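/- For a finite bipartite graph $G=(V,E)$ and $p\in(0,1]$, let $G_p$ be the random subgraph that contains each edge of $G$ independently with probability $p$, let $\nu(\cdot)$ denote the size of a minimum vertex cover, and for $Q\subseteq E$ let $Q_p$ be the set of edges of $Q$ that lie in $G_p$. Vertex sets are $\{0,\dots,n-1\}$, graphs are given to programs by $n$ and their adjacency matrices, and a program is a program with arrays of natural numbers, addition, truncated subtraction, branching, counting loops and fair coin flips, whose running time is its number of elementary steps. There are an integer $d$, a deterministic program $B$ and a constant $T_0$ such that for every bipartite $G$ on $n$ vertices, all $Q\subseteq E$ and every $R\subseteq Q$, the program $B$, given $(G,Q,R)$, outputs within $T_0(n+1)^d$ steps a minimum vertex cover of the graph $R\cup(E\setminus Q)$. Write $C_Q$ for its output on $(G,Q,Q_p)$; it depends on $G_p$ only through the outcome $Q_p$ of querying the edges of $Q$. Moreover, for every $\beta>\frac{e+1}{e}\approx1.3679$ there is a constant $K=K(\beta)$ such that for every $p\in(0,1]$ there are a randomized program $A$ and a constant $T$ (both depending only on $\beta$ and $p$) such that for every $n$ and every bipartite graph $G$ on $n$ vertices: 1. there is a subgraph $Q$ of $G$ of maximum degree at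 most $K/p^6$ such that $C_Q$ is a vertex cover of $G_p$ for every outcome of $G_p$, and $\mathbb E|C_Q|\le\beta\,\mathbb E[\nu(G_p)]$; 2. for every outcome of its coin flips, $A$ on input $G$ outputs within $T(n+1)^d$ steps a subgraph $Q$ of $G$ of maximum degree at most $K/p^6$; 3. (for $n\ge1$) with probability at least $1-1/n$ over the coin flips of $A$, the subgraph $Q$ found by $A$ has the properties of $C_Q$ stated in 1; 4. if $Q$ is the subgraph found by $A$, then $\mathbb E|C_Q|\le\beta\,\mathbb E[\nu(G_p)]$, where the expectation on the left is over both the coin flips of $A$ and, independently, $G_p$. -/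

import Mathlib

open ProbabilityTheory MeasureTheory

namespace StochVC

/-! ### A randomized array machine with a step count

Memory consists of two-dimensional arrays of natural numbers, named by natural numbers; a scalar
variable is the entry `(0, 0)` of an array. The only arithmetic is addition and truncated
subtraction, so after `t` steps every number has `O(t)` bits and unit cost is polynomially
equivalent to the number of steps of a (probabilistic) Turing machine. All loops are counting
loops, so every program halts on every input; its running time is the number of steps below. -/

/-- Arithmetic expressions; `read a i j` is the entry `(i, j)` of the array `a`. -/
inductive Expr : Type
  | const (c : ℕ)
  | read (a : ℕ) (i j : Expr)
  | add (e f : Expr)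
  | sub (e f : Expr)

/-- A machine state: the memory, and the fair coins that have not been used yet. -/
structure State : Type where
  mem : ℕ → ℕ → ℕ → ℕ
  coins : ℕ → Bool

/-- Write `v` into the entry `(i, j)` of the array `a`. -/
def State.write (s : State) (a i j v : ℕ) : State :=
  { s with mem := fun a' i' j' => if a' = a ∧ i' = i ∧ j' = j then v else s.mem a' i' j' }

/-- The value of an expression. -/
def Expr.eval (s : State) : Expr → ℕ
  | .const c => c
  | .read a i j => s.mem a (i.eval s) (j.eval s)
  | .add e f => e.eval s + f.eval s
  | .sub e f => e.eval s - f.eval s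

/-- The number of steps that the evaluation of an expression takes. -/
def Expr.cost : Expr → ℕ
  | .const _ => 1
  | .read _ i j => i.cost + j.cost + 1
  | .add e f => e.cost + f.cost + 1
  | .sub e f => e.cost + f.cost + 1

/-- Programs. -/
inductive Prog : Type
  /-- do nothing -/
  | skip
  /-- `a[i, j] := e` -/
  | assign (a : ℕ) (i j e : Expr)
  /-- `a[i, j] :=` the next coin, as `0` or `1` -/
  | flip (a : ℕ) (i j : Expr)
  /-- first `c`, then `d` -/
  | seq (c d : Prog)
  /-- `c` if `e ≠ 0`, and `d` otherwise -/
  | ite (e : Expr) (c d : Prog)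
  /-- for `a[0, 0] = 0, 1, …, e - 1` do `c`; the bound `e` is evaluated once, at the start -/
  | loop (a : ℕ) (e : Expr) (c : Prog)

/-- Execute `body 0, …, body (k - 1)` in this order, starting with `r`, and add up the steps. -/
def iterate (body : ℕ → State → State × ℕ) (r : State × ℕ) : ℕ → State × ℕ
  | 0 => r
  | k + 1 =>
    let q := iterate body r k
    let q' := body k q.1
    (q'.1, q.2 + q'.2 + 1)

/-- The final state of a program, and the number of steps that it makes. -/
def Prog.exec : Prog → State → State × ℕ
  | .skip, s => (s, 1)
  | .assign a i j e, s =>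
    (s.write a (i.eval s) (j.eval s) (e.eval s), i.cost + j.cost + e.cost + 1)
  | .flip a i j, s =>
    ({ s.write a (i.eval s) (j.eval s) (s.coins 0).toNat with coins := fun k => s.coins (k + 1) },
      i.cost + j.cost + 1)
  | .seq c d, s =>
    let r := c.exec s
    let r' := d.exec r.1
    (r'.1, r.2 + r'.2 + 1)
  | .ite e c d, s =>
    let r := if e.eval s ≠ 0 then c.exec s else d.exec s
    (r.1, e.cost + r.2 + 1)
  | .loop a e c, s =>
    iterate (fun k s' => c.exec (s'.write a 0 0 k)) (s, e.cost + 1) (e.eval s)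

/-! ### Coins -/

/-- The coin sequence that starts with the `m` given coins; what follows them is irrelevant for a
program that makes at most `m` steps. -/
def tape {m : ℕ} (r : Fin m → Bool) : ℕ → Bool :=
  fun k => if h : k < m then r ⟨k, h⟩ else false

/-- Expectation over `m` independent fair coins. -/
noncomputable def coinExp (m : ℕ) (f : (ℕ → Bool) → ℝ) : ℝ :=
  (∑ r : Fin m → Bool, f (tape r)) / 2 ^ m

open Classical in
/-- Probability of an event over `m` independent fair coins. -/
noncomputable def coinProb (m : ℕ) (P : (ℕ → Bool) → Prop) : ℝ :=
  coinExp m (fun ω => if P ω then 1 else 0)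

/-! ### Graphs as inputs and outputs -/

open Classical in
/-- The adjacency matrix of `G`, extended by zero. -/
noncomputable def adjEntry {n : ℕ} (G : SimpleGraph (Fin n)) (i j : ℕ) : ℕ :=
  if ∃ (hi : i < n) (hj : j < n), G.Adj ⟨i, hi⟩ ⟨j, hj⟩ then 1 else 0

/-- The input `G` of the first program: the number of vertices in array `0`, the adjacency matrix
in array `1`, and zero elsewhere. -/
noncomputable def graphInput {n : ℕ} (G : SimpleGraph (Fin n)) (ω : ℕ → Bool) : State where
  mem := fun a i j => match a with
    | 0 => if i = 0 ∧ j = 0 then n else 0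
    | 1 => adjEntry G i j
    | _ => 0
  coins := ω

/-- The input of the second program: as before, and moreover the queried graph `Q` in array `2` and
its realized edges `Qp` in array `3`. This program is deterministic: its coins are constant. -/
noncomputable def queryInput {n : ℕ} (G Q Qp : SimpleGraph (Fin n)) : State where
  mem := fun a i j => match a with
    | 0 => if i = 0 ∧ j = 0 then n else 0
    | 1 => adjEntry G i j
    | 2 => adjEntry Q i j
    | 3 => adjEntry Qp i j
    | _ => 0
  coins := fun _ => false

/-- The graph that is stored in array `4`. -/
def outputGraph (n : ℕ) (s : State) : SimpleGraph (Fin n) :=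
  SimpleGraph.fromRel fun i j => s.mem 4 i j ≠ 0

/-- The vertex set that is stored in column `0` of array `4`. -/
def outputSet (n : ℕ) (s : State) : Finset (Fin n) :=
  Finset.univ.filter fun v => s.mem 4 v 0 ≠ 0

/-- The graph to be queried that the program `A` finds for `G`, with coins `ω`. -/
noncomputable def findQuery (A : Prog) {n : ℕ} (G : SimpleGraph (Fin n)) (ω : ℕ → Bool) :
    SimpleGraph (Fin n) :=
  outputGraph n (A.exec (graphInput G ω)).1

/-- The number of steps of `A` on the input `G`, with coins `ω`. -/
noncomputable def findQueryTime (A : Prog) {n : ℕ} (G : SimpleGraph (Fin n)) (ω : ℕ → Bool) : ℕ :=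
  (A.exec (graphInput G ω)).2

/-- The vertex set that the program `B` finds from `G`, the queried graph `Q`, and the outcome `Qp`
of the queries. -/
noncomputable def findCover (B : Prog) {n : ℕ} (G Q Qp : SimpleGraph (Fin n)) : Finset (Fin n) :=
  outputSet n (B.exec (queryInput G Q Qp)).1

/-- The number of steps of `B` on the input `G, Q, Qp`. -/
noncomputable def findCoverTime (B : Prog) {n : ℕ} (G Q Qp : SimpleGraph (Fin n)) : ℕ :=
  (B.exec (queryInput G Q Qp)).2

/-! ### Stochastic vertex cover -/

/-- The expectation of `f (G_p)`, where `G_p` contains every edge of `G` independently with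
probability `p`. -/
noncomputable def expect {n : ℕ} (G : SimpleGraph (Fin n)) (p : unitInterval)
    (f : SimpleGraph (Fin n) → ℝ) : ℝ :=
  ∫ F, f (SimpleGraph.fromEdgeSet F) ∂(setBernoulli G.edgeSet p)

/-- `C` is a vertex cover of `H` of the least possible size. -/
def IsMinVertexCover {n : ℕ} (H : SimpleGraph (Fin n)) (C : Finset (Fin n)) : Prop :=
  H.IsVertexCover (C : Set (Fin n)) ∧
    ∀ D : Finset (Fin n), H.IsVertexCover (D : Set (Fin n)) → C.card ≤ D.card

/-- All degrees in `Q` are at most `D`. -/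
def DegreesLE {n : ℕ} (Q : SimpleGraph (Fin n)) (D : ℝ) : Prop :=
  ∀ v, ((Q.neighborSet v).ncard : ℝ) ≤ D

/-- The expected size of the set that `B` returns after querying `Q`; if `R` is the realization of
`G`, then the outcome of the queries is `Q ⊓ R`. -/
noncomputable def expectedCover (B : Prog) (p : unitInterval) {n : ℕ}
    (G Q : SimpleGraph (Fin n)) : ℝ :=
  expect G p fun R => ((findCover B G Q (Q ⊓ R)).card : ℝ)

/-- The expected size of a minimum vertex cover of `G_p`. -/
noncomputable def expectedNu (p : unitInterval) {n : ℕ} (G : SimpleGraph (Fin n)) : ℝ :=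
  expect G p fun R => (R.vertexCoverNum.toNat : ℝ)

/-- Querying `Q` only, `B` always returns a vertex cover of the realization of `G`, whose expected
size is at most `β` times that of a minimum vertex cover. -/
def Approximates (B : Prog) (β : ℝ) (p : unitInterval) {n : ℕ}
    (G Q : SimpleGraph (Fin n)) : Prop :=
  (∀ R ≤ G, R.IsVertexCover (findCover B G Q (Q ⊓ R) : Set (Fin n))) ∧
    expectedCover B p G Q ≤ β * expectedNu p G

end StochVC

/-! Write opt for the expected cover number of `G_p`; by König's theorem cover numbers are matching
numbers. Fix a small `ε` and a dyadic `p₁` between `(1 - 2ε)p` and `(1 - ε)p`. Starting from the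
empty graph, `R` rounds, with `R` of order `1/(ε^5 p)`, build an increasing sequence `Q_0, ..., Q_R
= Q`. In round `i` a fixed rule `S` selects a maximum matching of the candidate graph, which
consists of the `p₁`-random part of `Q_i` and of all edges outside `Q_i`. Edges that are selected
too often join `Q_{i+1}`. A vertex has few frequent edges, because its selection probabilities add
up to at most 1, so the final degrees are at most `2R²`.

Why `Q` is good: average the selection probabilities over the rounds, and split the average into `c`
(rounds in which the edge is already queried) and `m` (the other rounds). Then `c + m` is a
fractional matching whose total is at least `coverE χ p₁ G Q`, because `Q_i ≤ Q`. Selected queried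
edges are realized, so the total of `c` is at most opt. Finally `m ≤ 3/R` on every edge: an edge
that stays unqueried in a round has selection probability at most `2/R`, and it is added in at most
one round.

The lower bound on opt splits `G_p` into independent parts `G_{p₁}` and `G_q` with `q ≥ εp`. In
`G_{p₁}` every vertex of the first class looks at its own edges only, simulates everything else, and
proposes along its selected queried edge. The proposals are independent with law `c`, so on average
at least `(1 - 1/e)` times the total of `c` columns receive one (`mul_le_one_sub_prod`). The edges
of `G_q` between rows and columns without proposals carry loads with mean almost `m`; single loads
are small, so a second moment bound shows that they nearly form a fractional matching. A cover has
to pay for both structures (`card_cover_ge`, `proposal_bound`). Hence opt is at least `(1 - 1/e)c +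
m` in total, up to `O(ε)`; as the total of `c` is at most opt, the total of `c + m` is at most `(1 +
1/e + O(ε))` opt. Passing from `p₁` back to `p` is thinning (`coverE_thin`), and the result is
`coverE_le_of_goodChain`.

Algorithms: `S` is `auctionRule`, the outcome of an auction whose final prices yield a cover of the
same size (`AuctionInv.exists_cover`). The program `B` is a greedy search that calls the auction to
compute cover numbers (`coverProg_post`). The program `A` replaces selection probabilities by sample
frequencies and fails to produce a good chain with probability `O(1/n)` (`queryProg_avg_le`); even
then the cover costs at most `opt/p` (`coverE_le_div`), so the expectation survives. Programs are
analysed with two transformers: `Prog.Post` for all coin outcomes, and `Prog.avg` for expectations,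
which `Prog.coinAvg_exec` identifies with averages over coin sequences. -/

namespace StochVC

set_option linter.unusedSectionVars false

/-! ### Semantics on memories -/

/-- The contents of the memory. -/
abbrev Mem : Type := ℕ → ℕ → ℕ → ℕ

/-- The memory `m` with `v` in the entry `(i, j)` of the array `a`. -/
def wr (m : Mem) (a i j v : ℕ) : Mem :=
  fun a' i' j' => if a' = a ∧ i' = i ∧ j' = j then v else m a' i' j'

theorem wr_apply (m : Mem) (a i j v a' i' j' : ℕ) :
    wr m a i j v a' i' j' = if a' = a ∧ i' = i ∧ j' = j then v else m a' i' j' := rfl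

theorem wr_ne (m : Mem) {a a' : ℕ} (h : a' ≠ a) (i j v : ℕ) : wr m a i j v a' = m a' := by
  funext i' j'
  simp [wr, h]

theorem State.write_eq (s : State) (a i j v : ℕ) : s.write a i j v = ⟨wr s.mem a i j v, s.coins⟩ :=
  rfl

/-- The value of an expression, as a function of the memory. -/
def Expr.val (m : Mem) : Expr → ℕ
  | .const c => c
  | .read a i j => m a (i.val m) (j.val m)
  | .add e f => e.val m + f.val m
  | .sub e f => e.val m - f.val m

theorem Expr.eval_eq (s : State) (e : Expr) : e.eval s = e.val s.mem := by
  induction e with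
  | const c => rfl
  | read a i j hi hj => simp [Expr.eval, Expr.val, hi, hj]
  | add e f he hf => simp [Expr.eval, Expr.val, he, hf]
  | sub e f he hf => simp [Expr.eval, Expr.val, he, hf]

/-- Iterated predicate transformers. -/
def loopPost (B : ℕ → (Mem → Prop) → Mem → Prop) : ℕ → (Mem → Prop) → Mem → Prop
  | 0, P => P
  | k + 1, P => loopPost B k (B k P)

/-- The property `P` holds after every execution of the program from the memory `m`. -/
def Prog.Post : Prog → (Mem → Prop) → Mem → Prop
  | .skip, P, m => P m
  | .assign a i j e, P, m => P (wr m a (i.val m) (j.val m) (e.val m))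
  | .flip a i j, P, m => P (wr m a (i.val m) (j.val m) 0) ∧ P (wr m a (i.val m) (j.val m) 1)
  | .seq c d, P, m => c.Post (d.Post P) m
  | .ite e c d, P, m => (e.val m ≠ 0 → c.Post P m) ∧ (e.val m = 0 → d.Post P m)
  | .loop a e c, P, m => loopPost (fun k P m => c.Post P (wr m a 0 0 k)) (e.val m) P m

theorem loopPost_mono {B : ℕ → (Mem → Prop) → Mem → Prop}
    (hB : ∀ k P P' m, (∀ m, P m → P' m) → B k P m → B k P' m) {K : ℕ} {P P' : Mem → Prop}
    (h : ∀ m, P m → P' m) {m : Mem} (hP : loopPost B K P m) : loopPost B K P' m := by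
  induction K generalizing P P' with
  | zero => exact h m hP
  | succ k ih => exact ih (fun m hm => hB k P P' m h hm) hP

theorem Prog.Post.mono {c : Prog} {P P' : Mem → Prop} {m : Mem} (hP : c.Post P m)
    (h : ∀ m, P m → P' m) : c.Post P' m := by
  induction c generalizing P P' m with
  | skip => exact h _ hP
  | assign => exact h _ hP
  | flip => exact ⟨h _ hP.1, h _ hP.2⟩
  | seq c d hc hd => exact hc hP fun m hm => hd hm h
  | ite e c d hc hd => exact ⟨fun he => hc (hP.1 he) h, fun he => hd (hP.2 he) h⟩
  | loop a e c hc =>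
    exact loopPost_mono (B := fun k P m => c.Post P (wr m a 0 0 k))
      (fun k P P' m hPP hB => hc hB hPP) h hP

/-- Loop invariants. -/
theorem Prog.Post.loop {a : ℕ} {e : Expr} {c : Prog} {m : Mem} {P : Mem → Prop}
    (I : ℕ → Mem → Prop) (h0 : I 0 m)
    (hstep : ∀ k < e.val m, ∀ m', I k m' → c.Post (I (k + 1)) (wr m' a 0 0 k))
    (hP : ∀ m', I (e.val m) m' → P m') : (Prog.loop a e c).Post P m := by
  -- The postcondition is generalised because `loopPost` peels off the last iteration and turns the
  -- postcondition into a precondition of that iteration.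
  have key : ∀ K ≤ e.val m, ∀ P : Mem → Prop, (∀ m', I K m' → P m') →
      loopPost (fun k P m => c.Post P (wr m a 0 0 k)) K P m := by
    intro K
    induction K with
    | zero => exact fun _ P hP => hP m h0
    | succ k ih =>
      intro hk P hP
      exact ih (by omega) _ fun m' hm' => (hstep k hk m' hm').mono hP
  exact key _ le_rfl P hP

/-- Every execution satisfies the postcondition. -/
theorem Prog.Post.exec {c : Prog} {P : Mem → Prop} {m : Mem} (hP : c.Post P m) (ω : ℕ → Bool) :
    P (c.exec ⟨m, ω⟩).1.mem := by
  induction c generalizing P m ω with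
  | skip => exact hP
  | assign a i j e =>
    simp only [Prog.exec, State.write_eq, Expr.eval_eq]
    exact hP
  | flip a i j =>
    simp only [Prog.exec, State.write_eq, Expr.eval_eq]
    cases ω 0
    · exact hP.1
    · exact hP.2
  | seq c d hc hd => exact hd (m := (c.exec ⟨m, ω⟩).1.mem) (hc hP ω) _
  | ite e c d hc hd =>
    simp only [Prog.exec, Expr.eval_eq]
    by_cases he : e.val m = 0
    · simpa [he] using hd (hP.2 he) ω
    · simpa [he] using hc (hP.1 he) ω
  | loop a e c hc =>
    simp only [Prog.exec, Expr.eval_eq]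
    have key : ∀ (K : ℕ) (r : ℕ) (P : Mem → Prop),
        loopPost (fun k P m => c.Post P (wr m a 0 0 k)) K P m →
        P (iterate (fun k s' => c.exec (s'.write a 0 0 k)) (⟨m, ω⟩, r) K).1.mem := by
      intro K r
      induction K with
      | zero => exact fun P h => h
      | succ k ih =>
        intro P h
        have h1 := ih _ h
        exact hc h1 _
    exact key _ _ P hP

/-! ### Syntactic properties of programs -/

/-- The program does not write into the array `a`. -/
def Prog.NoWrite (a : ℕ) : Prog → Prop
  | .skip => True
  | .assign b _ _ _ => b ≠ a
  | .flip b _ _ => b ≠ a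
  | .seq c d => c.NoWrite a ∧ d.NoWrite a
  | .ite _ c d => c.NoWrite a ∧ d.NoWrite a
  | .loop b _ c => b ≠ a ∧ c.NoWrite a

theorem loopPost_and {B : ℕ → (Mem → Prop) → Mem → Prop}
    (hmono : ∀ k P P' m, (∀ m, P m → P' m) → B k P m → B k P' m)
    (hB : ∀ k P P' m, B k P m → B k P' m → B k (fun m => P m ∧ P' m) m) {K : ℕ}
    {P P' : Mem → Prop} {m : Mem} (h : loopPost B K P m) (h' : loopPost B K P' m) :
    loopPost B K (fun m => P m ∧ P' m) m := by
  induction K generalizing P P' with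
  | zero => exact ⟨h, h'⟩
  | succ k ih => exact loopPost_mono hmono (fun m hm => hB k P P' m hm.1 hm.2) (ih h h')

theorem Prog.Post.and {c : Prog} {P P' : Mem → Prop} {m : Mem} (hP : c.Post P m)
    (hP' : c.Post P' m) : c.Post (fun m => P m ∧ P' m) m := by
  induction c generalizing P P' m with
  | skip => exact ⟨hP, hP'⟩
  | assign => exact ⟨hP, hP'⟩
  | flip => exact ⟨⟨hP.1, hP'.1⟩, ⟨hP.2, hP'.2⟩⟩
  | seq c d hc hd => exact (hc hP hP').mono fun m hm => hd hm.1 hm.2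
  | ite e c d hc hd => exact ⟨fun he => hc (hP.1 he) (hP'.1 he), fun he => hd (hP.2 he) (hP'.2 he)⟩
  | loop a e c hc =>
    exact loopPost_and (B := fun k P m => c.Post P (wr m a 0 0 k))
      (fun k P P' m hPP hB => Prog.Post.mono hB hPP)
      (fun k P P' m h1 h2 => hc h1 h2) hP hP'

/-- A program changes only the arrays that it writes into. -/
theorem Prog.frame (c : Prog) (m : Mem) : c.Post (fun m' => ∀ a, c.NoWrite a → m' a = m a) m := by
  induction c generalizing m with
  | skip => exact fun _ _ => rfl
  | assign b i j e => exact fun a h => wr_ne m (Ne.symm h) _ _ _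
  | flip b i j =>
    exact ⟨fun a h => wr_ne m (Ne.symm h) _ _ _, fun a h => wr_ne m (Ne.symm h) _ _ _⟩
  | seq c d hc hd =>
    exact (hc m).mono fun m' hm' => (hd m').mono fun _ h a ha => (h a ha.2).trans (hm' a ha.1)
  | ite e c d hc hd =>
    exact ⟨fun _ => (hc m).mono fun _ h a ha => h a ha.1,
      fun _ => (hd m).mono fun _ h a ha => h a ha.2⟩
  | loop b e c hc =>
    refine Prog.Post.loop (fun _ m' => ∀ a, (Prog.loop b e c).NoWrite a → m' a = m a)
      (fun _ _ => rfl) ?_ fun _ h => h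
    intro k _ m' hm'
    refine (hc _).mono fun m'' h'' a ha => (h'' a ha.2).trans ?_
    rw [wr_ne _ (Ne.symm ha.1), hm' a ha]

theorem Prog.NoWrite.post {a : ℕ} {c : Prog} (h : c.NoWrite a) (m : Mem) :
    c.Post (fun m' => m' a = m a) m := (c.frame m).mono fun _ hf => hf a h

/-- The postcondition may use that the arrays that are not written are unchanged. -/
theorem Prog.Post.framed {c : Prog} {m : Mem} {P : Mem → Prop}
    (h : c.Post (fun m' => (∀ a, c.NoWrite a → m' a = m a) → P m') m) : c.Post P m :=
  ((c.frame m).and h).mono fun _ h => h.2 h.1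

/-- All writes into the array `a` go to its entry `(0, 0)`. -/
def Prog.Scalar (a : ℕ) : Prog → Prop
  | .skip => True
  | .assign b i j _ => b = a → i = .const 0 ∧ j = .const 0
  | .flip b i j => b = a → i = .const 0 ∧ j = .const 0
  | .seq c d => c.Scalar a ∧ d.Scalar a
  | .ite _ c d => c.Scalar a ∧ d.Scalar a
  | .loop _ _ c => c.Scalar a

theorem wr_scalar {m : Mem} {a b i j : ℕ} (h : b = a → i = 0 ∧ j = 0) (v : ℕ) {i' j' : ℕ}
    (hij : i' ≠ 0 ∨ j' ≠ 0) : wr m b i j v a i' j' = m a i' j' := by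
  rw [wr_apply, if_neg]
  rintro ⟨rfl, rfl, rfl⟩
  have := h rfl
  omega

theorem Prog.Scalar.post {a : ℕ} {c : Prog} (h : c.Scalar a) (m : Mem) :
    c.Post (fun m' => ∀ i j, (i ≠ 0 ∨ j ≠ 0) → m' a i j = m a i j) m := by
  induction c generalizing m with
  | skip => exact fun _ _ _ => rfl
  | assign b i j e =>
    refine fun i' j' hij => wr_scalar (fun hb => ?_) _ hij
    obtain ⟨rfl, rfl⟩ := h hb
    exact ⟨rfl, rfl⟩
  | flip b i j =>
    constructor
    all_goals
      refine fun i' j' hij => wr_scalar (fun hb => ?_) _ hij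
      obtain ⟨rfl, rfl⟩ := h hb
      exact ⟨rfl, rfl⟩
  | seq c d hc hd =>
    exact (hc h.1 m).mono fun m' hm' => (hd h.2 m').mono fun _ h i j hij =>
      (h i j hij).trans (hm' i j hij)
  | ite e c d hc hd => exact ⟨fun _ => hc h.1 m, fun _ => hd h.2 m⟩
  | loop b e c hc =>
    refine Prog.Post.loop (fun _ m' => ∀ i j, (i ≠ 0 ∨ j ≠ 0) → m' a i j = m a i j)
      (fun _ _ _ => rfl) ?_ fun _ h => h
    intro k _ m' hm'
    refine (hc h _).mono fun m'' h'' i j hij => (h'' i j hij).trans ?_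
    rw [wr_scalar (fun _ => ⟨rfl, rfl⟩) _ hij, hm' i j hij]

/-- Expressions that only use constants and the entry `(0, 0)` of the array `0`. -/
def Expr.IsSize : Expr → Prop
  | .const _ => True
  | .read a i j => a = 0 ∧ i = .const 0 ∧ j = .const 0
  | .add e f => e.IsSize ∧ f.IsSize
  | .sub _ _ => False

/-- The value of such an expression. -/
def Expr.sizeVal (n : ℕ) : Expr → ℕ
  | .const c => c
  | .read _ _ _ => n
  | .add e f => e.sizeVal n + f.sizeVal n
  | .sub _ _ => 0

theorem Expr.IsSize.val_eq {e : Expr} (h : e.IsSize) (m : Mem) : e.val m = e.sizeVal (m 0 0 0) := by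
  induction e with
  | const c => rfl
  | read a i j =>
    obtain ⟨rfl, rfl, rfl⟩ := h
    rfl
  | add e f he hf => simp [Expr.val, Expr.sizeVal, he h.1, hf h.2]
  | sub e f => exact h.elim

theorem Expr.IsSize.exists_le {e : Expr} (h : e.IsSize) : ∃ k, ∀ n, e.sizeVal n ≤ k * (n + 1) := by
  induction e with
  | const c => exact ⟨c, fun n => by simp only [Expr.sizeVal]; nlinarith⟩
  | read a i j => exact ⟨1, fun n => by simp only [Expr.sizeVal]; omega⟩
  | add e f he hf =>
    obtain ⟨k, hk⟩ := he h.1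
    obtain ⟨l, hl⟩ := hf h.2
    refine ⟨k + l, fun n => ?_⟩
    simp only [Expr.sizeVal, add_mul]
    exact add_le_add (hk n) (hl n)
  | sub e f => exact h.elim

/-- The program does not write into the array `0`, which bounds all its loops. -/
def Prog.Bounded : Prog → Prop
  | .skip => True
  | .assign b _ _ _ => b ≠ 0
  | .flip b _ _ => b ≠ 0
  | .seq c d => c.Bounded ∧ d.Bounded
  | .ite _ c d => c.Bounded ∧ d.Bounded
  | .loop b e c => b ≠ 0 ∧ e.IsSize ∧ c.Bounded

theorem Prog.Bounded.noWrite {c : Prog} (h : c.Bounded) : c.NoWrite 0 := by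
  induction c with
  | skip => trivial
  | assign => exact h
  | flip => exact h
  | seq c d hc hd => exact ⟨hc h.1, hd h.2⟩
  | ite e c d hc hd => exact ⟨hc h.1, hd h.2⟩
  | loop b e c hc => exact ⟨h.1, hc h.2.2⟩

/-- The depth of nested loops. -/
def Prog.depth : Prog → ℕ
  | .seq c d => max c.depth d.depth
  | .ite _ c d => max c.depth d.depth
  | .loop _ _ c => c.depth + 1
  | _ => 0

/-- The array `0` never changes, so in every reachable state all loop bounds are the same linear
expressions in the input size; each level of nesting costs one factor `n + 1`. -/
theorem Prog.Bounded.exists_cost_le {c : Prog} (h : c.Bounded) :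
    ∃ T, ∀ s : State, (c.exec s).2 ≤ T * (s.mem 0 0 0 + 1) ^ c.depth := by
  have pow_up : ∀ (T n : ℕ) {d d' : ℕ}, d ≤ d' → T * (n + 1) ^ d ≤ T * (n + 1) ^ d' :=
    fun T n d d' hd => Nat.mul_le_mul_left _ (Nat.pow_le_pow_right (by omega) hd)
  have one_le : ∀ n d : ℕ, 1 ≤ (n + 1) ^ d := fun n d => Nat.one_le_pow _ _ (by omega)
  induction c with
  | skip => exact ⟨1, fun s => by simp [Prog.exec, Prog.depth]⟩
  | assign a i j e =>
    exact ⟨i.cost + j.cost + e.cost + 1, fun s => by simp [Prog.exec, Prog.depth]⟩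
  | flip a i j => exact ⟨i.cost + j.cost + 1, fun s => by simp [Prog.exec, Prog.depth]⟩
  | seq c d hc hd =>
    obtain ⟨T, hT⟩ := hc h.1
    obtain ⟨T', hT'⟩ := hd h.2
    refine ⟨T + T' + 1, fun s => ?_⟩
    have h0 : (c.exec s).1.mem 0 = s.mem 0 := (h.1.noWrite.post s.mem).exec s.coins
    have h1 := hT s
    have h2 := hT' (c.exec s).1
    rw [h0] at h2
    have h3 := pow_up T (s.mem 0 0 0) (le_max_left c.depth d.depth)
    have h4 := pow_up T' (s.mem 0 0 0) (le_max_right c.depth d.depth)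
    have h5 := one_le (s.mem 0 0 0) (max c.depth d.depth)
    simp only [Prog.exec, Prog.depth, add_mul]
    omega
  | ite e c d hc hd =>
    obtain ⟨T, hT⟩ := hc h.1
    obtain ⟨T', hT'⟩ := hd h.2
    refine ⟨T + T' + (e.cost + 1), fun s => ?_⟩
    have h1 := hT s
    have h2 := hT' s
    have h3 := pow_up T (s.mem 0 0 0) (le_max_left c.depth d.depth)
    have h4 := pow_up T' (s.mem 0 0 0) (le_max_right c.depth d.depth)
    have h5 := Nat.mul_le_mul_left (e.cost + 1) (one_le (s.mem 0 0 0) (max c.depth d.depth))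
    simp only [Prog.exec, Prog.depth, add_mul] at h5 ⊢
    split_ifs <;> omega
  | loop a e c hc =>
    obtain ⟨T, hT⟩ := hc h.2.2
    obtain ⟨k, hk⟩ := h.2.1.exists_le
    refine ⟨k * (T + 1) + (e.cost + 1), fun s => ?_⟩
    have key : ∀ K, (iterate (fun k s' => c.exec (s'.write a 0 0 k)) (s, e.cost + 1) K).1.mem 0 =
        s.mem 0 ∧ (iterate (fun k s' => c.exec (s'.write a 0 0 k)) (s, e.cost + 1) K).2 ≤
        e.cost + 1 + K * (T * (s.mem 0 0 0 + 1) ^ c.depth + 1) := by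
      intro K
      induction K with
      | zero => simp [iterate]
      | succ K ih =>
        set q := iterate (fun k s' => c.exec (s'.write a 0 0 k)) (s, e.cost + 1) K with hq
        have hw : (q.1.write a 0 0 K).mem 0 = s.mem 0 := by
          rw [State.write_eq]; exact (wr_ne _ (Ne.symm h.1) _ _ _).trans ih.1
        have h1 := hT (q.1.write a 0 0 K)
        rw [hw] at h1
        refine ⟨?_, ?_⟩
        · exact ((h.2.2.noWrite.post (q.1.write a 0 0 K).mem).exec q.1.coins).trans hw
        · simp only [iterate]
          rw [add_mul K 1]
          have := ih.2
          simp only [← hq]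
          omega
    have h1 := (key (e.eval s)).2
    have h2 : e.eval s ≤ k * (s.mem 0 0 0 + 1) := by
      rw [Expr.eval_eq, h.2.1.val_eq]; exact hk _
    have h3 : e.eval s * (T * (s.mem 0 0 0 + 1) ^ c.depth + 1) ≤
        k * (T + 1) * (s.mem 0 0 0 + 1) ^ (c.depth + 1) := by
      calc _ ≤ k * (s.mem 0 0 0 + 1) * (T * (s.mem 0 0 0 + 1) ^ c.depth +
            (s.mem 0 0 0 + 1) ^ c.depth) :=
            Nat.mul_le_mul h2 (Nat.add_le_add_left (one_le _ _) _)
        _ = _ := by ring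
    have h5 := Nat.mul_le_mul_left (e.cost + 1) (one_le (s.mem 0 0 0) (c.depth + 1))
    simp only [Prog.exec, Prog.depth]
    rw [add_mul]
    omega

/-! ### Deterministic programs -/

theorem iterate_succ_fst (body : ℕ → State → State × ℕ) (r : State × ℕ) (K : ℕ) :
    (iterate body r (K + 1)).1 = (body K (iterate body r K).1).1 := rfl

/-- The program does not flip coins. -/
def Prog.NoFlip : Prog → Prop
  | .skip => True
  | .assign _ _ _ _ => True
  | .flip _ _ _ => False
  | .seq c d => c.NoFlip ∧ d.NoFlip
  | .ite _ c d => c.NoFlip ∧ d.NoFlip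
  | .loop _ _ c => c.NoFlip

/-- The memory after the execution of a program, all of whose coins show `0`. -/
def Prog.run (c : Prog) (m : Mem) : Mem := (c.exec ⟨m, fun _ => false⟩).1.mem

/-- Without flips the coins pass through untouched, so the program acts as the function `run` on
memories. -/
theorem Prog.NoFlip.exec_eq {c : Prog} (h : c.NoFlip) (m : Mem) (ω : ℕ → Bool) :
    (c.exec ⟨m, ω⟩).1 = ⟨c.run m, ω⟩ := by
  suffices key : ∀ ω ω', (c.exec ⟨m, ω⟩).1 = ⟨(c.exec ⟨m, ω'⟩).1.mem, ω⟩ from key ω _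
  clear ω
  induction c generalizing m with
  | skip => intro ω ω'; rfl
  | assign a i j e =>
    intro ω ω'
    simp only [Prog.exec, Expr.eval_eq, State.write_eq]
  | flip => exact h.elim
  | seq c d hc hd =>
    intro ω ω'
    simp only [Prog.exec]
    rw [hc h.1 m ω ω', hc h.1 m ω' ω', hd h.2 _ ω ω']
  | ite e c d hc hd =>
    intro ω ω'
    simp only [Prog.exec, Expr.eval_eq]
    by_cases he : e.val m = 0
    · simpa [he] using hd h.2 m ω ω'
    · simpa [he] using hc h.1 m ω ω'
  | loop a e c hc =>
    intro ω ω'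
    simp only [Prog.exec, Expr.eval_eq]
    generalize e.val m = K
    induction K with
    | zero => rfl
    | succ K ih =>
      have h' : (iterate (fun k s' => c.exec (s'.write a 0 0 k)) (⟨m, ω'⟩, e.cost + 1) K).1.coins =
          ω' := by
        clear ih
        induction K with
        | zero => rfl
        | succ K ih =>
          rw [iterate_succ_fst, State.write_eq, hc h _ _ ω', ih]
      rw [iterate_succ_fst, iterate_succ_fst, ih, State.write_eq, State.write_eq, h',
        hc h _ ω ω']

theorem Prog.Post.run {c : Prog} {P : Mem → Prop} {m : Mem} (h : c.Post P m) : P (c.run m) :=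
  h.exec _

/-- The program only uses the arrays in `A`. -/
def Expr.Within (A : ℕ → Prop) : Expr → Prop
  | .const _ => True
  | .read a i j => A a ∧ i.Within A ∧ j.Within A
  | .add e f => e.Within A ∧ f.Within A
  | .sub e f => e.Within A ∧ f.Within A

/-- The program only uses the arrays in `A`. -/
def Prog.Within (A : ℕ → Prop) : Prog → Prop
  | .skip => True
  | .assign a i j e => A a ∧ i.Within A ∧ j.Within A ∧ e.Within A
  | .flip a i j => A a ∧ i.Within A ∧ j.Within A
  | .seq c d => c.Within A ∧ d.Within A
  | .ite e c d => e.Within A ∧ c.Within A ∧ d.Within A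
  | .loop a e c => A a ∧ e.Within A ∧ c.Within A

theorem Expr.Within.val_eq {A : ℕ → Prop} {e : Expr} (h : e.Within A) {m m' : Mem}
    (hm : ∀ a, A a → m a = m' a) : e.val m = e.val m' := by
  induction e with
  | const => rfl
  | read a i j hi hj => simp only [Expr.val, hm a h.1, hi h.2.1, hj h.2.2]
  | add e f he hf => simp only [Expr.val, he h.1, hf h.2]
  | sub e f he hf => simp only [Expr.val, he h.1, hf h.2]

theorem wr_agree {A : ℕ → Prop} {m m' : Mem} (hm : ∀ a, A a → m a = m' a) (b i j v : ℕ) :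
    ∀ a, A a → wr m b i j v a = wr m' b i j v a := by
  intro a ha
  funext i' j'
  simp only [wr, hm a ha]

/-- Needed for the auction: its matching must be a function of the input relation alone, whatever
the surrounding program keeps in other arrays. -/
theorem Prog.Within.exec_agree {A : ℕ → Prop} {c : Prog} (h : c.Within A) {m m' : Mem}
    (hm : ∀ a, A a → m a = m' a) (ω : ℕ → Bool) :
    (∀ a, A a → (c.exec ⟨m, ω⟩).1.mem a = (c.exec ⟨m', ω⟩).1.mem a) ∧
      (c.exec ⟨m, ω⟩).1.coins = (c.exec ⟨m', ω⟩).1.coins := by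
  induction c generalizing m m' ω with
  | skip => exact ⟨hm, rfl⟩
  | assign b i j e =>
    simp only [Prog.exec, Expr.eval_eq, State.write_eq]
    rw [h.2.1.val_eq hm, h.2.2.1.val_eq hm, h.2.2.2.val_eq hm]
    exact ⟨wr_agree hm _ _ _ _, trivial⟩
  | flip b i j =>
    simp only [Prog.exec, Expr.eval_eq, State.write_eq]
    rw [h.2.1.val_eq hm, h.2.2.val_eq hm]
    exact ⟨wr_agree hm _ _ _ _, trivial⟩
  | seq c d hc hd =>
    simp only [Prog.exec]
    have h1 := hc h.1 hm ω
    have h2 := hd h.2 h1.1 (c.exec ⟨m, ω⟩).1.coins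
    rw [show (⟨(c.exec ⟨m', ω⟩).1.mem, (c.exec ⟨m, ω⟩).1.coins⟩ : State) = (c.exec ⟨m', ω⟩).1 by
      rw [h1.2]] at h2
    exact h2
  | ite e c d hc hd =>
    simp only [Prog.exec, Expr.eval_eq]
    rw [h.1.val_eq hm]
    by_cases he : e.val m' = 0
    · simpa [he] using hd h.2.2 hm ω
    · simpa [he] using hc h.2.1 hm ω
  | loop b e c hc =>
    simp only [Prog.exec, Expr.eval_eq]
    rw [h.2.1.val_eq hm]
    generalize e.val m' = K
    induction K with
    | zero => exact ⟨hm, rfl⟩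
    | succ K ih =>
      rw [iterate_succ_fst, iterate_succ_fst, State.write_eq, State.write_eq]
      have h2 := hc h.2.2 (wr_agree ih.1 b 0 0 K)
        (iterate (fun k s' => c.exec (s'.write b 0 0 k)) (⟨m, ω⟩, e.cost + 1) K).1.coins
      rw [← ih.2]
      exact h2

theorem Prog.Within.run_agree {A : ℕ → Prop} {c : Prog} (h : c.Within A) {m m' : Mem}
    (hm : ∀ a, A a → m a = m' a) : ∀ a, A a → c.run m a = c.run m' a :=
  (h.exec_agree hm _).1

/-! ### Expectations over finite products -/

section ProdExpectation

variable {ι Ω Ω₁ Ω₂ : Type*} [Fintype ι] [DecidableEq ι] [Fintype Ω] [DecidableEq Ω]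
  [Fintype Ω₁] [Fintype Ω₂]

/-- The expectation of `f` when the coordinates are independent and have the weights `w i`. -/
noncomputable def prodE (w : ι → Ω₁ → ℝ) (f : (ι → Ω₁) → ℝ) : ℝ :=
  ∑ z, (∏ i, w i (z i)) * f z

theorem prodE_prod (w : ι → Ω₁ → ℝ) (g : ι → Ω₁ → ℝ) :
    prodE w (fun z => ∏ i, g i (z i)) = ∏ i, ∑ x, w i x * g i x := by
  classical
  unfold prodE
  rw [Finset.prod_univ_sum, Fintype.piFinset_univ]
  simp [Finset.prod_mul_distrib]

theorem prodE_const {w : ι → Ω₁ → ℝ} (hw : ∀ i, ∑ x, w i x = 1) (c : ℝ) :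
    prodE w (fun _ => c) = c := by
  have h := prodE_prod w (fun _ _ => 1)
  simp only [Finset.prod_const_one, mul_one, hw] at h
  unfold prodE at h ⊢
  simp only [mul_one] at h
  rw [← Finset.sum_mul, h, one_mul]

theorem prodE_mono {w : ι → Ω₁ → ℝ} (hw : ∀ i x, 0 ≤ w i x) {f g : (ι → Ω₁) → ℝ}
    (h : ∀ z, f z ≤ g z) : prodE w f ≤ prodE w g :=
  Finset.sum_le_sum fun z _ =>
    mul_le_mul_of_nonneg_left (h z) (Finset.prod_nonneg fun i _ => hw i _)

theorem prodE_nonneg {w : ι → Ω₁ → ℝ} (hw : ∀ i x, 0 ≤ w i x) {f : (ι → Ω₁) → ℝ}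
    (h : ∀ z, 0 ≤ f z) : 0 ≤ prodE w f :=
  Finset.sum_nonneg fun z _ => mul_nonneg (Finset.prod_nonneg fun i _ => hw i _) (h z)

theorem prodE_add (w : ι → Ω₁ → ℝ) (f g : (ι → Ω₁) → ℝ) :
    prodE w (fun z => f z + g z) = prodE w f + prodE w g := by
  simp [prodE, mul_add, Finset.sum_add_distrib]

theorem prodE_sub (w : ι → Ω₁ → ℝ) (f g : (ι → Ω₁) → ℝ) :
    prodE w (fun z => f z - g z) = prodE w f - prodE w g := by
  simp [prodE, mul_sub, Finset.sum_sub_distrib]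

theorem prodE_mul_left (w : ι → Ω₁ → ℝ) (c : ℝ) (f : (ι → Ω₁) → ℝ) :
    prodE w (fun z => c * f z) = c * prodE w f := by
  simp only [prodE, Finset.mul_sum]
  exact Finset.sum_congr rfl fun z _ => by ring

theorem prodE_mul_right (w : ι → Ω₁ → ℝ) (c : ℝ) (f : (ι → Ω₁) → ℝ) :
    prodE w (fun z => f z * c) = prodE w f * c := by
  simp only [prodE, Finset.sum_mul]
  exact Finset.sum_congr rfl fun z _ => by ring

theorem prodE_sum {κ : Type*} (s : Finset κ) (w : ι → Ω₁ → ℝ) (f : κ → (ι → Ω₁) → ℝ) :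
    prodE w (fun z => ∑ k ∈ s, f k z) = ∑ k ∈ s, prodE w (f k) := by
  simp only [prodE, Finset.mul_sum]
  exact Finset.sum_comm

/-- Point indicators factor over the coordinates, so identities for arbitrary `f` reduce to
`prodE_prod`. -/
theorem eq_sum_points (f : (ι → Ω) → ℝ) (z : ι → Ω) :
    f z = ∑ y, f y * ∏ i, (if z i = y i then 1 else 0) := by
  have h : ∀ y : ι → Ω, (∏ i, (if z i = y i then 1 else 0) : ℝ) = if z = y then 1 else 0 := by
    intro y
    rw [Finset.prod_ite_zero]
    simp [funext_iff]
  simp [h]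

/-- Combining two independent outcomes coordinate by coordinate. -/
theorem prodE_comp {w₁ : ι → Ω₁ → ℝ} {w₂ : ι → Ω₂ → ℝ} {w : ι → Ω → ℝ} (op : Ω₁ → Ω₂ → Ω)
    (h : ∀ i x, w i x = ∑ a, w₁ i a * ∑ b, w₂ i b * (if op a b = x then 1 else 0))
    (f : (ι → Ω) → ℝ) :
    prodE w₁ (fun z₁ => prodE w₂ (fun z₂ => f (fun i => op (z₁ i) (z₂ i)))) = prodE w f := by
  have key : ∀ y : ι → Ω, prodE w₁ (fun z₁ => prodE w₂ (fun z₂ =>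
      ∏ i, (if op (z₁ i) (z₂ i) = y i then 1 else 0))) = ∏ i, w i (y i) := by
    intro y
    have h1 : ∀ z₁ : ι → Ω₁, prodE w₂ (fun z₂ =>
        ∏ i, (if op (z₁ i) (z₂ i) = y i then (1 : ℝ) else 0)) =
        ∏ i, ∑ b, w₂ i b * (if op (z₁ i) b = y i then 1 else 0) := fun z₁ =>
      prodE_prod w₂ (fun i b => if op (z₁ i) b = y i then 1 else 0)
    simp only [h1]
    rw [prodE_prod w₁ (fun i a => ∑ b, w₂ i b * (if op a b = y i then 1 else 0))]
    simp [h]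
  have h2 : ∀ (z₁ : ι → Ω₁) (z₂ : ι → Ω₂), f (fun i => op (z₁ i) (z₂ i)) =
      ∑ y, f y * ∏ i, (if op (z₁ i) (z₂ i) = y i then 1 else 0) := fun z₁ z₂ =>
    eq_sum_points f _
  simp only [h2, prodE_sum, prodE_mul_left, key]
  unfold prodE
  exact Finset.sum_congr rfl fun y _ => mul_comm _ _

/-- Resampling one coordinate does not change an expectation. -/
theorem prodE_update {w : ι → Ω → ℝ} (i : ι) (hw : ∑ x, w i x = 1) (f : (ι → Ω) → ℝ) :
    ∑ x, w i x * prodE w (fun z => f (Function.update z i x)) = prodE w f := by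
  have key : ∀ (y : ι → Ω) (x : Ω), prodE w (fun z =>
      ∏ j, (if Function.update z i x j = y j then 1 else 0)) =
      (if x = y i then 1 else 0) * ∏ j ∈ Finset.univ.erase i, w j (y j) := by
    intro y x
    have h1 : ∀ z : ι → Ω, (∏ j, (if Function.update z i x j = y j then 1 else 0) : ℝ) =
        ∏ j, (if j = i then (if x = y i then 1 else 0) else (if z j = y j then 1 else 0)) := by
      intro z
      refine Finset.prod_congr rfl fun j _ => ?_
      by_cases hj : j = i
      · subst hj; simp
      · simp [hj]
    simp only [h1]
    rw [prodE_prod w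
      (fun j b => if j = i then (if x = y i then 1 else 0) else (if b = y j then 1 else 0)),
      ← Finset.mul_prod_erase _ _ (Finset.mem_univ i)]
    congr 1
    · simp only [if_true]
      rw [← Finset.sum_mul, hw, one_mul]
    · refine Finset.prod_congr rfl fun j hj => ?_
      simp [Finset.ne_of_mem_erase hj]
  have h2 : ∀ z x, f (Function.update z i x) =
      ∑ y, f y * ∏ j, (if Function.update z i x j = y j then 1 else 0) := fun z x =>
    eq_sum_points f _
  simp only [h2, prodE_sum, prodE_mul_left, key, Finset.mul_sum]
  rw [Finset.sum_comm]
  unfold prodE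
  refine Finset.sum_congr rfl fun y _ => ?_
  rw [← Finset.mul_prod_erase _ _ (Finset.mem_univ i)]
  simp
  ring

end ProdExpectation

/-! ### Matrices of independent Bernoulli variables -/

/-- The weight of an outcome of a Bernoulli variable. -/
noncomputable def bern (p : ℝ) (b : Bool) : ℝ := if b then p else 1 - p

theorem sum_bern (p : ℝ) : ∑ b, bern p b = 1 := by simp [bern]

theorem bern_nonneg {p : ℝ} (h0 : 0 ≤ p) (h1 : p ≤ 1) (b : Bool) : 0 ≤ bern p b := by
  unfold bern; split_ifs <;> linarith

/-- The weight of a sequence of independent Bernoulli variables. -/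
noncomputable def rowWeight {κ : Type*} [Fintype κ] (p : ℝ) (r : κ → Bool) : ℝ :=
  ∏ j, bern p (r j)

section Rows
variable {κ : Type*} [Fintype κ] [DecidableEq κ]

theorem sum_rowWeight (p : ℝ) : ∑ r : κ → Bool, rowWeight p r = 1 := by
  have := prodE_const (w := fun (_ : κ) => bern p) (fun _ => sum_bern p) 1
  simpa [prodE, rowWeight] using this

theorem rowWeight_nonneg {p : ℝ} (h0 : 0 ≤ p) (h1 : p ≤ 1) (r : κ → Bool) : 0 ≤ rowWeight p r :=
  Finset.prod_nonneg fun _ _ => bern_nonneg h0 h1 _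

theorem rowWeight_comp {p₁ p₂ p : ℝ} (op : Bool → Bool → Bool)
    (h : ∀ x, bern p x = ∑ a, bern p₁ a * ∑ b, bern p₂ b * (if op a b = x then 1 else 0))
    (x : κ → Bool) :
    rowWeight p x = ∑ a : κ → Bool, rowWeight p₁ a * ∑ b : κ → Bool, rowWeight p₂ b *
      (if (fun j => op (a j) (b j)) = x then 1 else 0) := by
  have := prodE_comp (ι := κ) (w₁ := fun _ => bern p₁) (w₂ := fun _ => bern p₂)
    (w := fun _ => bern p) op (fun _ => h) (fun z => if z = x then 1 else 0)
  simpa [prodE, rowWeight] using this.symm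

end Rows

section Matrices
variable {ι κ : Type*} [Fintype ι] [DecidableEq ι] [Fintype κ] [DecidableEq κ]

/-- The expectation over matrices of independent Bernoulli variables. -/
noncomputable def bernE (p : ℝ) (f : (ι → κ → Bool) → ℝ) : ℝ :=
  prodE (fun _ => rowWeight p) f

theorem bernE_const (p c : ℝ) : bernE (ι := ι) (κ := κ) p (fun _ => c) = c :=
  prodE_const (fun _ => sum_rowWeight p) c

theorem bernE_mono {p : ℝ} (h0 : 0 ≤ p) (h1 : p ≤ 1) {f g : (ι → κ → Bool) → ℝ}
    (h : ∀ z, f z ≤ g z) : bernE p f ≤ bernE p g :=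
  prodE_mono (fun _ => rowWeight_nonneg h0 h1) h

theorem bernE_prod (p : ℝ) (g : ι → κ → Bool → ℝ) :
    bernE p (fun z => ∏ i, ∏ j, g i j (z i j)) = ∏ i, ∏ j, ∑ b, bern p b * g i j b := by
  have h := prodE_prod (fun (_ : ι) => rowWeight (κ := κ) p) (fun i r => ∏ j, g i j (r j))
  rw [bernE, h]
  refine Finset.prod_congr rfl fun i _ => ?_
  exact prodE_prod (fun _ => bern p) (g i)

theorem bernE_entry (p : ℝ) (i : ι) (j : κ) :
    bernE p (fun z => if z i j then 1 else 0) = p := by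
  have h := bernE_prod p (fun i' j' b => if i' = i ∧ j' = j then (if b then 1 else 0) else 1)
  have e : ∀ z : ι → κ → Bool,
      (∏ i', ∏ j', if i' = i ∧ j' = j then (if z i' j' then (1 : ℝ) else 0) else 1) =
      if z i j then 1 else 0 := by
    intro z
    rw [Fintype.prod_eq_single i, Fintype.prod_eq_single j]
    · simp
    · intro j' hj; simp [hj]
    · intro i' hi; simp [hi]
  simp only [e] at h
  rw [h, Fintype.prod_eq_single i, Fintype.prod_eq_single j]
  · simp [bern]
  · intro j' hj; simp [hj, bern]
  · intro i' hi; simp [hi, bern]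

theorem bernE_entry_mul (p : ℝ) {i i' : ι} {j j' : κ} (hne : (i, j) ≠ (i', j')) :
    bernE p (fun z => (if z i j then 1 else 0) * (if z i' j' then 1 else 0)) = p * p := by
  have h := bernE_prod p (fun a b x => (if a = i ∧ b = j then (if x then 1 else 0) else 1) *
    (if a = i' ∧ b = j' then (if x then 1 else 0) else 1))
  have single : ∀ (F : ι → κ → ℝ) (i : ι) (j : κ),
      (∏ a, ∏ b, if a = i ∧ b = j then F a b else 1) = F i j := by
    intro F i j
    rw [Fintype.prod_eq_single i, Fintype.prod_eq_single j]
    · simp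
    · intro j' hj; simp [hj]
    · intro i' hi; simp [hi]
  simp only [Finset.prod_mul_distrib] at h
  have e : ∀ z : ι → κ → Bool, ∀ i j,
      (∏ a, ∏ b, if a = i ∧ b = j then (if z a b then (1 : ℝ) else 0) else 1) =
      if z i j then 1 else 0 := fun z i j => single (fun a b => if z a b then 1 else 0) i j
  simp only [e] at h
  rw [h, show p * p = (∏ a, ∏ b, if a = i ∧ b = j then p else 1) *
    (∏ a, ∏ b, if a = i' ∧ b = j' then p else 1) by
      rw [single (fun _ _ => p), single (fun _ _ => p)]]
  simp only [← Finset.prod_mul_distrib]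
  refine Finset.prod_congr rfl fun a _ => Finset.prod_congr rfl fun b _ => ?_
  by_cases h1 : a = i ∧ b = j
  · have h2 : ¬ (a = i' ∧ b = j') := by
      rintro ⟨rfl, rfl⟩; exact hne (by simp [h1.1, h1.2])
    have h2' : ¬ (i = i' ∧ j = j') := by rw [← h1.1, ← h1.2]; exact h2
    simp [h1.1, h1.2, h2', bern]
  · by_cases h2 : a = i' ∧ b = j'
    · have h1' : ¬ (i' = i ∧ j' = j) := by rw [← h2.1, ← h2.2]; exact h1
      simp [h2.1, h2.2, h1', bern]
    · simp [h1, h2, bern]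

/-- A union of independent random sets. -/
theorem bernE_or {p₁ p₂ p : ℝ} (hp : 1 - p = (1 - p₁) * (1 - p₂)) (f : (ι → κ → Bool) → ℝ) :
    bernE p₁ (fun z₁ => bernE p₂ (fun z₂ => f (fun i j => z₁ i j || z₂ i j))) = bernE p f := by
  have hb : ∀ x, bern p x =
      ∑ a, bern p₁ a * ∑ b, bern p₂ b * (if (a || b) = x then 1 else 0) := by
    intro x; cases x <;> simp [bern] <;> linarith
  exact prodE_comp (Ω := κ → Bool) (w := fun _ : ι => rowWeight p)
    (fun (a b : κ → Bool) j => a j || b j)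
    (fun _ x => rowWeight_comp (fun a b => a || b) hb x) f

/-- A random subset of a random set. -/
theorem bernE_and {p₁ p₂ p : ℝ} (hp : p = p₁ * p₂) (f : (ι → κ → Bool) → ℝ) :
    bernE p₁ (fun z₁ => bernE p₂ (fun z₂ => f (fun i j => z₁ i j && z₂ i j))) = bernE p f := by
  have hb : ∀ x, bern p x =
      ∑ a, bern p₁ a * ∑ b, bern p₂ b * (if (a && b) = x then 1 else 0) := by
    intro x; cases x <;> simp [bern, hp] <;> ring
  exact prodE_comp (Ω := κ → Bool) (w := fun _ : ι => rowWeight p)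
    (fun (a b : κ → Bool) j => a j && b j)
    (fun _ x => rowWeight_comp (fun a b => a && b) hb x) f

end Matrices

/-! ### Independent proposals

Every row proposes to at most one column, independently of the other rows. -/

section Proposals

variable {ι κ : Type*} [Fintype ι] [DecidableEq ι] [Fintype κ] [DecidableEq κ]

/-- The law of the proposal of the row `u`: it proposes to `w` with probability `c u w`. -/
noncomputable def propWeight (c : ι → κ → ℝ) (u : ι) : Option κ → ℝ
  | none => 1 - ∑ w, c u w
  | some w => c u w

/-- The indicator that the row `u` does not propose. -/
def freeRow (π : ι → Option κ) (u : ι) : ℝ := if π u = none then 1 else 0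

/-- The indicator that nobody proposes to the column `w`. -/
def freeCol (π : ι → Option κ) (w : κ) : ℝ := ∏ u, if π u = some w then 0 else 1

theorem freeCol_eq (π : ι → Option κ) (w : κ) :
    freeCol π w = if ∃ u, π u = some w then 0 else 1 := by
  unfold freeCol
  by_cases h : ∃ u, π u = some w
  · obtain ⟨u, hu⟩ := h
    rw [if_pos ⟨u, hu⟩]
    exact Finset.prod_eq_zero (Finset.mem_univ u) (by simp [hu])
  · rw [if_neg h]
    push Not at h
    simp [h]

theorem sum_propWeight (c : ι → κ → ℝ) (u : ι) : ∑ x, propWeight c u x = 1 := by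
  simp [Fintype.sum_option, propWeight]

theorem sum_propWeight_ne (c : ι → κ → ℝ) (u : ι) (w : κ) :
    ∑ x, propWeight c u x * (if x = some w then 0 else 1) = 1 - c u w := by
  have e : ∀ x : Option κ, propWeight c u x * (if x = some w then 0 else 1) =
      propWeight c u x - (if x = some w then propWeight c u x else 0) := by
    intro x; split_ifs <;> simp
  simp only [e, Finset.sum_sub_distrib, sum_propWeight]
  simp [propWeight]

/-- A row proposes at most once, so the two events to be avoided are disjoint and their
probabilities are simply subtracted. -/
theorem sum_propWeight_ne_ne (c : ι → κ → ℝ) (u : ι) {w w' : κ} (h : w ≠ w') :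
    ∑ x, propWeight c u x * ((if x = some w then 0 else 1) * (if x = some w' then 0 else 1)) =
      1 - c u w - c u w' := by
  have e : ∀ x : Option κ, propWeight c u x *
      ((if x = some w then 0 else 1) * (if x = some w' then 0 else 1)) =
      propWeight c u x * (if x = some w then 0 else 1) +
      propWeight c u x * (if x = some w' then 0 else 1) - propWeight c u x := by
    intro x
    by_cases h1 : x = some w
    · have h2 : x ≠ some w' := by rw [h1]; simpa using h
      simp [h1, h]
    · simp [h1]
  simp only [e, Finset.sum_add_distrib, Finset.sum_sub_distrib, sum_propWeight_ne, sum_propWeight]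
  ring

/-- The probability that no row other than `u` proposes to `w`. -/
noncomputable def missOther (c : ι → κ → ℝ) (u : ι) (w : κ) : ℝ :=
  ∏ u' ∈ Finset.univ.erase u, (1 - c u' w)

theorem prodE_freeCol (c : ι → κ → ℝ) (w : κ) :
    prodE (propWeight c) (fun π => freeCol π w) = ∏ u, (1 - c u w) := by
  unfold freeCol
  rw [prodE_prod (propWeight c) (fun _ x => if x = some w then 0 else 1)]
  simp only [sum_propWeight_ne]

theorem prodE_freeRow (c : ι → κ → ℝ) (u : ι) :
    prodE (propWeight c) (fun π => freeRow π u) = 1 - ∑ w, c u w := by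
  have e : ∀ π : ι → Option κ, freeRow π u =
      ∏ j, (if j = u then (if π j = none then 1 else 0) else 1) := by
    intro π; simp [freeRow]
  simp only [e]
  rw [prodE_prod (propWeight c) (fun j x => if j = u then (if x = none then 1 else 0) else 1),
    Fintype.prod_eq_single u]
  · simp [propWeight]
  · intro j hj; simp only [hj, if_false, mul_one, sum_propWeight]

theorem freeRow_mul_freeCol (π : ι → Option κ) (u : ι) (w : κ) :
    freeRow π u * freeCol π w =
      ∏ j, (if j = u then (if π j = none then 1 else 0) else (if π j = some w then 0 else 1)) := by
  rw [← Finset.mul_prod_erase _ _ (Finset.mem_univ u), freeCol,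
    ← Finset.mul_prod_erase _ _ (Finset.mem_univ u)]
  have e : ∀ j ∈ Finset.univ.erase u, (if j = u then (if π j = none then (1 : ℝ) else 0)
      else (if π j = some w then 0 else 1)) = (if π j = some w then 0 else 1) := by
    intro j hj; simp [Finset.ne_of_mem_erase hj]
  rw [Finset.prod_congr rfl e, ← mul_assoc]
  congr 1
  by_cases h : π u = none <;> simp [freeRow, h]

theorem prodE_freeRow_freeCol (c : ι → κ → ℝ) (u : ι) (w : κ) :
    prodE (propWeight c) (fun π => freeRow π u * freeCol π w) =
      (1 - ∑ w, c u w) * missOther c u w := by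
  simp only [freeRow_mul_freeCol]
  rw [prodE_prod (propWeight c) (fun j x =>
    if j = u then (if x = none then 1 else 0) else (if x = some w then 0 else 1)),
    ← Finset.mul_prod_erase _ _ (Finset.mem_univ u), missOther]
  congr 1
  · simp [propWeight]
  · refine Finset.prod_congr rfl fun j hj => ?_
    simp only [Finset.ne_of_mem_erase hj, if_false]
    exact sum_propWeight_ne c j w

theorem freeRow_sq (π : ι → Option κ) (u : ι) : freeRow π u * freeRow π u = freeRow π u := by
  unfold freeRow; split_ifs <;> simp

theorem freeCol_sq (π : ι → Option κ) (w : κ) : freeCol π w * freeCol π w = freeCol π w := by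
  rw [freeCol_eq]; split_ifs <;> simp

/-- Negative correlation of free columns: another row misses both `w` and `w'` with probability `1 -
x - y ≤ (1 - x)(1 - y)`. This controls the variance of the load of a row. -/
theorem prodE_freeRow_freeCol_freeCol {c : ι → κ → ℝ} (hc : ∀ u w, 0 ≤ c u w)
    (hr : ∀ u, ∑ w, c u w ≤ 1) (u : ι) {w w' : κ} (h : w ≠ w') :
    prodE (propWeight c) (fun π => freeRow π u * freeCol π w * (freeRow π u * freeCol π w')) ≤
      (1 - ∑ w, c u w) * missOther c u w * missOther c u w' := by
  have hle : ∀ u w, c u w ≤ 1 := fun u w =>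
    (Finset.single_le_sum (fun w _ => hc u w) (Finset.mem_univ w)).trans (hr u)
  have e : ∀ π : ι → Option κ, freeRow π u * freeCol π w * (freeRow π u * freeCol π w') =
      ∏ j, (if j = u then (if π j = none then 1 else 0) else
        ((if π j = some w then 0 else 1) * (if π j = some w' then 0 else 1))) := by
    intro π
    rw [freeRow_mul_freeCol, freeRow_mul_freeCol, ← Finset.prod_mul_distrib]
    refine Finset.prod_congr rfl fun j _ => ?_
    by_cases hj : j = u
    · simp only [hj, if_true]; split_ifs <;> simp
    · simp only [hj, if_false]
  simp only [e]
  rw [prodE_prod (propWeight c) (fun j x => if j = u then (if x = none then 1 else 0) else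
        ((if x = some w then 0 else 1) * (if x = some w' then 0 else 1))),
    ← Finset.mul_prod_erase _ _ (Finset.mem_univ u), missOther, missOther, mul_assoc,
    ← Finset.prod_mul_distrib]
  have e1 : ∑ x, propWeight c u x * (if u = u then (if x = none then 1 else 0) else
        ((if x = some w then 0 else 1) * (if x = some w' then 0 else 1))) = 1 - ∑ w, c u w := by
    simp [propWeight]
  rw [e1]
  refine mul_le_mul_of_nonneg_left ?_ (by linarith [hr u])
  refine Finset.prod_le_prod ?_ ?_
  · intro j hj
    simp only [Finset.ne_of_mem_erase hj, if_false]
    rw [sum_propWeight_ne_ne c j h]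
    have : c j w + c j w' ≤ ∑ w, c j w := by
      rw [← Finset.sum_pair h]
      exact Finset.sum_le_sum_of_subset_of_nonneg (Finset.subset_univ _) (fun _ _ _ => hc _ _)
    linarith [hr j]
  · intro j hj
    simp only [Finset.ne_of_mem_erase hj, if_false]
    rw [sum_propWeight_ne_ne c j h]
    nlinarith [mul_nonneg (hc j w) (hc j w')]

/-- Two free rows miss `w` automatically, so only the remaining rows contribute a factor. -/
theorem prodE_freeRow_freeRow_freeCol (c : ι → κ → ℝ) {u u' : ι} (h : u ≠ u') (w : κ) :
    prodE (propWeight c) (fun π => freeRow π u * freeCol π w * (freeRow π u' * freeCol π w)) =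
      (1 - ∑ w, c u w) * ((1 - ∑ w, c u' w) *
        ∏ j ∈ (Finset.univ.erase u).erase u', (1 - c j w)) := by
  have hm : u' ∈ Finset.univ.erase u := by simp [h.symm]
  have e : ∀ π : ι → Option κ, freeRow π u * freeCol π w * (freeRow π u' * freeCol π w) =
      ∏ j, (if j = u ∨ j = u' then (if π j = none then 1 else 0) else
        (if π j = some w then 0 else 1)) := by
    intro π
    rw [freeRow_mul_freeCol, freeRow_mul_freeCol, ← Finset.prod_mul_distrib]
    refine Finset.prod_congr rfl fun j _ => ?_
    by_cases hj : j = u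
    · simp only [hj, if_true, h, if_false, true_or]
      by_cases h0 : π u = none <;> simp [h0]
    · by_cases hj' : j = u'
      · simp only [hj', if_true, h.symm, if_false, or_true]
        by_cases h0 : π u' = none <;> simp [h0]
      · simp only [hj, hj', if_false, or_self]
        split_ifs <;> simp
  simp only [e]
  rw [prodE_prod (propWeight c) (fun j x => if j = u ∨ j = u' then (if x = none then 1 else 0) else
        (if x = some w then 0 else 1)),
    ← Finset.mul_prod_erase _ _ (Finset.mem_univ u), ← Finset.mul_prod_erase _ _ hm]
  congr 1
  · simp [propWeight]
  congr 1
  · simp [propWeight]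
  · refine Finset.prod_congr rfl fun j hj => ?_
    have h1 := Finset.ne_of_mem_erase hj
    have h2 := Finset.ne_of_mem_erase (Finset.mem_of_mem_erase hj)
    simp only [h1, h2, or_self, if_false]
    exact sum_propWeight_ne c j w

/-! ### Loads

Every edge between a free row and a free column carries the load `a u w` if it is present. -/

/-- The load of an edge. -/
def load (a : ι → κ → ℝ) (π : ι → Option κ) (z : ι → κ → Bool) (u : ι) (w : κ) : ℝ :=
  a u w * (if z u w then 1 else 0) * (freeRow π u * freeCol π w)

/-- The joint expectation over the proposals and the present edges. -/
noncomputable def jointE (c : ι → κ → ℝ) (q : ℝ) (f : (ι → Option κ) → (ι → κ → Bool) → ℝ) : ℝ :=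
  prodE (propWeight c) (fun π => bernE q (f π))

theorem jointE_load (c a : ι → κ → ℝ) (q : ℝ) (u : ι) (w : κ) :
    jointE c q (fun π z => load a π z u w) =
      a u w * q * ((1 - ∑ w, c u w) * missOther c u w) := by
  unfold jointE load bernE
  simp only [prodE_mul_right, prodE_mul_left]
  rw [prodE_freeRow_freeCol]
  congr 2
  exact bernE_entry q u w

/-- A load takes only the values `0` and `a u w`. The diagonal of the variance is therefore small
when the loads are small. -/
theorem jointE_load_mul_self (c a : ι → κ → ℝ) (q : ℝ) (u : ι) (w : κ) :
    jointE c q (fun π z => load a π z u w * load a π z u w) =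
      a u w * (a u w * q * ((1 - ∑ w, c u w) * missOther c u w)) := by
  rw [← jointE_load c a q u w]
  have e : ∀ π z, load a π z u w * load a π z u w = a u w * load a π z u w := by
    intro π z
    unfold load
    have h1 := freeRow_sq π u
    have h2 := freeCol_sq π w
    have h3 : (if z u w then (1 : ℝ) else 0) * (if z u w then 1 else 0) = if z u w then 1 else 0 := by
      split_ifs <;> simp
    calc _ = a u w * a u w * ((if z u w then (1 : ℝ) else 0) * (if z u w then 1 else 0)) *
          ((freeRow π u * freeRow π u) * (freeCol π w * freeCol π w)) := by ring
      _ = _ := by rw [h1, h2, h3]; ring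
  unfold jointE
  simp only [e]
  unfold bernE
  simp only [prodE_mul_left]

theorem jointE_load_mul (c a : ι → κ → ℝ) (q : ℝ) {u u' : ι} {w w' : κ} (h : (u, w) ≠ (u', w')) :
    jointE c q (fun π z => load a π z u w * load a π z u' w') =
      a u w * q * (a u' w' * q) * prodE (propWeight c)
        (fun π => freeRow π u * freeCol π w * (freeRow π u' * freeCol π w')) := by
  have e : ∀ π z, load a π z u w * load a π z u' w' =
      (a u w * a u' w') * ((if z u w then 1 else 0) * (if z u' w' then 1 else 0)) *
        (freeRow π u * freeCol π w * (freeRow π u' * freeCol π w')) := by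
    intro π z; unfold load; ring
  unfold jointE
  simp only [e]
  have hz := bernE_entry_mul q h
  unfold bernE at hz ⊢
  simp only [prodE_mul_right, prodE_mul_left]
  rw [hz]
  ring

theorem jointE_add (c : ι → κ → ℝ) (q : ℝ) (f g : (ι → Option κ) → (ι → κ → Bool) → ℝ) :
    jointE c q (fun π z => f π z + g π z) = jointE c q f + jointE c q g := by
  simp only [jointE, bernE, prodE_add]

theorem jointE_sub (c : ι → κ → ℝ) (q : ℝ) (f g : (ι → Option κ) → (ι → κ → Bool) → ℝ) :
    jointE c q (fun π z => f π z - g π z) = jointE c q f - jointE c q g := by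
  simp only [jointE, bernE, prodE_sub]

theorem jointE_mul_left (c : ι → κ → ℝ) (q t : ℝ) (f : (ι → Option κ) → (ι → κ → Bool) → ℝ) :
    jointE c q (fun π z => t * f π z) = t * jointE c q f := by
  simp only [jointE, bernE, prodE_mul_left]

theorem jointE_sum {σ : Type*} (s : Finset σ) (c : ι → κ → ℝ) (q : ℝ)
    (f : σ → (ι → Option κ) → (ι → κ → Bool) → ℝ) :
    jointE c q (fun π z => ∑ k ∈ s, f k π z) = ∑ k ∈ s, jointE c q (f k) := by
  simp only [jointE, bernE, prodE_sum]

theorem jointE_left (c : ι → κ → ℝ) (q : ℝ) (f : (ι → Option κ) → ℝ) :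
    jointE c q (fun π _ => f π) = prodE (propWeight c) f := by
  simp only [jointE, bernE_const]

/-- The expected squared deviation of the total load of a row. -/
theorem jointE_row_deviation {c a m : ι → κ → ℝ} {q θ : ℝ} (hc : ∀ u w, 0 ≤ c u w)
    (hr : ∀ u, ∑ w, c u w ≤ 1) (hq : 0 ≤ q) (ha : ∀ u w, 0 ≤ a u w) (haθ : ∀ u w, a u w ≤ θ)
    (hm : ∀ u w, a u w * q * ((1 - ∑ w, c u w) * missOther c u w) = m u w) (u : ι) :
    jointE c q (fun π z => (∑ w, load a π z u w - ∑ w, a u w * q * missOther c u w) ^ 2 *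
      freeRow π u) ≤ θ * ∑ w, m u w := by
  set μ := ∑ w, a u w * q * missOther c u w with hμ
  have hle : ∀ u w, c u w ≤ 1 := fun u w =>
    (Finset.single_le_sum (fun w _ => hc u w) (Finset.mem_univ w)).trans (hr u)
  have hmo : ∀ u w, 0 ≤ missOther c u w := fun u w =>
    Finset.prod_nonneg fun j _ => by linarith [hle j w]
  have hm0 : ∀ w, 0 ≤ m u w := fun w => by
    rw [← hm]
    exact mul_nonneg (mul_nonneg (ha _ _) hq) (mul_nonneg (by linarith [hr u]) (hmo _ _))
  have hμm : μ * (1 - ∑ w, c u w) = ∑ w, m u w := by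
    rw [hμ, Finset.sum_mul]
    exact Finset.sum_congr rfl fun w _ => by rw [← hm]; ring
  -- The load of a row already contains the factor `freeRow`, which is idempotent; it survives only
  -- in the term `μ²`.
  have e : ∀ (π : ι → Option κ) (z : ι → κ → Bool), (∑ w, load a π z u w - μ) ^ 2 * freeRow π u =
      ∑ w, ∑ w', load a π z u w * load a π z u w' - (2 * μ) * ∑ w, load a π z u w +
        μ ^ 2 * freeRow π u := by
    intro π z
    have h1 : (∑ w, load a π z u w) * freeRow π u = ∑ w, load a π z u w := by
      rw [Finset.sum_mul]
      refine Finset.sum_congr rfl fun w _ => ?_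
      unfold load
      calc _ = a u w * (if z u w then 1 else 0) * ((freeRow π u * freeRow π u) * freeCol π w) := by
            ring
        _ = _ := by rw [freeRow_sq]
    have h2 : ∑ w, ∑ w', load a π z u w * load a π z u w' =
        (∑ w, load a π z u w) * (∑ w, load a π z u w) := by
      rw [Finset.sum_mul_sum]
    rw [h2]
    linear_combination (∑ w, load a π z u w - 2 * μ) * h1
  simp only [e]
  rw [jointE_add, jointE_sub, jointE_mul_left, jointE_mul_left, jointE_sum, jointE_sum,
    jointE_left, prodE_freeRow]
  simp only [jointE_sum, jointE_load, hm]
  -- Off the diagonal, negative correlation gives at most the summand of `μ` at `w` times `m u w'`.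
  -- Summed up this is `μ ∑ m`, which cancels against `-2μ ∑ m + μ² (1 - ∑ c)`, and only the
  -- diagonal `θ ∑ m` remains.
  have hpair : ∀ w w', jointE c q (fun π z => load a π z u w * load a π z u w') ≤
      (if w = w' then θ * m u w else 0) + (a u w * q * missOther c u w) * m u w' := by
    intro w w'
    by_cases h : w = w'
    · subst h
      rw [jointE_load_mul_self, hm]
      simp only [if_true]
      have h1 := mul_le_mul_of_nonneg_right (haθ u w) (hm0 w)
      have h2 := mul_nonneg (mul_nonneg (mul_nonneg (ha u w) hq) (hmo u w)) (hm0 w)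
      linarith
    · rw [jointE_load_mul c a q (by simpa using h)]
      simp only [h, if_false, zero_add]
      have h1 := prodE_freeRow_freeCol_freeCol hc hr u h
      have h2 : 0 ≤ a u w * q * (a u w' * q) :=
        mul_nonneg (mul_nonneg (ha _ _) hq) (mul_nonneg (ha _ _) hq)
      refine (mul_le_mul_of_nonneg_left h1 h2).trans (le_of_eq ?_)
      rw [← hm u w']; ring
  have hsum := Finset.sum_le_sum fun w (_ : w ∈ Finset.univ) =>
    Finset.sum_le_sum fun w' (_ : w' ∈ Finset.univ) => hpair w w'
  simp only [Finset.sum_add_distrib, Finset.sum_ite_eq, Finset.mem_univ, if_true,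
    ← Finset.mul_sum, ← Finset.sum_mul] at hsum
  rw [← hμ] at hsum
  have h3 : μ ^ 2 * (1 - ∑ w, c u w) = μ * ∑ w, m u w := by rw [← hμm]; ring
  rw [h3]
  linarith

/-- The expected squared deviation of the total load of a column. -/
theorem jointE_col_deviation {c a m : ι → κ → ℝ} {q θ : ℝ} (hc : ∀ u w, 0 ≤ c u w)
    (hr : ∀ u, ∑ w, c u w ≤ 1) (hq : 0 ≤ q) (ha : ∀ u w, 0 ≤ a u w) (haθ : ∀ u w, a u w ≤ θ)
    (hm : ∀ u w, a u w * q * ((1 - ∑ w, c u w) * missOther c u w) = m u w) (w : κ)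
    (hw : ∏ u, (1 - c u w) ≠ 0) :
    jointE c q (fun π z => (∑ u, load a π z u w - (∑ u, m u w) / ∏ u, (1 - c u w)) ^ 2 *
      freeCol π w) ≤ θ * ∑ u, m u w := by
  set φ := ∏ u, (1 - c u w) with hφ
  set μ := (∑ u, m u w) / φ with hμ
  have hle : ∀ u w, c u w ≤ 1 := fun u w =>
    (Finset.single_le_sum (fun w _ => hc u w) (Finset.mem_univ w)).trans (hr u)
  have hmo : ∀ u w, 0 ≤ missOther c u w := fun u w =>
    Finset.prod_nonneg fun j _ => by linarith [hle j w]
  have hφ0 : 0 < φ := lt_of_le_of_ne (Finset.prod_nonneg fun j _ => by linarith [hle j w]) hw.symm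
  have hm0 : ∀ u, 0 ≤ m u w := fun u => by
    rw [← hm]
    exact mul_nonneg (mul_nonneg (ha _ _) hq) (mul_nonneg (by linarith [hr u]) (hmo _ _))
  have e : ∀ (π : ι → Option κ) (z : ι → κ → Bool), (∑ u, load a π z u w - μ) ^ 2 * freeCol π w =
      ∑ u, ∑ u', load a π z u w * load a π z u' w - (2 * μ) * ∑ u, load a π z u w +
        μ ^ 2 * freeCol π w := by
    intro π z
    have h1 : (∑ u, load a π z u w) * freeCol π w = ∑ u, load a π z u w := by
      rw [Finset.sum_mul]
      refine Finset.sum_congr rfl fun u _ => ?_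
      unfold load
      calc _ = a u w * (if z u w then 1 else 0) * (freeRow π u * (freeCol π w * freeCol π w)) := by
            ring
        _ = _ := by rw [freeCol_sq]
    have h2 : ∑ u, ∑ u', load a π z u w * load a π z u' w =
        (∑ u, load a π z u w) * (∑ u, load a π z u w) := by
      rw [Finset.sum_mul_sum]
    rw [h2]
    linear_combination (∑ u, load a π z u w - 2 * μ) * h1
  simp only [e]
  rw [jointE_add, jointE_sub, jointE_mul_left, jointE_mul_left, jointE_sum, jointE_sum,
    jointE_left, prodE_freeCol, ← hφ]
  simp only [jointE_sum, jointE_load, hm]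
  -- For different rows this is an equality: once `w` is free, the loads that two rows put on it are
  -- uncorrelated.
  have hpair : ∀ u u', jointE c q (fun π z => load a π z u w * load a π z u' w) ≤
      (if u = u' then θ * m u w else 0) + m u w / φ * m u' w := by
    intro u u'
    by_cases h : u = u'
    · subst h
      rw [jointE_load_mul_self, hm]
      simp only [if_true]
      have h1 := mul_le_mul_of_nonneg_right (haθ u w) (hm0 u)
      have h2 := mul_nonneg (div_nonneg (hm0 u) hφ0.le) (hm0 u)
      linarith
    · rw [jointE_load_mul c a q (by simpa using h), prodE_freeRow_freeRow_freeCol c h]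
      simp only [h, if_false, zero_add]
      have hm1 : u' ∈ Finset.univ.erase u := by simp [Ne.symm h]
      have hm2 : u ∈ Finset.univ.erase u' := by simp [h]
      set ψ := ∏ j ∈ (Finset.univ.erase u).erase u', (1 - c j w) with hψ
      have e1 : missOther c u w = (1 - c u' w) * ψ := (Finset.mul_prod_erase _ _ hm1).symm
      have e2 : missOther c u' w = (1 - c u w) * ψ := by
        rw [hψ, Finset.erase_right_comm]; exact (Finset.mul_prod_erase _ _ hm2).symm
      have e3 : φ = (1 - c u w) * ((1 - c u' w) * ψ) := by
        rw [← e1]; exact (Finset.mul_prod_erase _ _ (Finset.mem_univ u)).symm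
      rw [← hm u w, ← hm u' w, e1, e2, e3]
      rw [e3] at hw
      have n1 : 1 - c u w ≠ 0 := left_ne_zero_of_mul hw
      have n2 : 1 - c u' w ≠ 0 := left_ne_zero_of_mul (right_ne_zero_of_mul hw)
      have n3 : ψ ≠ 0 := right_ne_zero_of_mul (right_ne_zero_of_mul hw)
      apply le_of_eq
      field_simp
  have hsum := Finset.sum_le_sum fun u (_ : u ∈ Finset.univ) =>
    Finset.sum_le_sum fun u' (_ : u' ∈ Finset.univ) => hpair u u'
  simp only [Finset.sum_add_distrib, Finset.sum_ite_eq, Finset.mem_univ, if_true,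
    ← Finset.mul_sum, ← Finset.sum_mul, ← Finset.sum_div] at hsum
  rw [← hμ] at hsum
  have h3 : μ ^ 2 * φ = μ * ∑ u, m u w := by
    rw [hμ]; field_simp
  rw [h3]
  linarith

end Proposals

/-! ### Covers pay for proposals and loads: the lower bound on the expected cover number. -/

section Proposals

variable {ι κ : Type*} [Fintype ι] [DecidableEq ι] [Fintype κ] [DecidableEq κ]

/-- For `x > 1` the excess satisfies `x - 1 ≤ ε + (x - 1)² / (4ε)` by the inequality of the means,
and `|x - 1| ≤ |x - μ|`. The overload is thus charged linearly to the squared deviation, without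
square roots. -/
theorem load_le_one_add_sq {ε x μ : ℝ} (hε : 0 < ε) (hε1 : ε ≤ 1) (hx : 0 ≤ x) (hμ : μ ≤ 1) :
    (1 - ε) * x ≤ 1 + 1 / (4 * ε) * (x - μ) ^ 2 := by
  have h4 : 0 < 4 * ε := by linarith
  by_cases h : x ≤ 1
  · have : 0 ≤ 1 / (4 * ε) * (x - μ) ^ 2 := by positivity
    nlinarith
  · push Not at h
    have h1 : (x - 1) ^ 2 ≤ (x - μ) ^ 2 := by nlinarith
    have h2 : x - 1 - ε ≤ 1 / (4 * ε) * (x - 1) ^ 2 := by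
      rw [div_mul_eq_mul_div, one_mul, le_div_iff₀ h4]
      nlinarith [sq_nonneg (x - 1 - 2 * ε)]
    have h3 : 1 / (4 * ε) * (x - 1) ^ 2 ≤ 1 / (4 * ε) * (x - μ) ^ 2 :=
      mul_le_mul_of_nonneg_left h1 (by positivity)
    nlinarith

theorem load_nonneg {a : ι → κ → ℝ} (ha : ∀ u w, 0 ≤ a u w) (π : ι → Option κ)
    (z : ι → κ → Bool) (u : ι) (w : κ) : 0 ≤ load a π z u w := by
  unfold load freeRow
  rw [freeCol_eq]
  have := ha u w
  split_ifs <;> simp [this]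

/-- Every cover is at least as large as the number of the columns that receive proposals, plus
the total load, up to corrections for overloaded rows and columns. -/
theorem card_cover_ge {a : ι → κ → ℝ} (ha : ∀ u w, 0 ≤ a u w) {ε : ℝ} (hε : 0 < ε) (hε1 : ε ≤ 1)
    {μ : ι → ℝ} {ν : κ → ℝ} (hμ : ∀ u, μ u ≤ 1) (hν : ∀ w, ν w ≤ 1)
    (π : ι → Option κ) (z : ι → κ → Bool) (L : Finset ι) (R : Finset κ)
    (hπ : ∀ u w, π u = some w → u ∈ L ∨ w ∈ R)
    (hz : ∀ u w, load a π z u w ≠ 0 → u ∈ L ∨ w ∈ R) :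
    ∑ w, (1 - freeCol π w) + (1 - ε) * ∑ u, ∑ w, load a π z u w
      - (1 / (4 * ε) * ∑ u, (∑ w, load a π z u w - μ u) ^ 2 * freeRow π u
        + 1 / (4 * ε) * ∑ w, (∑ u, load a π z u w - ν w) ^ 2 * freeCol π w)
      ≤ (L.card : ℝ) + R.card := by
  have hl := load_nonneg ha π z
  have hfr : ∀ u, 0 ≤ freeRow π u := fun u => by unfold freeRow; split_ifs <;> simp
  have hfc : ∀ w, 0 ≤ freeCol π w := fun w => by rw [freeCol_eq]; split_ifs <;> simp
  -- Columns outside `R` that receive proposals have different proposers, and these lie in `L` and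
  -- are not free.
  have h1 : ∑ w, (1 - freeCol π w) ≤
      ∑ u ∈ L, (1 - freeRow π u) + ∑ w ∈ R, (1 - freeCol π w) := by
    have e1 : ∑ w ∈ Finset.univ \ R, (1 - freeCol π w) ≤ ∑ u ∈ L, (1 - freeRow π u) := by
      have s1 : ∑ w ∈ Finset.univ \ R, (1 - freeCol π w) =
          ((Finset.univ \ R).filter (fun w => ∃ u, π u = some w)).card := by
        rw [Finset.card_filter]
        push_cast
        refine Finset.sum_congr rfl fun w _ => ?_
        rw [freeCol_eq]; split_ifs <;> simp
      have s2 : ∑ u ∈ L, (1 - freeRow π u) = (L.filter (fun u => π u ≠ none)).card := by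
        rw [Finset.card_filter]
        push_cast
        refine Finset.sum_congr rfl fun u _ => ?_
        unfold freeRow; split_ifs <;> simp_all
      rw [s1, s2, Nat.cast_le]
      have hsub : ((Finset.univ \ R).filter (fun w => ∃ u, π u = some w)).image some ⊆
          (L.filter (fun u => π u ≠ none)).image π := by
        intro x hx
        simp only [Finset.mem_image, Finset.mem_filter, Finset.mem_sdiff, Finset.mem_univ,
          true_and] at hx ⊢
        obtain ⟨w, ⟨hw, u, hu⟩, rfl⟩ := hx
        exact ⟨u, ⟨(hπ u w hu).resolve_right hw, by simp [hu]⟩, hu⟩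
      calc _ = _ := (Finset.card_image_of_injective _ (Option.some_injective κ)).symm
        _ ≤ _ := Finset.card_le_card hsub
        _ ≤ _ := Finset.card_image_le
    have e2 := Finset.sum_sdiff (f := fun w => 1 - freeCol π w) (Finset.subset_univ R)
    linarith
  -- Every edge with a load is covered by `L` or by `R`.
  have h2 : ∑ u, ∑ w, load a π z u w ≤
      ∑ u ∈ L, ∑ w, load a π z u w + ∑ w ∈ R, ∑ u, load a π z u w := by
    have e1 : ∑ u ∈ L, ∑ w, load a π z u w =
        ∑ u, ∑ w, if u ∈ L then load a π z u w else 0 := by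
      rw [← Finset.sum_filter_add_sum_filter_not Finset.univ (· ∈ L)
        (fun u => ∑ w, if u ∈ L then load a π z u w else 0)]
      rw [Finset.sum_eq_zero (s := Finset.univ.filter (¬ · ∈ L)), add_zero]
      · rw [Finset.filter_univ_mem]
        exact Finset.sum_congr rfl fun u hu => by simp [hu]
      · intro u hu; simp [(Finset.mem_filter.1 hu).2]
    have e2 : ∑ w ∈ R, ∑ u, load a π z u w =
        ∑ u, ∑ w, if w ∈ R then load a π z u w else 0 := by
      rw [Finset.sum_comm]
      refine Finset.sum_congr rfl fun u _ => ?_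
      simp
    rw [e1, e2, ← Finset.sum_add_distrib]
    refine Finset.sum_le_sum fun u _ => ?_
    rw [← Finset.sum_add_distrib]
    refine Finset.sum_le_sum fun w _ => ?_
    by_cases h0 : load a π z u w = 0
    · simp [h0]
    · rcases hz u w h0 with h | h
      · simp only [h, if_true]; split_ifs <;> linarith [hl u w]
      · simp only [h, if_true]; split_ifs <;> linarith [hl u w]
  -- Rows that propose carry no load. So the proposals are paid by the non-free members of the cover
  -- and the loads by the free ones, and nothing is counted twice.
  have h3 : ∀ u, (1 - ε) * ∑ w, load a π z u w ≤
      freeRow π u + 1 / (4 * ε) * ((∑ w, load a π z u w - μ u) ^ 2 * freeRow π u) := by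
    intro u
    by_cases h : π u = none
    · have : freeRow π u = 1 := by simp [freeRow, h]
      rw [this, mul_one]
      exact load_le_one_add_sq hε hε1 (Finset.sum_nonneg fun w _ => hl u w) (hμ u)
    · have : freeRow π u = 0 := by simp [freeRow, h]
      simp [load, this]
  have h4 : ∀ w, (1 - ε) * ∑ u, load a π z u w ≤
      freeCol π w + 1 / (4 * ε) * ((∑ u, load a π z u w - ν w) ^ 2 * freeCol π w) := by
    intro w
    by_cases h : ∃ u, π u = some w
    · have : freeCol π w = 0 := by rw [freeCol_eq, if_pos h]
      simp [load, this]
    · have : freeCol π w = 1 := by rw [freeCol_eq, if_neg h]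
      rw [this, mul_one]
      exact load_le_one_add_sq hε hε1 (Finset.sum_nonneg fun u _ => hl u w) (hν w)
  have h5 := Finset.sum_le_sum fun u (_ : u ∈ L) => h3 u
  have h6 := Finset.sum_le_sum fun w (_ : w ∈ R) => h4 w
  rw [← Finset.mul_sum, Finset.sum_add_distrib, ← Finset.mul_sum] at h5 h6
  have h7 : ∑ u ∈ L, (∑ w, load a π z u w - μ u) ^ 2 * freeRow π u ≤
      ∑ u, (∑ w, load a π z u w - μ u) ^ 2 * freeRow π u :=
    Finset.sum_le_sum_of_subset_of_nonneg (Finset.subset_univ _)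
      fun u _ _ => mul_nonneg (sq_nonneg _) (hfr u)
  have h8 : ∑ w ∈ R, (∑ u, load a π z u w - ν w) ^ 2 * freeCol π w ≤
      ∑ w, (∑ u, load a π z u w - ν w) ^ 2 * freeCol π w :=
    Finset.sum_le_sum_of_subset_of_nonneg (Finset.subset_univ _)
      fun w _ _ => mul_nonneg (sq_nonneg _) (hfc w)
  have h4ε : 0 ≤ 1 / (4 * ε) := by positivity
  have h7' := mul_le_mul_of_nonneg_left h7 h4ε
  have h8' := mul_le_mul_of_nonneg_left h8 h4ε
  have h2' := mul_le_mul_of_nonneg_left h2 (by linarith : 0 ≤ 1 - ε)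
  have e3 : ∑ u ∈ L, (1 - freeRow π u) = L.card - ∑ u ∈ L, freeRow π u := by
    simp [Finset.sum_sub_distrib]
  have e4 : ∑ w ∈ R, (1 - freeCol π w) = R.card - ∑ w ∈ R, freeCol π w := by
    simp [Finset.sum_sub_distrib]
  rw [e3, e4] at h1
  linarith

/-- A union bound: a column stays free with probability at least one minus the expected number of
its proposals. -/
theorem one_sub_sum_le_prod {s : Finset ι} {x : ι → ℝ} (h0 : ∀ i, 0 ≤ x i) (h1 : ∀ i, x i ≤ 1) :
    1 - ∑ i ∈ s, x i ≤ ∏ i ∈ s, (1 - x i) := by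
  induction s using Finset.induction_on with
  | empty => simp
  | insert i s hi ih =>
    rw [Finset.sum_insert hi, Finset.prod_insert hi]
    have hs : 0 ≤ ∑ i ∈ s, x i := Finset.sum_nonneg fun i _ => h0 i
    have := mul_le_mul_of_nonneg_left ih (by linarith [h1 i] : 0 ≤ 1 - x i)
    nlinarith [mul_nonneg (h0 i) hs]

/-- The source of the constant `1 - 1/e`: the product is at most `exp (-s)` with `s` the sum, and
convexity of `exp` on `[-1, 0]` gives `exp (-s) ≤ 1 - s + s/e`. -/
theorem mul_le_one_sub_prod {x : ι → ℝ} (h0 : ∀ i, 0 ≤ x i) (hx : ∑ i, x i ≤ 1) :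
    (1 - Real.exp (-1)) * ∑ i, x i ≤ 1 - ∏ i, (1 - x i) := by
  have h1 : ∀ i, x i ≤ 1 := fun i =>
    (Finset.single_le_sum (fun i _ => h0 i) (Finset.mem_univ i)).trans hx
  have h2 : ∏ i, (1 - x i) ≤ Real.exp (-∑ i, x i) := by
    rw [← Finset.sum_neg_distrib, Real.exp_sum]
    refine Finset.prod_le_prod (fun i _ => by linarith [h1 i]) fun i _ => ?_
    have := Real.add_one_le_exp (-x i)
    linarith
  have h3 : Real.exp (-∑ i, x i) ≤ 1 - ∑ i, x i + (∑ i, x i) * Real.exp (-1) := by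
    have hs : 0 ≤ ∑ i, x i := Finset.sum_nonneg fun i _ => h0 i
    have := convexOn_exp.2 (Set.mem_univ 0) (Set.mem_univ (-1))
      (by linarith : 0 ≤ 1 - ∑ i, x i) hs (by ring)
    simpa using this
  linarith

/-- Proposals that are drawn given the present edges of their rows have the law `c`. -/
theorem bernE_prodE_propWeight {p : ℝ} {c : ι → κ → ℝ} {k : ι → (κ → Bool) → κ → ℝ}
    (hkc : ∀ u w, ∑ r, rowWeight p r * k u r w = c u w) (F : (ι → Option κ) → ℝ) :
    bernE p (fun z : ι → κ → Bool => prodE (propWeight fun u w => k u (z u) w) F) =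
      prodE (propWeight c) F := by
  have hrow : ∀ (u : ι) (x : Option κ),
      ∑ r : κ → Bool, rowWeight p r * (match x with
        | none => 1 - ∑ w, k u r w
        | some w => k u r w) = propWeight c u x := by
    intro u x
    cases x with
    | none =>
      simp only [propWeight, mul_sub, mul_one, Finset.sum_sub_distrib, sum_rowWeight,
        Finset.mul_sum]
      rw [Finset.sum_comm]
      simp only [hkc]
    | some w => exact hkc u w
  have e : ∀ (z : ι → κ → Bool) (u : ι) (x : Option κ),
      propWeight (fun u w => k u (z u) w) u x = (match x with
        | none => 1 - ∑ w, k u (z u) w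
        | some w => k u (z u) w) := by
    intro z u x; cases x <;> rfl
  have h1 : ∀ z : ι → κ → Bool, prodE (propWeight fun u w => k u (z u) w) F =
      ∑ π : ι → Option κ, F π * ∏ u, (match π u with
        | none => 1 - ∑ w, k u (z u) w
        | some w => k u (z u) w) := by
    intro z
    unfold prodE
    exact Finset.sum_congr rfl fun π _ => by rw [mul_comm]; simp only [e]
  simp only [h1]
  unfold bernE
  simp only [prodE_sum, prodE_mul_left]
  rw [prodE]
  refine Finset.sum_congr rfl fun π _ => ?_
  rw [mul_comm]
  congr 1
  have := prodE_prod (fun (_ : ι) => rowWeight (κ := κ) p) (fun u r => (match π u with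
        | none => 1 - ∑ w, k u r w
        | some w => k u r w))
  rw [this]
  exact Finset.prod_congr rfl fun u _ => hrow u (π u)

/-- The main estimate: the expected size of a minimum cover of a union of two random subgraphs,
the first of which supports independent proposals with the law `c`, while the second contains
every edge with probability `q`, and `m` is a fractional matching with small values. -/
theorem proposal_bound {E : ι → κ → Prop} {c m : ι → κ → ℝ} {k : ι → (κ → Bool) → κ → ℝ}
    {V : (ι → κ → Bool) → ℝ} {p q ε δ : ℝ} (hp0 : 0 ≤ p) (hp1 : p ≤ 1) (hq0 : 0 < q) (hq1 : q ≤ 1)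
    (hε : 0 < ε) (hε1 : ε ≤ 1 / 2) (hδ : δ ≤ 2 * ε ^ 4 * q)
    (hk0 : ∀ u r w, 0 ≤ k u r w) (hk1 : ∀ u r, ∑ w, k u r w ≤ 1)
    (hkE : ∀ u r w, k u r w ≠ 0 → E u w ∧ r w = true)
    (hkc : ∀ u w, ∑ r, rowWeight p r * k u r w = c u w)
    (hm0 : ∀ u w, 0 ≤ m u w) (hmE : ∀ u w, m u w ≠ 0 → E u w) (hmδ : ∀ u w, m u w ≤ δ)
    (hrow : ∀ u, ∑ w, c u w + ∑ w, m u w ≤ 1) (hcol : ∀ w, ∑ u, c u w + ∑ u, m u w ≤ 1)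
    (hV : ∀ z, ∃ (L : Finset ι) (R : Finset κ), (∀ u w, E u w → z u w = true → u ∈ L ∨ w ∈ R) ∧
      (L.card : ℝ) + R.card ≤ V z) :
    (1 - Real.exp (-1)) * ∑ u, ∑ w, c u w + (1 - 2 * ε) * ∑ u, ∑ w, m u w -
      4 * ε * ∑ u, ∑ w, c u w ≤
      bernE p (fun z₁ => bernE q (fun z₂ => V (fun i j => z₁ i j || z₂ i j))) := by
  classical
  have hc0 : ∀ u w, 0 ≤ c u w := fun u w => by
    rw [← hkc]
    exact Finset.sum_nonneg fun r _ => mul_nonneg (rowWeight_nonneg hp0 hp1 r) (hk0 _ _ _)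
  have hr : ∀ u, ∑ w, c u w ≤ 1 := fun u => by
    have : 0 ≤ ∑ w, m u w := Finset.sum_nonneg fun w _ => hm0 u w
    linarith [hrow u]
  have hcl : ∀ w, ∑ u, c u w ≤ 1 := fun w => by
    have : 0 ≤ ∑ u, m u w := Finset.sum_nonneg fun u _ => hm0 u w
    linarith [hcol w]
  have hc1 : ∀ u w, c u w ≤ 1 := fun u w =>
    (Finset.single_le_sum (fun w _ => hc0 u w) (Finset.mem_univ w)).trans (hr u)
  -- Rows and columns that `c` nearly saturates are rarely free, and loads there would have to be
  -- large. Dropping `m` on them leaves only edges that are free with probability `D ≥ ε²`.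
  set m' : ι → κ → ℝ := fun u w =>
    if ∑ w, c u w ≤ 1 - ε ∧ ∑ u, c u w ≤ 1 - ε then m u w else 0 with hm'
  set D : ι → κ → ℝ := fun u w => (1 - ∑ w, c u w) * missOther c u w with hD
  -- Normalised so that the expected load of an edge is `m'`: it is present with probability `q` and
  -- free with probability `D`.
  set a : ι → κ → ℝ := fun u w => m' u w / (q * D u w) with ha'
  have hm'0 : ∀ u w, 0 ≤ m' u w := fun u w => by
    simp only [hm']; split_ifs <;> simp [hm0]
  have hm'm : ∀ u w, m' u w ≤ m u w := fun u w => by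
    simp only [hm']; split_ifs <;> simp [hm0]
  have hφmo : ∀ u w, ∏ u, (1 - c u w) ≤ missOther c u w := fun u w => by
    rw [missOther, ← Finset.mul_prod_erase _ _ (Finset.mem_univ u)]
    have h0 : 0 ≤ ∏ u' ∈ Finset.univ.erase u, (1 - c u' w) :=
      Finset.prod_nonneg fun j _ => by linarith [hc1 j w]
    nlinarith [hc0 u w]
  have hφ1 : ∀ w, 1 - ∑ u, c u w ≤ ∏ u, (1 - c u w) := fun w =>
    one_sub_sum_le_prod (fun u => hc0 u w) (fun u => hc1 u w)
  have hDε : ∀ u w, m' u w ≠ 0 → ε ^ 2 ≤ D u w := fun u w h => by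
    simp only [hm'] at h
    have hh : ∑ w, c u w ≤ 1 - ε ∧ ∑ u, c u w ≤ 1 - ε := by
      by_contra hh; simp [hh] at h
    have h1 : ε ≤ 1 - ∑ w, c u w := by linarith [hh.1]
    have h2 : ε ≤ missOther c u w := by linarith [hh.2, hφmo u w, hφ1 w]
    simp only [hD]
    nlinarith
  have hD0 : ∀ u w, 0 ≤ D u w := fun u w =>
    mul_nonneg (by linarith [hr u]) (Finset.prod_nonneg fun j _ => by linarith [hc1 j w])
  have ha : ∀ u w, 0 ≤ a u w := fun u w => div_nonneg (hm'0 u w) (mul_nonneg hq0.le (hD0 u w))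
  -- A single load is at most `δ / (q ε²) ≤ 2ε² = θ`, and the factor `1/(4ε)` of `card_cover_ge`
  -- turns `θ` into `ε/2`.
  set θ : ℝ := 4 * ε * ε / 2 with hθ
  have haθ : ∀ u w, a u w ≤ θ := fun u w => by
    by_cases h : m' u w = 0
    · simp only [ha', h, zero_div]; positivity
    · have h1 := hDε u w h
      have h2 : 0 < q * ε ^ 2 := by positivity
      have h3 : q * ε ^ 2 ≤ q * D u w := mul_le_mul_of_nonneg_left h1 hq0.le
      simp only [ha']
      rw [div_le_iff₀ (by linarith)]
      calc m' u w ≤ δ := (hm'm u w).trans (hmδ u w)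
        _ ≤ 2 * ε ^ 4 * q := hδ
        _ = θ * (q * ε ^ 2) := by rw [hθ]; ring
        _ ≤ θ * (q * D u w) := mul_le_mul_of_nonneg_left h3 (by positivity)
  have hm : ∀ u w, a u w * q * ((1 - ∑ w, c u w) * missOther c u w) = m' u w := fun u w => by
    by_cases h : m' u w = 0
    · simp [ha', h]
    · have h1 := hDε u w h
      have h2 : 0 < D u w := lt_of_lt_of_le (by positivity) h1
      have h3 : a u w * q * D u w = m' u w := by
        simp only [ha']; field_simp
      exact h3
  set μ : ι → ℝ := fun u => ∑ w, a u w * q * missOther c u w with hμ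
  set ν : κ → ℝ := fun w => (∑ u, m' u w) / ∏ u, (1 - c u w) with hν
  -- `μ u` is the mean load of a free row: `∑ m'` divided by the probability `1 - ∑ c` of being
  -- free, which is at least `∑ m` by `hrow`.
  have hμ1 : ∀ u, μ u ≤ 1 := fun u => by
    by_cases h : ∑ w, c u w ≤ 1 - ε
    · have h1 : μ u * (1 - ∑ w, c u w) ≤ 1 * (1 - ∑ w, c u w) := by
        have : μ u * (1 - ∑ w, c u w) = ∑ w, m' u w := by
          simp only [hμ]
          rw [Finset.sum_mul]
          exact Finset.sum_congr rfl fun w _ => by rw [← hm]; ring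
        rw [this]
        have : ∑ w, m' u w ≤ ∑ w, m u w := Finset.sum_le_sum fun w _ => hm'm u w
        linarith [hrow u]
      exact le_of_mul_le_mul_right h1 (by linarith)
    · have : ∀ w, a u w = 0 := fun w => by simp [ha', hm', h]
      simp [hμ, this]
  have hν1 : ∀ w, ν w ≤ 1 := fun w => by
    refine div_le_one_of_le₀ ?_ (Finset.prod_nonneg fun j _ => by linarith [hc1 j w])
    have : ∑ u, m' u w ≤ ∑ u, m u w := Finset.sum_le_sum fun u _ => hm'm u w
    linarith [hcol w, hφ1 w]
  set g : (ι → Option κ) → (ι → κ → Bool) → ℝ := fun π z =>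
    ∑ w, (1 - freeCol π w) + (1 - ε) * ∑ u, ∑ w, load a π z u w
      - (1 / (4 * ε) * ∑ u, (∑ w, load a π z u w - μ u) ^ 2 * freeRow π u
        + 1 / (4 * ε) * ∑ w, (∑ u, load a π z u w - ν w) ^ 2 * freeCol π w) with hg
  -- The proposals use edges of `z₁` and the loads use edges of `z₂`, so a cover of the union covers
  -- both, and `card_cover_ge` applies to every outcome of positive weight.
  have step1 : jointE c q g ≤
      bernE p (fun z₁ => bernE q (fun z₂ => V (fun i j => z₁ i j || z₂ i j))) := by
    have e : jointE c q g = bernE p (fun z : ι → κ → Bool =>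
        prodE (propWeight fun u w => k u (z u) w) (fun π => bernE q (g π))) :=
      (bernE_prodE_propWeight hkc _).symm
    rw [e]
    refine bernE_mono hp0 hp1 fun z₁ => ?_
    have hw0 : ∀ u x, 0 ≤ propWeight (fun u w => k u (z₁ u) w) u x := by
      intro u x
      cases x with
      | none => simp only [propWeight]; linarith [hk1 u (z₁ u)]
      | some w => exact hk0 _ _ _
    rw [← prodE_const (w := propWeight fun u w => k u (z₁ u) w) (sum_propWeight _)
      (bernE q fun z₂ => V fun i j => z₁ i j || z₂ i j)]
    refine Finset.sum_le_sum fun π _ => ?_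
    by_cases hπ0 : ∏ u, propWeight (fun u w => k u (z₁ u) w) u (π u) = 0
    · simp [hπ0]
    refine mul_le_mul_of_nonneg_left ?_ (Finset.prod_nonneg fun u _ => hw0 u _)
    refine bernE_mono hq0.le hq1 fun z₂ => ?_
    obtain ⟨L, R, hLR, hcard⟩ := hV (fun i j => z₁ i j || z₂ i j)
    refine le_trans ?_ hcard
    refine card_cover_ge ha hε (by linarith) hμ1 hν1 π z₂ L R ?_ ?_
    · intro u w hu
      have h1 : propWeight (fun u w => k u (z₁ u) w) u (π u) ≠ 0 := fun h0 =>
        hπ0 (Finset.prod_eq_zero (Finset.mem_univ u) h0)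
      rw [hu] at h1
      have h2 := hkE u (z₁ u) w h1
      exact hLR u w h2.1 (by simp [h2.2])
    · intro u w hl
      have h1 : a u w ≠ 0 := fun h0 => hl (by simp [load, h0])
      have h2 : z₂ u w = true := by
        by_contra h0; exact hl (by simp [load, h0])
      have h3 : m u w ≠ 0 := fun h0 => h1 (by simp [ha', hm', h0])
      exact hLR u w (hmE u w h3) (by simp [h2])
  refine le_trans ?_ step1
  have hdevr := fun u => jointE_row_deviation hc0 hr hq0.le ha haθ hm u
  have hdevc : ∀ w, jointE c q (fun π z => (∑ u, load a π z u w - ν w) ^ 2 * freeCol π w) ≤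
      θ * ∑ u, m' u w := by
    intro w
    -- In this degenerate case the division gives `ν w = 0`, and the column is saturated, so that it
    -- carries no loads.
    by_cases hw : ∏ u, (1 - c u w) = 0
    · have : ∀ π : ι → Option κ, ∀ z : ι → κ → Bool,
          (∑ u, load a π z u w - ν w) ^ 2 * freeCol π w = 0 := by
        intro π z
        have h1 : ¬ (∑ u, c u w ≤ 1 - ε) := by
          intro h; linarith [hφ1 w]
        have h2 : ∀ u, a u w = 0 := fun u => by simp [ha', hm', h1]
        have h3 : ν w = 0 := by simp [hν, hw]
        simp [load, h2, h3]
      simp only [this]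
      rw [jointE_left c q (fun _ => 0), prodE_const (sum_propWeight c)]
      exact mul_nonneg (by positivity) (Finset.sum_nonneg fun u _ => hm'0 u w)
    · exact jointE_col_deviation hc0 hr hq0.le ha haθ hm w hw
  have hEg : jointE c q g = ∑ w, (1 - ∏ u, (1 - c u w)) + (1 - ε) * ∑ u, ∑ w, m' u w -
      (1 / (4 * ε) * ∑ u, jointE c q (fun π z => (∑ w, load a π z u w - μ u) ^ 2 * freeRow π u) +
       1 / (4 * ε) * ∑ w, jointE c q (fun π z => (∑ u, load a π z u w - ν w) ^ 2 * freeCol π w)) := by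
    simp only [hg]
    rw [jointE_sub, jointE_add, jointE_add, jointE_mul_left, jointE_mul_left, jointE_mul_left,
      jointE_sum, jointE_sum, jointE_sum, jointE_sum]
    simp only [jointE_sum, jointE_load, hm]
    congr 2
    refine Finset.sum_congr rfl fun w _ => ?_
    rw [jointE_left c q (fun π => 1 - freeCol π w), prodE_sub, prodE_freeCol,
      prodE_const (sum_propWeight c)]
  have hs1 := Finset.sum_le_sum fun u (_ : u ∈ Finset.univ) => hdevr u
  have hs2 := Finset.sum_le_sum fun w (_ : w ∈ Finset.univ) => hdevc w
  rw [← Finset.mul_sum] at hs1 hs2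
  rw [Finset.sum_comm] at hs2
  have h4ε : 0 ≤ 1 / (4 * ε) := by positivity
  have hs1' := mul_le_mul_of_nonneg_left hs1 h4ε
  have hs2' := mul_le_mul_of_nonneg_left hs2 h4ε
  have hθε : 1 / (4 * ε) * (θ * ∑ u, ∑ w, m' u w) = ε / 2 * ∑ u, ∑ w, m' u w := by
    rw [hθ]; field_simp
  rw [hθε] at hs1' hs2'
  have hprop : (1 - Real.exp (-1)) * ∑ u, ∑ w, c u w ≤ ∑ w, (1 - ∏ u, (1 - c u w)) := by
    rw [Finset.sum_comm, Finset.mul_sum]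
    exact Finset.sum_le_sum fun w _ => mul_le_one_sub_prod (fun u => hc0 u w) (hcl w)
  -- A saturated row has `∑ c > 1 - ε ≥ 1/2`, so the dropped part of `m` is at most `ε ≤ 2ε ∑ c`.
  -- Rows and columns contribute `2ε` each.
  have hdisc : ∑ u, ∑ w, m u w ≤ ∑ u, ∑ w, m' u w + 4 * ε * ∑ u, ∑ w, c u w := by
    have big : ∀ x y : ℝ, 0 ≤ x → x + y ≤ 1 → ¬ (x ≤ 1 - ε) → y ≤ 2 * ε * x := by
      intro x y _ h1 h2
      push Not at h2
      nlinarith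
    have hb1 : ∀ u, (∑ w, if ∑ w, c u w ≤ 1 - ε then 0 else m u w) ≤ 2 * ε * ∑ w, c u w := by
      intro u
      by_cases h : ∑ w, c u w ≤ 1 - ε
      · simp only [h, if_true, Finset.sum_const_zero]
        exact mul_nonneg (by linarith) (Finset.sum_nonneg fun w _ => hc0 u w)
      · simp only [h, if_false]
        exact big _ _ (Finset.sum_nonneg fun w _ => hc0 u w) (hrow u) h
    have hb2 : ∀ w, (∑ u, if ∑ u, c u w ≤ 1 - ε then 0 else m u w) ≤ 2 * ε * ∑ u, c u w := by
      intro w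
      by_cases h : ∑ u, c u w ≤ 1 - ε
      · simp only [h, if_true, Finset.sum_const_zero]
        exact mul_nonneg (by linarith) (Finset.sum_nonneg fun u _ => hc0 u w)
      · simp only [h, if_false]
        exact big _ _ (Finset.sum_nonneg fun u _ => hc0 u w) (hcol w) h
    have hs3 := Finset.sum_le_sum fun u (_ : u ∈ Finset.univ) => hb1 u
    have hs4 := Finset.sum_le_sum fun w (_ : w ∈ Finset.univ) => hb2 w
    rw [← Finset.mul_sum] at hs3 hs4
    rw [Finset.sum_comm, Finset.sum_comm (f := fun w u => c u w)] at hs4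
    have hpt : ∀ u w, m u w ≤ m' u w + ((if ∑ w, c u w ≤ 1 - ε then 0 else m u w) +
        if ∑ u, c u w ≤ 1 - ε then 0 else m u w) := by
      intro u w
      have := hm0 u w
      simp only [hm']
      by_cases h1 : ∑ w, c u w ≤ 1 - ε <;> by_cases h2 : ∑ u, c u w ≤ 1 - ε <;>
        simp [h1, h2, this]
    have hs5 := Finset.sum_le_sum fun u (_ : u ∈ Finset.univ) =>
      Finset.sum_le_sum fun w (_ : w ∈ Finset.univ) => hpt u w
    simp only [Finset.sum_add_distrib] at hs5
    linarith
  have hm'N : ∑ u, ∑ w, m' u w ≤ ∑ u, ∑ w, m u w :=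
    Finset.sum_le_sum fun u _ => Finset.sum_le_sum fun w _ => hm'm u w
  have hC0 : 0 ≤ ∑ u, ∑ w, c u w :=
    Finset.sum_nonneg fun u _ => Finset.sum_nonneg fun w _ => hc0 u w
  rw [hEg]
  -- The coefficient of `m'` is `1 - ε` minus `ε/2` for the deviations of the rows and `ε/2` for
  -- those of the columns.
  have hdisc' := mul_le_mul_of_nonneg_left hdisc (by linarith : 0 ≤ 1 - 2 * ε)
  nlinarith [mul_nonneg hε.le hC0, mul_nonneg (mul_nonneg hε.le hε.le) hC0]

end Proposals

/-! ### Covers and matchings of relations -/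

section Covers

variable {ι κ : Type*} [Fintype ι] [Fintype κ]

/-- The least size of a set of rows and columns that covers the relation `h`. -/
noncomputable def coverNum (h : ι → κ → Prop) : ℕ :=
  sInf {k | ∃ (L : Finset ι) (R : Finset κ), (∀ u w, h u w → u ∈ L ∨ w ∈ R) ∧
    L.card + R.card = k}

theorem coverNum_le {h : ι → κ → Prop} {L : Finset ι} {R : Finset κ}
    (hLR : ∀ u w, h u w → u ∈ L ∨ w ∈ R) : coverNum h ≤ L.card + R.card :=
  Nat.sInf_le ⟨L, R, hLR, rfl⟩

theorem exists_cover (h : ι → κ → Prop) : ∃ (L : Finset ι) (R : Finset κ),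
    (∀ u w, h u w → u ∈ L ∨ w ∈ R) ∧ L.card + R.card = coverNum h :=
  Nat.sInf_mem (s := {k | ∃ (L : Finset ι) (R : Finset κ),
    (∀ u w, h u w → u ∈ L ∨ w ∈ R) ∧ L.card + R.card = k})
    ⟨_, Finset.univ, ∅, fun u _ _ => Or.inl (Finset.mem_univ u), rfl⟩

theorem coverNum_mono {h h' : ι → κ → Prop} (hh : ∀ u w, h u w → h' u w) :
    coverNum h ≤ coverNum h' := by
  obtain ⟨L, R, hLR, hc⟩ := exists_cover h'
  rw [← hc]
  exact coverNum_le fun u w huw => hLR u w (hh u w huw)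

/-- `M` contains at most one pair in every row and in every column. -/
structure IsRelMatching (M : ι → κ → Prop) : Prop where
  row : ∀ u w w', M u w → M u w' → w = w'
  col : ∀ u u' w, M u w → M u' w → u = u'

open Classical in
/-- The number of pairs in a relation. -/
noncomputable def relCard (M : ι → κ → Prop) : ℝ := ∑ u, ∑ w, if M u w then 1 else 0

open Classical in
theorem IsRelMatching.sum_row_le {M : ι → κ → Prop} (hM : IsRelMatching M) (u : ι) :
    (∑ w, if M u w then (1 : ℝ) else 0) ≤ 1 := by
  by_cases h : ∃ w, M u w
  · obtain ⟨w, hw⟩ := h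
    rw [Fintype.sum_eq_single w]
    · simp [hw]
    · intro w' hw'
      simp only [ite_eq_right_iff, one_ne_zero, imp_false]
      exact fun h => hw' (hM.row u w' w h hw)
  · push Not at h
    simp [h]

open Classical in
theorem IsRelMatching.sum_col_le {M : ι → κ → Prop} (hM : IsRelMatching M) (w : κ) :
    (∑ u, if M u w then (1 : ℝ) else 0) ≤ 1 := by
  by_cases h : ∃ u, M u w
  · obtain ⟨u, hu⟩ := h
    rw [Fintype.sum_eq_single u]
    · simp [hu]
    · intro u' hu'
      simp only [ite_eq_right_iff, one_ne_zero, imp_false]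
      exact fun h => hu' (hM.col u' u w h hu)
  · push Not at h
    simp [h]

theorem IsRelMatching.mono {M M' : ι → κ → Prop} (hM : IsRelMatching M)
    (h : ∀ u w, M' u w → M u w) : IsRelMatching M' :=
  ⟨fun u w w' h1 h2 => hM.row u w w' (h _ _ h1) (h _ _ h2),
    fun u u' w h1 h2 => hM.col u u' w (h _ _ h1) (h _ _ h2)⟩

/-- Weak duality: each member of a cover accounts for at most one pair of a matching. -/
theorem IsRelMatching.relCard_le {M h : ι → κ → Prop} (hM : IsRelMatching M)
    (hMh : ∀ u w, M u w → h u w) : relCard M ≤ coverNum h := by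
  classical
  obtain ⟨L, R, hLR, hc⟩ := exists_cover h
  rw [← hc]
  push_cast
  have h1 : ∀ u w, (if M u w then (1 : ℝ) else 0) ≤
      (if u ∈ L then (if M u w then 1 else 0) else 0) +
      (if w ∈ R then (if M u w then 1 else 0) else 0) := by
    intro u w
    by_cases hm : M u w
    · rcases hLR u w (hMh u w hm) with hl | hr
      · simp only [hm, hl, if_true]; split_ifs <;> norm_num
      · simp only [hm, hr, if_true]; split_ifs <;> norm_num
    · simp [hm]
  calc relCard M ≤ ∑ u, ∑ w, ((if u ∈ L then (if M u w then (1 : ℝ) else 0) else 0) +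
      (if w ∈ R then (if M u w then 1 else 0) else 0)) := by
        unfold relCard
        exact Finset.sum_le_sum fun u _ => Finset.sum_le_sum fun w _ => by convert h1 u w
    _ = ∑ u, (if u ∈ L then ∑ w, (if M u w then (1 : ℝ) else 0) else 0) +
        ∑ w, (if w ∈ R then ∑ u, (if M u w then 1 else 0) else 0) := by
      simp only [Finset.sum_add_distrib]
      congr 1
      · refine Finset.sum_congr rfl fun u _ => ?_
        split_ifs <;> simp
      · rw [Finset.sum_comm]
        refine Finset.sum_congr rfl fun w _ => ?_
        split_ifs <;> simp
    _ ≤ ∑ u, (if u ∈ L then (1 : ℝ) else 0) + ∑ w, (if w ∈ R then (1 : ℝ) else 0) := by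
      refine add_le_add (Finset.sum_le_sum fun u _ => ?_) (Finset.sum_le_sum fun w _ => ?_)
      · split_ifs
        · convert hM.sum_row_le u
        · exact le_refl _
      · split_ifs
        · convert hM.sum_col_le w
        · exact le_refl _
    _ = _ := by simp

/-- A rule that selects a maximum matching of every relation. -/
structure IsMatchingRule (S : (ι → κ → Prop) → ι → κ → Prop) : Prop where
  matching : ∀ h, IsRelMatching (S h)
  sub : ∀ h u w, S h u w → h u w
  opt : ∀ h, (coverNum h : ℝ) ≤ relCard (S h)

end Covers

/-! ### Partially queried graphs -/

section Queried

variable {n : ℕ}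

/-- The edges of `G` that may be present: those outside `Q`, and the realized ones in `Q`. -/
def candidate (G Q : SimpleGraph (Fin n)) (z : Fin n → Fin n → Bool) (u w : Fin n) : Prop :=
  G.Adj u w ∧ (Q.Adj u w → z u w = true)

/-- The pairs of `h` that start in the first colour class. -/
def side (χ : Fin n → Bool) (h : Fin n → Fin n → Prop) (u w : Fin n) : Prop :=
  χ u = true ∧ h u w

/-- The expected cover number after querying `Q`. -/
noncomputable def coverE (χ : Fin n → Bool) (p : ℝ) (G Q : SimpleGraph (Fin n)) : ℝ :=
  bernE p (fun z => (coverNum (side χ (candidate G Q z)) : ℝ))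

open Classical in
/-- The probability that the rule `S` selects the pair `u w`. -/
noncomputable def selectProb (S : (Fin n → Fin n → Prop) → Fin n → Fin n → Prop) (p : ℝ)
    (G Q : SimpleGraph (Fin n)) (u w : Fin n) : ℝ :=
  bernE p (fun z => if S (candidate G Q z) u w then 1 else 0)

variable {S : (Fin n → Fin n → Prop) → Fin n → Fin n → Prop} {χ : Fin n → Bool}
  {G Q Q' : SimpleGraph (Fin n)} {p p₁ : ℝ}

/-- The rule does not know the colouring and treats both orientations of the edges at once. A cover
of the whole relation splits into covers of the two orientations; since weak duality holds on each,
optimality of the total matching forces optimality on the first side. -/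
theorem coverNum_side_le (hS : IsMatchingRule S) {h : Fin n → Fin n → Prop}
    (hχ : ∀ u w, h u w → χ u ≠ χ w) :
    (coverNum (side χ h) : ℝ) ≤ relCard (side χ (S h)) := by
  classical
  obtain ⟨L, R, hLR, hc⟩ := exists_cover h
  have e1 : coverNum (side χ h) ≤
      (L.filter (fun u => χ u = true)).card + (R.filter (fun u => χ u = false)).card := by
    refine coverNum_le fun u w huw => ?_
    have h1 := hχ u w huw.2
    rw [huw.1] at h1
    rcases hLR u w huw.2 with h | h
    · left; simp [h, huw.1]
    · right; simpa [h] using h1.symm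
  have e2 : coverNum (fun u w => χ u = false ∧ h u w) ≤
      (L.filter (fun u => χ u = false)).card + (R.filter (fun u => χ u = true)).card := by
    refine coverNum_le fun u w huw => ?_
    have h1 := hχ u w huw.2
    rw [huw.1] at h1
    rcases hLR u w huw.2 with h | h
    · left; simp [h, huw.1]
    · right; simpa [h] using h1.symm
  have e3 : relCard (fun u w => χ u = false ∧ S h u w) ≤
      coverNum (fun u w => χ u = false ∧ h u w) :=
    ((hS.matching h).mono fun u w h => h.2).relCard_le fun u w huw => ⟨huw.1, hS.sub h u w huw.2⟩
  have e4 : relCard (S h) = relCard (side χ (S h)) + relCard (fun u w => χ u = false ∧ S h u w) := by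
    unfold relCard
    rw [← Finset.sum_add_distrib]
    refine Finset.sum_congr rfl fun u _ => ?_
    rw [← Finset.sum_add_distrib]
    refine Finset.sum_congr rfl fun w _ => ?_
    unfold side
    cases hu : χ u <;> simp [hu]
  have e5 : ∀ A : Finset (Fin n), (A.filter (fun u => χ u = true)).card +
      (A.filter (fun u => χ u = false)).card = A.card := by
    intro A
    rw [← Finset.card_filter_add_card_filter_not (s := A) (fun u => χ u = true)]
    simp
  have e6 := hS.opt h
  have e7 := e5 L
  have e8 := e5 R
  have e9 : (coverNum (side χ h) : ℝ) + coverNum (fun u w => χ u = false ∧ h u w) ≤ coverNum h := by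
    rw [← hc]
    exact_mod_cast (by omega)
  linarith

theorem coverE_anti (hp0 : 0 ≤ p) (hp1 : p ≤ 1) (h : Q ≤ Q') : coverE χ p G Q' ≤ coverE χ p G Q :=
  bernE_mono hp0 hp1 fun _ => by
    refine Nat.cast_le.2 (coverNum_mono fun u w huw => ?_)
    exact ⟨huw.1, huw.2.1, fun hq => huw.2.2 (h hq)⟩

/-- Coupling: the denser random graph is the sparser one together with an independent one of density
`(p - p₁)/(1 - p₁)`. -/
theorem coverE_mono_prob (hp0 : 0 ≤ p₁) (hp : p₁ ≤ p) (hp1 : p ≤ 1) (hlt : p₁ < 1) :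
    coverE χ p₁ G G ≤ coverE χ p G G := by
  have h1 : 0 < 1 - p₁ := by linarith
  have hq0 : 0 ≤ (p - p₁) / (1 - p₁) := div_nonneg (by linarith) h1.le
  have hq1 : (p - p₁) / (1 - p₁) ≤ 1 := (div_le_one h1).2 (by linarith)
  have e := bernE_or (p₁ := p₁) (p₂ := (p - p₁) / (1 - p₁)) (p := p)
    (by field_simp; ring) (fun z => (coverNum (side χ (candidate G G z)) : ℝ))
  unfold coverE
  rw [← e]
  refine bernE_mono hp0 (by linarith) fun z₁ => ?_
  rw [← bernE_const (ι := Fin n) (κ := Fin n) ((p - p₁) / (1 - p₁))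
    (coverNum (side χ (candidate G G z₁)) : ℝ)]
  refine bernE_mono hq0 hq1 fun z₂ => ?_
  refine Nat.cast_le.2 (coverNum_mono fun u w huw => ?_)
  exact ⟨huw.1, huw.2.1, fun hq => by simp [huw.2.2 hq]⟩

theorem bernE_ite_imp_ge (hp0 : 0 ≤ p) (hp1 : p ≤ 1) (P : Prop) [Decidable P] (u w : Fin n) :
    p ≤ bernE (ι := Fin n) (κ := Fin n) p (fun z => if (P → z u w = true) then 1 else 0) := by
  calc p = bernE (ι := Fin n) (κ := Fin n) p (fun z => if z u w then 1 else 0) :=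
        (bernE_entry p u w).symm
    _ ≤ _ := bernE_mono hp0 hp1 fun z => by
      by_cases h : z u w = true
      · simp [h]
      · rw [if_neg h]; split_ifs <;> norm_num

/-- Thinning the realized edges does not lose more than the thinning factor. -/
theorem coverE_thin (hS : IsMatchingRule S) (hχ : ∀ u w, G.Adj u w → χ u ≠ χ w) (hp0 : 0 ≤ p)
    (hp1 : p ≤ 1) {r : ℝ} (hr0 : 0 ≤ r) (hr1 : r ≤ 1) :
    r * coverE χ p G Q ≤ coverE χ (p * r) G Q := by
  classical
  have e := bernE_and (p₁ := p) (p₂ := r) (p := p * r) rfl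
    (fun z => (coverNum (side χ (candidate G Q z)) : ℝ))
  have e' : coverE χ (p * r) G Q = _ := e.symm
  rw [e', coverE, bernE, ← prodE_mul_left]
  refine bernE_mono hp0 hp1 fun z₁ => ?_
  set M := side χ (S (candidate G Q z₁)) with hM
  have h1 : (coverNum (side χ (candidate G Q z₁)) : ℝ) ≤ relCard M :=
    coverNum_side_le hS fun u w h => hχ u w h.1
  -- A maximum matching for `z₁` loses only the queried edges that the thinning removes; each of its
  -- edges survives with probability at least `r`, and unqueried ones survive for sure.
  have h2 : ∀ z₂ : Fin n → Fin n → Bool, relCard (fun u w => M u w ∧ (Q.Adj u w → z₂ u w = true)) ≤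
      coverNum (side χ (candidate G Q (fun i j => z₁ i j && z₂ i j))) := by
    intro z₂
    refine (((hS.matching _).mono (M' := M) fun u w h => h.2).mono fun u w h => h.1).relCard_le ?_
    intro u w h
    have h3 := hS.sub _ u w h.1.2
    exact ⟨h.1.1, h3.1, fun hq => by simp [h3.2 hq, h.2 hq]⟩
  refine le_trans ?_ (bernE_mono hr0 hr1 h2)
  unfold relCard bernE
  simp only [prodE_sum]
  calc r * (coverNum (side χ (candidate G Q z₁)) : ℝ) ≤ r * relCard M :=
        mul_le_mul_of_nonneg_left h1 hr0
    _ = ∑ u, ∑ w, r * (if M u w then 1 else 0) := by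
      unfold relCard; simp only [Finset.mul_sum]
    _ ≤ _ := by
      refine Finset.sum_le_sum fun u _ => Finset.sum_le_sum fun w _ => ?_
      by_cases hm : M u w
      · simp only [hm, true_and, if_true, mul_one]
        have := bernE_ite_imp_ge hr0 hr1 (Q.Adj u w) u w
        unfold bernE at this
        convert this
      · simp only [hm, false_and, if_false, mul_zero]
        exact (prodE_nonneg (fun _ => rowWeight_nonneg hr0 hr1) fun _ => le_refl _)

/-- Every pair that is still missing after a step is rarely selected. -/
def GoodStep (S : (Fin n → Fin n → Prop) → Fin n → Fin n → Prop) (p : ℝ) (R : ℕ)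
    (G Q Q' : SimpleGraph (Fin n)) : Prop :=
  Q ≤ Q' ∧ ∀ u w, G.Adj u w → ¬ Q'.Adj u w → selectProb S p G Q u w ≤ 2 / R

/-- `Q` is reached from the empty graph by `i` good steps. -/
def GoodChain (S : (Fin n → Fin n → Prop) → Fin n → Fin n → Prop) (p : ℝ) (R : ℕ)
    (G : SimpleGraph (Fin n)) : ℕ → SimpleGraph (Fin n) → Prop
  | 0, Q => Q = ⊥
  | i + 1, Q' => ∃ Q, GoodChain S p R G i Q ∧ GoodStep S p R G Q Q'

theorem GoodChain.exists_seq {R : ℕ} : ∀ {i : ℕ} {Q : SimpleGraph (Fin n)},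
    GoodChain S p R G i Q → ∃ q : ℕ → SimpleGraph (Fin n), q i = Q ∧
      ∀ j < i, GoodStep S p R G (q j) (q (j + 1))
  | 0, Q, _ => ⟨fun _ => Q, rfl, by simp⟩
  | i + 1, Q', ⟨Q, hQ, hstep⟩ => by
    obtain ⟨q, hq, hs⟩ := hQ.exists_seq
    refine ⟨fun j => if j ≤ i then q j else Q', by simp, fun j hj => ?_⟩
    rcases Nat.lt_succ_iff_lt_or_eq.1 hj with h | h
    · have h1 : j ≤ i := h.le
      have h2 : j + 1 ≤ i := h
      simpa [h1, h2] using hs j h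
    · subst h
      simpa [hq] using hstep

theorem selectProb_nonneg (hp0 : 0 ≤ p) (hp1 : p ≤ 1) (u w : Fin n) :
    0 ≤ selectProb S p G Q u w :=
  prodE_nonneg (fun _ => rowWeight_nonneg hp0 hp1) fun z => by split_ifs <;> simp

theorem selectProb_eq_zero (hS : IsMatchingRule S) {u w : Fin n} (h : ¬ G.Adj u w) :
    selectProb S p G Q u w = 0 := by
  unfold selectProb
  have : ∀ z, ¬ S (candidate G Q z) u w := fun z hs => h (hS.sub _ u w hs).1
  simp [this, bernE_const]

theorem sum_row_selectProb_le (hS : IsMatchingRule S) (hp0 : 0 ≤ p) (hp1 : p ≤ 1) (u : Fin n) :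
    ∑ w, selectProb S p G Q u w ≤ 1 := by
  classical
  unfold selectProb bernE
  rw [← prodE_sum]
  refine le_trans (bernE_mono hp0 hp1 fun z => (hS.matching _).sum_row_le u) ?_
  rw [bernE_const]

theorem sum_col_selectProb_le (hS : IsMatchingRule S) (hp0 : 0 ≤ p) (hp1 : p ≤ 1) (w : Fin n) :
    ∑ u, selectProb S p G Q u w ≤ 1 := by
  classical
  unfold selectProb bernE
  rw [← prodE_sum]
  refine le_trans (bernE_mono hp0 hp1 fun z => (hS.matching _).sum_col_le w) ?_
  rw [bernE_const]

theorem selectProb_le_one (hS : IsMatchingRule S) (hp0 : 0 ≤ p) (hp1 : p ≤ 1) (u w : Fin n) :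
    selectProb S p G Q u w ≤ 1 :=
  (Finset.single_le_sum (fun w _ => selectProb_nonneg hp0 hp1 u w) (Finset.mem_univ w)).trans
    (sum_row_selectProb_le hS hp0 hp1 u)

-- The expected size of the selected matching on the first side dominates the expected cover number,
-- by optimality of `S`.
open Classical in
theorem coverE_le_sum_selectProb (hS : IsMatchingRule S) (hχ : ∀ u w, G.Adj u w → χ u ≠ χ w)
    (hp0 : 0 ≤ p) (hp1 : p ≤ 1) :
    coverE χ p G Q ≤ ∑ u, ∑ w, if χ u = true then selectProb S p G Q u w else 0 := by
  have h1 : coverE χ p G Q ≤ bernE p (fun z => relCard (side χ (S (candidate G Q z)))) :=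
    bernE_mono hp0 hp1 fun z => coverNum_side_le hS fun u w h => hχ u w h.1
  refine h1.trans (le_of_eq ?_)
  unfold relCard bernE
  simp only [prodE_sum]
  refine Finset.sum_congr rfl fun u _ => Finset.sum_congr rfl fun w _ => ?_
  unfold side selectProb
  by_cases h : χ u = true
  · simp [h, bernE]
  · simp only [h, if_false, Bool.false_eq_true, false_and]
    exact prodE_const (fun _ => sum_rowWeight p) 0

-- Selected edges that lie in `Q` are realized, so they form a matching of the random graph itself.
open Classical in
theorem sum_selectProb_queried_le (hS : IsMatchingRule S) (hp0 : 0 ≤ p) (hp1 : p ≤ 1) :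
    ∑ u, ∑ w, (if χ u = true ∧ Q.Adj u w then selectProb S p G Q u w else 0) ≤ coverE χ p G G := by
  have h1 : bernE p (fun z => relCard (fun u w => (χ u = true ∧ Q.Adj u w) ∧
      S (candidate G Q z) u w)) ≤ coverE χ p G G := by
    refine bernE_mono hp0 hp1 fun z => ?_
    refine ((hS.matching (candidate G Q z)).mono fun u w h => h.2).relCard_le fun u w h => ?_
    have h2 := hS.sub _ u w h.2
    exact ⟨h.1.1, h2.1, fun _ => h2.2 h.1.2⟩
  refine le_trans (le_of_eq ?_) h1
  unfold relCard bernE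
  simp only [prodE_sum]
  refine Finset.sum_congr rfl fun u _ => Finset.sum_congr rfl fun w _ => ?_
  unfold selectProb
  by_cases h : χ u = true ∧ Q.Adj u w
  · simp [h, bernE]
  · simp only [h, false_and, if_false]
    exact (prodE_const (fun _ => sum_rowWeight p) 0).symm

end Queried

/-! ### Chains of good steps: combining all rounds into one system of proposals and loads. -/

section Chain

variable {n : ℕ} {S : (Fin n → Fin n → Prop) → Fin n → Fin n → Prop} {χ : Fin n → Bool}
  {G Q : SimpleGraph (Fin n)} {p p₁ : ℝ}

open Classical in
/-- The probability that `S` selects `u w`, given that the row `u` is `r`. -/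
noncomputable def selectGiven (S : (Fin n → Fin n → Prop) → Fin n → Fin n → Prop) (p : ℝ)
    (G Q : SimpleGraph (Fin n)) (u : Fin n) (r : Fin n → Bool) (w : Fin n) : ℝ :=
  bernE p (fun z => if S (candidate G Q (Function.update z u r)) u w then 1 else 0)

theorem selectGiven_nonneg (hp0 : 0 ≤ p) (hp1 : p ≤ 1) (u : Fin n) (r : Fin n → Bool)
    (w : Fin n) : 0 ≤ selectGiven S p G Q u r w :=
  prodE_nonneg (fun _ => rowWeight_nonneg hp0 hp1) fun z => by split_ifs <;> simp

theorem sum_selectGiven_le (hS : IsMatchingRule S) (hp0 : 0 ≤ p) (hp1 : p ≤ 1) (u : Fin n)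
    (r : Fin n → Bool) : ∑ w, selectGiven S p G Q u r w ≤ 1 := by
  classical
  unfold selectGiven bernE
  rw [← prodE_sum]
  refine le_trans (bernE_mono hp0 hp1 fun z => (hS.matching _).sum_row_le u) ?_
  rw [bernE_const]

/-- A vertex that knows only its own row and simulates the others still selects its partner with the
correct probability. In this way dependent selections become independent proposals. -/
theorem sum_rowWeight_selectGiven (u w : Fin n) :
    ∑ r, rowWeight p r * selectGiven S p G Q u r w = selectProb S p G Q u w := by
  classical
  have := prodE_update (w := fun (_ : Fin n) => rowWeight (κ := Fin n) p) u (sum_rowWeight p)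
    (fun z => if S (candidate G Q z) u w then (1 : ℝ) else 0)
  unfold selectGiven selectProb bernE
  convert this

theorem selectGiven_ne_zero (hS : IsMatchingRule S) {u : Fin n} {r : Fin n → Bool} {w : Fin n}
    (h : selectGiven S p G Q u r w ≠ 0) : G.Adj u w ∧ (Q.Adj u w → r w = true) := by
  by_contra hc
  apply h
  have : ∀ z, ¬ S (candidate G Q (Function.update z u r)) u w := by
    intro z hs
    have := hS.sub _ u w hs
    simp only [candidate, Function.update_self] at this
    exact hc this
  unfold selectGiven
  simp [this, bernE_const]

/-- The graph at the end of a chain of good steps has a small expected cover number. -/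
theorem coverE_le_of_goodChain (hS : IsMatchingRule S) (hχ : ∀ u w, G.Adj u w → χ u ≠ χ w)
    {ε : ℝ} {R : ℕ} (hp0 : 0 < p) (hp1 : p ≤ 1) (hε : 0 < ε) (hε1 : ε ≤ 1 / 8)
    (hl : (1 - 2 * ε) * p ≤ p₁) (hu : p₁ ≤ (1 - ε) * p) (hR : 0 < R)
    (hRp : 3 / (R : ℝ) ≤ 2 * ε ^ 5 * p) (hQ : GoodChain S p₁ R G R Q) :
    (1 - 4 * ε) * (1 - 2 * ε) * coverE χ p G Q ≤ (1 + Real.exp (-1)) * coverE χ p G G := by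
  classical
  obtain ⟨qs, hqR, hstep⟩ := hQ.exists_seq
  have hR' : (0 : ℝ) < R := by exact_mod_cast hR
  have h10 : 0 ≤ p₁ := le_trans (mul_nonneg (by linarith) hp0.le) hl
  have hp₁p : p₁ ≤ p := hu.trans (by nlinarith)
  have h11 : p₁ < 1 := by nlinarith
  have hmono : ∀ i j, i ≤ j → j ≤ R → qs i ≤ qs j := by
    intro i j hij hj
    induction j, hij using Nat.le_induction with
    | base => exact le_refl _
    | succ j hij ih => exact (ih (by omega)).trans (hstep j (by omega)).1
  set X : ℕ → Fin n → Fin n → ℝ := fun i => selectProb S p₁ G (qs i) with hX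
  have hX0 : ∀ i u w, 0 ≤ X i u w := fun i u w => selectProb_nonneg h10 h11.le u w
  have hX1 : ∀ i u w, X i u w ≤ 1 := fun i u w => selectProb_le_one hS h10 h11.le u w
  -- The averages over the rounds: `c` collects the selections of edges already queried, `m` those
  -- of edges not yet queried. `k` is the proposal law given the row: a uniformly random round is
  -- simulated, and a proposal is made only along a queried edge.
  set c : Fin n → Fin n → ℝ := fun u w =>
    (R : ℝ)⁻¹ * ∑ i ∈ Finset.range R, if χ u = true ∧ (qs i).Adj u w then X i u w else 0 with hc
  set m : Fin n → Fin n → ℝ := fun u w =>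
    (R : ℝ)⁻¹ * ∑ i ∈ Finset.range R, if χ u = true ∧ ¬ (qs i).Adj u w then X i u w else 0 with hm
  set k : Fin n → (Fin n → Bool) → Fin n → ℝ := fun u r w =>
    (R : ℝ)⁻¹ * ∑ i ∈ Finset.range R,
      if χ u = true ∧ (qs i).Adj u w then selectGiven S p₁ G (qs i) u r w else 0 with hk
  have hcm : ∀ u w, c u w + m u w =
      (R : ℝ)⁻¹ * ∑ i ∈ Finset.range R, if χ u = true then X i u w else 0 := by
    intro u w
    simp only [hc, hm]
    rw [← mul_add, ← Finset.sum_add_distrib]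
    congr 1
    refine Finset.sum_congr rfl fun i _ => ?_
    by_cases h1 : χ u = true <;> by_cases h2 : (qs i).Adj u w <;> simp [h1, h2]
  have havg : ∀ (f : ℕ → ℝ) (B : ℝ), (∀ i ∈ Finset.range R, f i ≤ B) →
      (R : ℝ)⁻¹ * ∑ i ∈ Finset.range R, f i ≤ B := by
    intro f B hf
    have := Finset.sum_le_sum hf
    simp only [Finset.sum_const, Finset.card_range, nsmul_eq_mul] at this
    rw [inv_mul_le_iff₀ hR']
    exact this
  set E : Fin n → Fin n → Prop := fun u w => χ u = true ∧ G.Adj u w with hE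
  set q : ℝ := (p - p₁) / (1 - p₁) with hq
  have h1p : 0 < 1 - p₁ := by linarith
  -- `1 - p₁ ≤ 1` and `p - p₁ ≥ ε p`: this is the use of sampling at a density below `p`.
  have hqp : ε * p ≤ q := by
    rw [hq, le_div_iff₀ h1p]
    nlinarith [mul_nonneg hε.le hp0.le]
  have hq0 : 0 < q := lt_of_lt_of_le (by positivity) hqp
  have hq1 : q ≤ 1 := (div_le_one h1p).2 (by linarith)
  have hm_le : ∀ u w, m u w ≤ 3 / R := by
    intro u w
    by_cases hG : G.Adj u w
    · have hb : ∀ i ∈ Finset.range R, (if χ u = true ∧ ¬ (qs i).Adj u w then X i u w else 0) ≤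
          2 / R + ((if (qs (i + 1)).Adj u w then (1 : ℝ) else 0) -
            (if (qs i).Adj u w then 1 else 0)) := by
        intro i hi
        have hs := hstep i (Finset.mem_range.1 hi)
        have h2R : (0 : ℝ) ≤ 2 / R := by positivity
        by_cases h1 : (qs i).Adj u w
        · have h2 := hs.1 h1
          simp only [h1, h2, not_true_eq_false, and_false, if_false, if_true, sub_self, add_zero]
          exact h2R
        · by_cases h2 : (qs (i + 1)).Adj u w
          · simp only [h1, h2, not_false_eq_true, and_true, if_true, if_false]
            split_ifs <;> linarith [hX1 i u w]
          · simp only [h1, h2, not_false_eq_true, and_true, if_false, sub_zero, add_zero]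
            split_ifs
            · exact hs.2 u w hG h2
            · exact h2R
      have hs := Finset.sum_le_sum hb
      rw [Finset.sum_add_distrib,
        Finset.sum_range_sub (fun i => if (qs i).Adj u w then (1 : ℝ) else 0)] at hs
      simp only [Finset.sum_const, Finset.card_range, nsmul_eq_mul] at hs
      have h3 : (R : ℝ) * (2 / R) = 2 := by field_simp
      have h4 : ((if (qs R).Adj u w then (1 : ℝ) else 0) - if (qs 0).Adj u w then 1 else 0) ≤ 1 := by
        split_ifs <;> norm_num
      simp only [hm]
      rw [inv_mul_le_iff₀ hR']
      have h5 : (R : ℝ) * (3 / R) = 3 := by field_simp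
      linarith
    · have : ∀ i, X i u w = 0 := fun i => selectProb_eq_zero hS hG
      simp only [hm, this, ite_self, Finset.sum_const_zero, mul_zero]
      positivity
  have hrow : ∀ u, ∑ w, c u w + ∑ w, m u w ≤ 1 := by
    intro u
    rw [← Finset.sum_add_distrib]
    simp only [hcm]
    rw [← Finset.mul_sum, Finset.sum_comm]
    refine havg _ _ fun i _ => ?_
    by_cases h : χ u = true
    · simp only [h, if_true]; exact sum_row_selectProb_le hS h10 h11.le u
    · simp [h]
  have hcol : ∀ w, ∑ u, c u w + ∑ u, m u w ≤ 1 := by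
    intro w
    rw [← Finset.sum_add_distrib]
    simp only [hcm]
    rw [← Finset.mul_sum, Finset.sum_comm]
    refine havg _ _ fun i _ => ?_
    refine le_trans (Finset.sum_le_sum fun u _ => ?_)
      (sum_col_selectProb_le (G := G) (Q := qs i) hS h10 h11.le w)
    split_ifs
    · exact le_refl _
    · exact hX0 i u w
  -- Here `δ = 3/R ≤ 2 ε^5 p ≤ 2 ε^4 q`.
  have hmain := proposal_bound (E := E) (c := c) (m := m) (k := k)
    (V := fun z => (coverNum (side χ (candidate G G z)) : ℝ)) (p := p₁) (q := q) (ε := ε)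
    (δ := 3 / R) h10 h11.le hq0 hq1 hε (by linarith)
    (by
      refine hRp.trans ?_
      have : 0 ≤ 2 * ε ^ 4 := by positivity
      nlinarith [mul_le_mul_of_nonneg_left hqp this])
    (by
      intro u r w
      refine mul_nonneg (by positivity) (Finset.sum_nonneg fun i _ => ?_)
      split_ifs
      · exact selectGiven_nonneg h10 h11.le u r w
      · exact le_refl _)
    (by
      intro u r
      simp only [hk]
      rw [← Finset.mul_sum, Finset.sum_comm]
      refine havg _ _ fun i _ => ?_
      refine le_trans (Finset.sum_le_sum fun w _ => ?_)
        (sum_selectGiven_le (G := G) (Q := qs i) hS h10 h11.le u r)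
      split_ifs
      · exact le_refl _
      · exact selectGiven_nonneg h10 h11.le u r w)
    (by
      intro u r w h
      have h1 : ∑ i ∈ Finset.range R,
        (if χ u = true ∧ (qs i).Adj u w then selectGiven S p₁ G (qs i) u r w else 0) ≠ 0 :=
        right_ne_zero_of_mul h
      obtain ⟨i, _, hi⟩ := Finset.exists_ne_zero_of_sum_ne_zero h1
      by_cases h2 : χ u = true ∧ (qs i).Adj u w
      · rw [if_pos h2] at hi
        have h3 := selectGiven_ne_zero hS hi
        exact ⟨⟨h2.1, h3.1⟩, h3.2 h2.2⟩
      · simp [h2] at hi)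
    (by
      intro u w
      simp only [hk, hc]
      have : ∀ r : Fin n → Bool, rowWeight p₁ r * ((R : ℝ)⁻¹ * ∑ i ∈ Finset.range R,
          if χ u = true ∧ (qs i).Adj u w then selectGiven S p₁ G (qs i) u r w else 0) =
          (R : ℝ)⁻¹ * ∑ i ∈ Finset.range R, if χ u = true ∧ (qs i).Adj u w then
            rowWeight p₁ r * selectGiven S p₁ G (qs i) u r w else 0 := by
        intro r
        rw [mul_left_comm, Finset.mul_sum]
        congr 1
        refine Finset.sum_congr rfl fun i _ => ?_
        split_ifs <;> simp
      simp only [this]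
      rw [← Finset.mul_sum, Finset.sum_comm]
      congr 1
      refine Finset.sum_congr rfl fun i _ => ?_
      by_cases h : χ u = true ∧ (qs i).Adj u w
      · simp only [if_pos h]
        exact sum_rowWeight_selectGiven u w
      · simp only [if_neg h, Finset.sum_const_zero])
    (by
      intro u w
      refine mul_nonneg (by positivity) (Finset.sum_nonneg fun i _ => ?_)
      split_ifs
      · exact hX0 i u w
      · exact le_refl _)
    (by
      intro u w h
      have h1 : ∑ i ∈ Finset.range R,
        (if χ u = true ∧ ¬ (qs i).Adj u w then X i u w else 0) ≠ 0 := right_ne_zero_of_mul h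
      obtain ⟨i, _, hi⟩ := Finset.exists_ne_zero_of_sum_ne_zero h1
      by_cases h2 : χ u = true ∧ ¬ (qs i).Adj u w
      · rw [if_pos h2] at hi
        refine ⟨h2.1, ?_⟩
        by_contra hG
        exact hi (selectProb_eq_zero hS hG)
      · simp [h2] at hi)
    hm_le hrow hcol
    (by
      intro z
      obtain ⟨L, T, hLT, hcard⟩ := exists_cover (side χ (candidate G G z))
      refine ⟨L, T, fun u w huw hz => hLT u w ⟨huw.1, huw.2, fun _ => hz⟩, ?_⟩
      rw [← hcard]; push_cast; exact le_refl _)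
  rw [bernE_or (p := p) (by rw [hq]; field_simp; ring)
    (fun z => (coverNum (side χ (candidate G G z)) : ℝ))] at hmain
  have hC : ∑ u, ∑ w, c u w ≤ coverE χ p G G := by
    refine le_trans ?_ (coverE_mono_prob (χ := χ) (G := G) h10 hp₁p hp1 h11)
    simp only [hc, ← Finset.mul_sum]
    have e : ∑ u, ∑ w, ∑ i ∈ Finset.range R, (if χ u = true ∧ (qs i).Adj u w then X i u w else 0) =
        ∑ i ∈ Finset.range R, ∑ u, ∑ w, if χ u = true ∧ (qs i).Adj u w then X i u w else 0 := by
      rw [Finset.sum_comm]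
      rw [Finset.sum_congr rfl fun w _ => Finset.sum_comm]
      rw [Finset.sum_comm]
      exact Finset.sum_congr rfl fun i _ => Finset.sum_comm
    rw [e]
    exact havg _ _ fun i _ => sum_selectProb_queried_le hS h10 h11.le
  -- In round `i` the expected matching has size at least `coverE χ p₁ G (qs i)`, and this is at
  -- least the value for the larger graph `Q`.
  have hF : coverE χ p₁ G Q ≤ ∑ u, ∑ w, c u w + ∑ u, ∑ w, m u w := by
    rw [← Finset.sum_add_distrib]
    simp only [← Finset.sum_add_distrib, hcm, ← Finset.mul_sum]
    have e : ∑ u, ∑ w, ∑ i ∈ Finset.range R, (if χ u = true then X i u w else 0) =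
        ∑ i ∈ Finset.range R, ∑ u, ∑ w, if χ u = true then X i u w else 0 := by
      rw [Finset.sum_comm]
      rw [Finset.sum_congr rfl fun w _ => Finset.sum_comm]
      rw [Finset.sum_comm]
      exact Finset.sum_congr rfl fun i _ => Finset.sum_comm
    rw [e, le_inv_mul_iff₀ hR']
    have : ∀ i ∈ Finset.range R, coverE χ p₁ G Q ≤
        ∑ u, ∑ w, if χ u = true then X i u w else 0 := by
      intro i hi
      refine le_trans ?_ (coverE_le_sum_selectProb hS hχ h10 h11.le)
      rw [← hqR]
      exact coverE_anti h10 h11.le (hmono i R (Finset.mem_range.1 hi).le le_rfl)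
    have := Finset.sum_le_sum this
    simpa using this
  have hthin := coverE_thin (Q := Q) (r := p₁ / p) hS hχ hp0.le hp1 (by positivity)
    ((div_le_one hp0).2 hp₁p)
  rw [mul_div_cancel₀ _ hp0.ne'] at hthin
  have hr : 1 - 2 * ε ≤ p₁ / p := by rw [le_div_iff₀ hp0]; exact hl
  have hcov0 : 0 ≤ coverE χ p G Q :=
    prodE_nonneg (fun _ => rowWeight_nonneg hp0.le hp1) fun z => by positivity
  have h1 := (mul_le_mul_of_nonneg_right hr hcov0).trans (hthin.trans hF)
  have h2 := mul_le_mul_of_nonneg_left h1 (by linarith : 0 ≤ 1 - 4 * ε)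
  have h3 := mul_le_mul_of_nonneg_left hC (Real.exp_pos (-1)).le
  have hN0 : 0 ≤ ∑ u, ∑ w, m u w := Finset.sum_nonneg fun u _ => Finset.sum_nonneg fun w _ =>
      mul_nonneg (by positivity) (Finset.sum_nonneg fun i _ => by
        split_ifs
        · exact hX0 i u w
        · exact le_refl _)
  -- Adding `exp (-1)` times the total of `c`, which is at most `exp (-1)` times opt by `h3`, leaves
  -- at least `1 - 4ε` times the total of `c + m` on the left.
  have h4 : (1 - Real.exp (-1)) * ∑ u, ∑ w, c u w + (1 - 2 * ε) * ∑ u, ∑ w, m u w -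
      4 * ε * ∑ u, ∑ w, c u w ≤ coverE χ p G G := hmain
  have h5 := mul_nonneg hε.le hN0
  linarith

end Chain

/-! ### Random subgraphs of bipartite graphs as random matrices -/

section Realize

variable {n : ℕ} {χ : Fin n → Bool} {G Q H : SimpleGraph (Fin n)}

/-- The subgraph of `G` whose edges are given by the rows of `z` in the first colour class. -/
def realize (χ : Fin n → Bool) (G : SimpleGraph (Fin n)) (z : Fin n → Fin n → Bool) :
    SimpleGraph (Fin n) where
  Adj u w := G.Adj u w ∧ ((χ u = true ∧ z u w = true) ∨ (χ w = true ∧ z w u = true))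
  symm := ⟨fun _ _ h => ⟨h.1.symm, h.2.symm⟩⟩
  loopless := ⟨fun u h => G.loopless.irrefl u h.1⟩

theorem realize_le (z : Fin n → Fin n → Bool) : realize χ G z ≤ G := fun _ _ h => h.1

theorem realize_adj (hχ : ∀ u w, G.Adj u w → χ u ≠ χ w) {z : Fin n → Fin n → Bool} {u w : Fin n}
    (hu : χ u = true) : (realize χ G z).Adj u w ↔ G.Adj u w ∧ z u w = true := by
  constructor
  · rintro ⟨h1, h2⟩
    refine ⟨h1, ?_⟩
    rcases h2 with h2 | h2
    · exact h2.2
    · exact absurd (hu.trans h2.1.symm) (hχ u w h1)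
  · exact fun h => ⟨h.1, Or.inl ⟨hu, h.2⟩⟩

open Classical in
theorem edgeSet_realize_eq_iff (hχ : ∀ u w, G.Adj u w → χ u ≠ χ w) {F : Set (Sym2 (Fin n))}
    (hF : F ⊆ G.edgeSet) (z : Fin n → Fin n → Bool) :
    (realize χ G z).edgeSet = F ↔
      ∀ u w, χ u = true ∧ G.Adj u w → z u w = decide (s(u, w) ∈ F) := by
  constructor
  · rintro rfl u w ⟨hu, huw⟩
    have := realize_adj (z := z) (w := w) hχ hu
    rw [Bool.eq_iff_iff]
    simp [this, huw]
  · intro h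
    ext e
    induction e using Sym2.ind with
    | _ u w =>
      rw [SimpleGraph.mem_edgeSet]
      by_cases huw : G.Adj u w
      · have key : ∀ u w, G.Adj u w → χ u = true →
            ((realize χ G z).Adj u w ↔ s(u, w) ∈ F) := by
          intro u w huw hu
          rw [realize_adj hχ hu, h u w ⟨hu, huw⟩]
          simp [huw]
        cases hu : χ u with
        | true => exact key u w huw hu
        | false =>
          have hw : χ w = true := by
            have := hχ u w huw
            rw [hu] at this
            simpa using this.symm
          rw [SimpleGraph.adj_comm, Sym2.eq_swap]
          exact key w u huw.symm hw
      · exact ⟨fun h => absurd h.1 huw, fun h => absurd ((SimpleGraph.mem_edgeSet G).1 (hF h)) huw⟩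

-- In a bipartite graph every edge has exactly one endpoint in the first class and so reads exactly
-- one entry of the matrix. The entries that are never read have total weight one.
open Classical in
theorem bernE_edgeSet_realize (hχ : ∀ u w, G.Adj u w → χ u ≠ χ w) (p : unitInterval)
    (F : Set (Sym2 (Fin n))) :
    bernE (p : ℝ) (fun z => if (realize χ G z).edgeSet = F then 1 else 0) =
      (setBernoulli G.edgeSet p).real {F} := by
  by_cases hF : F ⊆ G.edgeSet
  · rw [setBernoulli_real_singleton p hF (Set.toFinite _)]
    have e1 : ∀ z : Fin n → Fin n → Bool, (if (realize χ G z).edgeSet = F then (1 : ℝ) else 0) =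
        ∏ u, ∏ w, (if χ u = true ∧ G.Adj u w then
          (if z u w = decide (s(u, w) ∈ F) then 1 else 0) else 1) := by
      intro z
      have hiff := edgeSet_realize_eq_iff hχ hF z
      have : ∀ u w, (if χ u = true ∧ G.Adj u w then
          (if z u w = decide (s(u, w) ∈ F) then (1 : ℝ) else 0) else 1) =
          if (χ u = true ∧ G.Adj u w → z u w = decide (s(u, w) ∈ F)) then 1 else 0 := by
        intro u w
        by_cases h : χ u = true ∧ G.Adj u w <;> simp [h]
      simp only [this, Finset.prod_ite_zero, Finset.prod_const_one, Finset.mem_univ, forall_true_left]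
      by_cases h : (realize χ G z).edgeSet = F
      · rw [if_pos h, if_pos (hiff.1 h)]
      · rw [if_neg h, if_neg (fun h' => h (hiff.2 h'))]
    simp only [e1]
    rw [bernE_prod (p : ℝ) (fun u w b => if χ u = true ∧ G.Adj u w then
          (if b = decide (s(u, w) ∈ F) then 1 else 0) else 1)]
    have e2 : ∀ u w, ∑ b, bern (p : ℝ) b * (if χ u = true ∧ G.Adj u w then
          (if b = decide (s(u, w) ∈ F) then 1 else 0) else 1) =
        if χ u = true ∧ G.Adj u w then (if s(u, w) ∈ F then (p : ℝ) else 1 - p) else 1 := by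
      intro u w
      by_cases h : χ u = true ∧ G.Adj u w
      · simp only [if_pos h]
        by_cases hf : s(u, w) ∈ F <;> simp [hf, bern]
      · simp [h, bern]
    simp only [e2]
    rw [← Finset.prod_product' Finset.univ Finset.univ (fun u w => if χ u = true ∧ G.Adj u w then
      (if s(u, w) ∈ F then (p : ℝ) else 1 - p) else 1), ← Finset.prod_filter]
    -- Edges are indexed by their orientation out of the first colour class.
    have e3 : G.edgeSet.toFinset = ((Finset.univ ×ˢ Finset.univ).filter
        (fun x : Fin n × Fin n => χ x.1 = true ∧ G.Adj x.1 x.2)).image (fun x => s(x.1, x.2)) := by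
      ext e
      induction e using Sym2.ind with
      | _ u w =>
        simp only [Set.mem_toFinset, SimpleGraph.mem_edgeSet, Finset.mem_image, Finset.mem_filter,
          Finset.mem_product, Finset.mem_univ, true_and, Prod.exists, and_self]
        constructor
        · intro huw
          cases hu : χ u with
          | true => exact ⟨u, w, ⟨hu, huw⟩, rfl⟩
          | false =>
            have hw : χ w = true := by
              have := hχ u w huw
              rw [hu] at this
              simpa using this.symm
            exact ⟨w, u, ⟨hw, huw.symm⟩, Sym2.eq_swap⟩
        · rintro ⟨a, b, ⟨_, hab⟩, he⟩
          rw [Sym2.eq_iff] at he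
          rcases he with ⟨rfl, rfl⟩ | ⟨rfl, rfl⟩
          · exact hab
          · exact hab.symm
    have e4 : ∏ e ∈ G.edgeSet.toFinset, (if e ∈ F then (p : ℝ) else 1 - p) =
        p ^ F.ncard * (1 - p : ℝ) ^ (G.edgeSet \ F).ncard := by
      rw [Finset.prod_ite, Finset.prod_const, Finset.prod_const]
      congr 2
      · rw [← Set.ncard_coe_finset]; congr 1
        ext e; simpa using fun h => hF h
      · rw [← Set.ncard_coe_finset]; congr 1
        ext e; simp
    rw [← e4, e3, Finset.prod_image]
    rintro ⟨a, b⟩ h1 ⟨a', b'⟩ h2 he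
    simp only [Finset.coe_filter, Finset.mem_product, Finset.mem_univ, and_self, true_and,
      Set.mem_ofPred_eq] at h1 h2
    rw [Sym2.eq_iff] at he
    rcases he with ⟨rfl, rfl⟩ | ⟨rfl, rfl⟩
    · rfl
    · exact absurd (h1.1.trans h2.1.symm) (hχ _ _ h1.2)
  · rw [measureReal_def, setBernoulli_singleton_of_not_subset p hF]
    have : ∀ z, (realize χ G z).edgeSet ≠ F := fun z h =>
      hF (h ▸ SimpleGraph.edgeSet_mono (realize_le z))
    simp [this, bernE_const]

theorem expect_eq_bernE (hχ : ∀ u w, G.Adj u w → χ u ≠ χ w) (p : unitInterval)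
    (f : SimpleGraph (Fin n) → ℝ) :
    expect G p f = bernE (p : ℝ) (fun z => f (realize χ G z)) := by
  classical
  unfold expect
  rw [integral_fintype .of_finite]
  have e : ∀ z, f (realize χ G z) = ∑ F : Set (Sym2 (Fin n)),
      f (SimpleGraph.fromEdgeSet F) * (if (realize χ G z).edgeSet = F then 1 else 0) := by
    intro z; simp
  simp only [e]
  unfold bernE
  simp only [prodE_sum, prodE_mul_left]
  refine Finset.sum_congr rfl fun F _ => ?_
  have := bernE_edgeSet_realize hχ p F
  unfold bernE at this
  rw [this, smul_eq_mul, mul_comm]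

/-! ### Vertex covers of bipartite graphs -/

theorem exists_isMinVertexCover (H : SimpleGraph (Fin n)) : ∃ C, IsMinVertexCover H C := by
  classical
  obtain ⟨C, hC, hmin⟩ := Finset.exists_min_image
    (Finset.univ.filter fun C : Finset (Fin n) => H.IsVertexCover (C : Set (Fin n)))
    Finset.card ⟨Finset.univ, by simp⟩
  exact ⟨C, (Finset.mem_filter.1 hC).2, fun D hD => hmin D (by simp [hD])⟩

theorem IsMinVertexCover.vertexCoverNum_eq {C : Finset (Fin n)} (hC : IsMinVertexCover H C) :
    H.vertexCoverNum.toNat = C.card := by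
  classical
  have h : H.vertexCoverNum = C.card := by
    apply le_antisymm
    · simpa using hC.1.vertexCoverNum_le
    · obtain ⟨s, hs, hc⟩ := H.vertexCoverNum_exists
      rw [← hs]
      have := hC.2 s.toFinset (by simpa using hc)
      rw [← Set.coe_toFinset s, Set.encard_coe_eq_coe_finsetCard]
      exact_mod_cast this
  simp [h]

theorem IsMinVertexCover.card_eq (hχ : ∀ u w, H.Adj u w → χ u ≠ χ w) {C : Finset (Fin n)}
    (hC : IsMinVertexCover H C) : C.card = coverNum (side χ H.Adj) := by
  classical
  apply le_antisymm
  · obtain ⟨L, R, hLR, hcard⟩ := exists_cover (side χ H.Adj)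
    rw [← hcard]
    refine (hC.2 (L ∪ R) ?_).trans (Finset.card_union_le _ _)
    intro u w huw
    have key : ∀ u w, H.Adj u w → χ u = true → u ∈ L ∪ R ∨ w ∈ L ∪ R := by
      intro u w huw hu
      rcases hLR u w ⟨hu, huw⟩ with h | h <;> simp [h]
    cases hu : χ u with
    | true => simpa using key u w huw hu
    | false =>
      have hw : χ w = true := by
        have := hχ u w huw
        rw [hu] at this
        simpa using this.symm
      simpa using (key w u huw.symm hw).symm
  · have h1 : ∀ u w, side χ H.Adj u w →
        u ∈ C.filter (fun u => χ u = true) ∨ w ∈ C.filter (fun u => ¬ χ u = true) := by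
      intro u w huw
      have h2 := hχ u w huw.2
      rw [huw.1] at h2
      rcases hC.1 huw.2 with h | h
      · left; simpa [huw.1] using h
      · right; simpa [h2.symm] using h
    have := coverNum_le h1
    rwa [Finset.card_filter_add_card_filter_not] at this

theorem side_adj_eq_side_candidate (hχ : ∀ u w, G.Adj u w → χ u ≠ χ w) (hQ : Q ≤ G)
    (z : Fin n → Fin n → Bool) :
    side χ ((Q ⊓ realize χ G z) ⊔ (G \ Q)).Adj = side χ (candidate G Q z) := by
  funext u w
  unfold side candidate
  apply propext
  refine and_congr_right fun hu => ?_
  simp only [SimpleGraph.sup_adj, SimpleGraph.inf_adj, SimpleGraph.sdiff_adj, realize_adj hχ hu]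
  have := @hQ u w
  tauto

theorem expectedNu_eq (hχ : ∀ u w, G.Adj u w → χ u ≠ χ w) (p : unitInterval) :
    expectedNu p G = coverE χ p G G := by
  unfold expectedNu coverE
  rw [expect_eq_bernE hχ]
  congr 1
  funext z
  obtain ⟨C, hC⟩ := exists_isMinVertexCover (realize χ G z)
  have hχ' : ∀ u w, (realize χ G z).Adj u w → χ u ≠ χ w := fun u w h => hχ u w h.1
  rw [hC.vertexCoverNum_eq, hC.card_eq hχ', ← side_adj_eq_side_candidate hχ le_rfl z]
  congr 3
  have h : G ⊓ realize χ G z ⊔ G \ G = realize χ G z := by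
    rw [sdiff_self, sup_bot_eq, inf_eq_right]
    exact realize_le z
  rw [h]

theorem expectedCover_eq {B : Prog} (hB : ∀ Qp ≤ Q, IsMinVertexCover (Qp ⊔ (G \ Q))
      (findCover B G Q Qp)) (hχ : ∀ u w, G.Adj u w → χ u ≠ χ w) (hQ : Q ≤ G) (p : unitInterval) :
    expectedCover B p G Q = coverE χ p G Q := by
  unfold expectedCover coverE
  rw [expect_eq_bernE hχ]
  congr 1
  funext z
  have h : ∀ u w, ((Q ⊓ realize χ G z) ⊔ (G \ Q)).Adj u w → χ u ≠ χ w := by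
    intro u w h
    rcases h with h | h
    · exact hχ u w (hQ h.1)
    · exact hχ u w h.1
  rw [(hB (Q ⊓ realize χ G z) inf_le_left).card_eq h, side_adj_eq_side_candidate hχ hQ]

theorem isVertexCover_findCover {B : Prog} (hB : ∀ Qp ≤ Q, IsMinVertexCover (Qp ⊔ (G \ Q))
      (findCover B G Q Qp)) (R : SimpleGraph (Fin n)) (hR : R ≤ G) :
    R.IsVertexCover (findCover B G Q (Q ⊓ R) : Set (Fin n)) := by
  refine (hB (Q ⊓ R) inf_le_left).1.mono fun u w h => ?_
  simp only [SimpleGraph.sup_adj, SimpleGraph.inf_adj, SimpleGraph.sdiff_adj]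
  have := hR h
  tauto

end Realize

/-! ### The auction: prices, owners and partners

The rows bid for the columns. `pr w` is the price of the column `w`, `own w - 1` is its owner (`0`
if there is none), and `mt (u + 1) - 1` is the column that the row `u` owns. -/

/-- The invariant of the auction. -/
structure AuctionInv (n : ℕ) (h : ℕ → ℕ → ℕ) (pr own mt : ℕ → ℕ) : Prop where
  mt_own : ∀ u < n, ∀ w < n, mt (u + 1) = w + 1 ↔ own w = u + 1
  mt_le : ∀ u < n, mt (u + 1) ≤ n
  own_le : ∀ w < n, own w ≤ n
  edge : ∀ u < n, ∀ w < n, mt (u + 1) = w + 1 →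
    h u w ≠ 0 ∧ ∀ w' < n, h u w' ≠ 0 → pr w ≤ pr w' + 1
  pr_zero : ∀ w < n, own w = 0 → pr w = 0
  pr_le : ∀ w < n, pr w ≤ n + 1

/-- The row `u` does not want to bid. -/
def AuctionDone (n : ℕ) (h : ℕ → ℕ → ℕ) (pr mt : ℕ → ℕ) (u : ℕ) : Prop :=
  mt (u + 1) ≠ 0 ∨ ∀ w < n, h u w ≠ 0 → n + 1 ≤ pr w

/-- The new owner took a cheapest column and the price rises by one, so the slack is at most one;
other rows see prices that only increase. Indices are shifted by one: if `b` had no owner, the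
update at `own b = 0` hits the unused entry `mt 0`. -/
theorem AuctionInv.award {n : ℕ} {h : ℕ → ℕ → ℕ} {pr own mt pr' own' mt' : ℕ → ℕ}
    (H : AuctionInv n h pr own mt) {u b : ℕ} (hu : u < n) (hmt : mt (u + 1) = 0) (hb : b < n)
    (hub : h u b ≠ 0) (hpr : pr b < n + 1) (hbest : ∀ w < n, h u w ≠ 0 → pr b ≤ pr w)
    (hpr' : ∀ w, pr' w = if w = b then pr b + 1 else pr w)
    (hown' : ∀ w, own' w = if w = b then u + 1 else own w)
    (hmt' : ∀ x, mt' x = if x = u + 1 then b + 1 else if x = own b then 0 else mt x) :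
    AuctionInv n h pr' own' mt' := by
  obtain ⟨h1, h2, h3, h4, h5, h6⟩ := H
  have hne : ∀ w < n, own w ≠ u + 1 := fun w hw hc => by
    have := (h1 u hu w hw).2 hc
    omega
  refine ⟨?_, ?_, ?_, ?_, ?_, ?_⟩
  · intro u' hu' w hw
    rw [hmt', hown']
    by_cases e1 : u' = u
    · subst e1
      simp only [if_true]
      by_cases e2 : w = b
      · simp [e2]
      · simp only [e2, if_false]
        have := hne w hw
        omega
    · have e1' : ¬ (u' + 1 = u + 1) := by omega
      simp only [e1', if_false]
      by_cases e2 : w = b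
      · subst e2
        simp only [if_true]
        by_cases e3 : u' + 1 = own w
        · simp only [e3, if_true]; omega
        · simp only [e3, if_false]
          have := h1 u' hu' w hw
          omega
      · simp only [e2, if_false]
        by_cases e3 : u' + 1 = own b
        · simp only [e3, if_true]
          have a1 := (h1 u' hu' b hb).2 e3.symm
          have a2 := h1 u' hu' w hw
          omega
        · simp only [e3, if_false]
          exact h1 u' hu' w hw
  · intro u' hu'
    rw [hmt']
    split_ifs
    · omega
    · omega
    · exact h2 u' hu'
  · intro w hw
    rw [hown']
    split_ifs
    · omega
    · exact h3 w hw
  · intro u' hu' w hw hw'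
    rw [hmt'] at hw'
    by_cases e1 : u' = u
    · subst e1
      simp only [if_true] at hw'
      have e2 : w = b := by omega
      subst e2
      refine ⟨hub, fun w' hw1 hw2 => ?_⟩
      rw [hpr', hpr']
      have := hbest w' hw1 hw2
      split_ifs <;> omega
    · have e1' : ¬ (u' + 1 = u + 1) := by omega
      simp only [e1', if_false] at hw'
      by_cases e3 : u' + 1 = own b
      · simp [e3] at hw'
      · simp only [e3, if_false] at hw'
        have e2 : w ≠ b := by
          rintro rfl
          have := (h1 u' hu' w hw).1 hw'
          omega
        obtain ⟨a1, a2⟩ := h4 u' hu' w hw hw'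
        refine ⟨a1, fun w' hw1 hw2 => ?_⟩
        rw [hpr', hpr']
        have := a2 w' hw1 hw2
        simp only [e2, if_false]
        split_ifs with e4
        · subst e4; omega
        · exact this
  · intro w hw h0
    rw [hown'] at h0
    rw [hpr']
    split_ifs at h0 ⊢
    exact h5 w hw h0
  · intro w hw
    rw [hpr']
    split_ifs
    · omega
    · exact h6 w hw

/-- The matching at the end of an auction is maximum: some cover has the same size. -/
theorem AuctionInv.exists_cover {n : ℕ} {h : ℕ → ℕ → ℕ} {pr own mt : ℕ → ℕ}
    (H : AuctionInv n h pr own mt) (hdone : ∀ u < n, AuctionDone n h pr mt u) :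
    ∃ L R : Finset (Fin n), (∀ u w : Fin n, h u w ≠ 0 → u ∈ L ∨ w ∈ R) ∧
      L.card + R.card ≤ (Finset.univ.filter fun u : Fin n => mt (u + 1) ≠ 0).card := by
  classical
  obtain ⟨h1, h2, h3, h4, h5, h6⟩ := H
  -- Pigeonhole: `n` prices miss one of the `n + 1` levels. The gap at `t` absorbs the slack of one,
  -- and the cover consists of the columns above it and of the rows with a neighbour below it.
  obtain ⟨t, ht1, ht2, ht⟩ : ∃ t, 1 ≤ t ∧ t ≤ n + 1 ∧ ∀ w : Fin n, pr w ≠ t := by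
    by_contra hc
    push Not at hc
    have hsub : Finset.Icc 1 (n + 1) ⊆ Finset.univ.image (fun w : Fin n => pr w) := by
      intro t ht
      rw [Finset.mem_Icc] at ht
      obtain ⟨w, hw⟩ := hc t ht.1 ht.2
      exact Finset.mem_image.2 ⟨w, Finset.mem_univ w, hw⟩
    have := (Finset.card_le_card hsub).trans Finset.card_image_le
    simp at this
  set L := Finset.univ.filter fun u : Fin n => ∃ w : Fin n, h u w ≠ 0 ∧ pr w < t with hL
  set R := Finset.univ.filter fun w : Fin n => t ≤ pr w with hR
  set M := Finset.univ.filter fun u : Fin n => mt (u + 1) ≠ 0 with hM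
  refine ⟨L, R, ?_, ?_⟩
  · intro u w huw
    by_cases hw : t ≤ pr w
    · right; simp [hR, hw]
    · left
      simp only [hL, Finset.mem_filter, Finset.mem_univ, true_and]
      exact ⟨w, huw, by omega⟩
  · have hLM : L ⊆ M := by
      intro u hu
      simp only [hL, hM, Finset.mem_filter, Finset.mem_univ, true_and] at hu ⊢
      obtain ⟨w, hw1, hw2⟩ := hu
      rcases hdone u u.2 with hd | hd
      · exact hd
      · have := hd w w.2 hw1
        omega
    have hown : ∀ w : Fin n, w ∈ R → ∃ u : Fin n, own w = u + 1 := by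
      intro w hw
      simp only [hR, Finset.mem_filter, Finset.mem_univ, true_and] at hw
      have h0 : own w ≠ 0 := fun h0 => by
        have := h5 w w.2 h0
        omega
      have := h3 w w.2
      exact ⟨⟨own w - 1, by omega⟩, by simp; omega⟩
    choose! f hf using hown
    -- A column in `R` costs at least `t + 1`, so all neighbours of its owner cost at least `t`, and
    -- the owner is not in `L`. Matched rows thus pay separately for `L` and for `R`.
    have hfM : R.image f ⊆ M \ L := by
      intro u hu
      obtain ⟨w, hw, rfl⟩ := Finset.mem_image.1 hu
      have a1 := (h1 (f w) (f w).2 w w.2).2 (hf w hw)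
      have hw' : t ≤ pr w := by simpa [hR] using hw
      rw [Finset.mem_sdiff]
      refine ⟨by simp [hM, a1], ?_⟩
      intro hl
      simp only [hL, Finset.mem_filter, Finset.mem_univ, true_and] at hl
      obtain ⟨w', hw1, hw2⟩ := hl
      have a2 := (h4 (f w) (f w).2 w w.2 a1).2 w' w'.2 hw1
      have a3 := ht w
      omega
    have hinj : Set.InjOn f R := by
      intro w hw w' hw' he
      have a1 := (h1 (f w) (f w).2 w w.2).2 (hf w hw)
      have a2 := (h1 (f w') (f w').2 w' w'.2).2 (hf w' hw')
      rw [he] at a1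
      exact Fin.ext (by omega)
    have c1 := Finset.card_le_card hfM
    rw [Finset.card_image_of_injOn hinj, Finset.card_sdiff_of_subset hLM] at c1
    have c2 := Finset.card_le_card hLM
    omega

/-! ### The auction as a program -/

/-- A scalar variable. -/
abbrev Expr.var (a : ℕ) : Expr := .read a (.const 0) (.const 0)

/-- An entry of a one-dimensional array. -/
abbrev Expr.vec (a : ℕ) (i : Expr) : Expr := .read a i (.const 0)

/-- The number of vertices. -/
abbrev Expr.size : Expr := .var 0

/-- The successor of an expression. -/
abbrev Expr.succ (e : Expr) : Expr := .add e (.const 1)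

/-- Assignment to a scalar variable. -/
abbrev Prog.set (a : ℕ) (e : Expr) : Prog := .assign a (.const 0) (.const 0) e

/-- Compare the column `15` with the best column so far. -/
def searchStep : Prog :=
  .ite (.read 5 (.var 14) (.var 15))
    (.ite (.sub (.var 10) (.vec 6 (.var 15)))
      (.seq (.set 10 (.vec 6 (.var 15))) (.set 9 (.var 15))) .skip) .skip

/-- Give the column `9` to the row `14`. -/
def awardStep : Prog :=
  .seq (.assign 8 (.vec 7 (.var 9)) (.const 0) (.const 0))
    (.seq (.assign 7 (.var 9) (.const 0) (.succ (.var 14)))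
      (.seq (.assign 8 (.succ (.var 14)) (.const 0) (.succ (.var 9)))
        (.assign 6 (.var 9) (.const 0) (.succ (.vec 6 (.var 9))))))

/-- The row `14` bids for its cheapest column. -/
def bidStep : Prog :=
  .ite (.vec 8 (.succ (.var 14))) .skip
    (.seq (.set 10 (.succ .size))
      (.seq (.loop 15 .size searchStep) (.ite (.sub (.succ .size) (.var 10)) awardStep .skip)))

/-- The rounds of the auction. -/
def auctionRounds : Prog :=
  .loop 12 (.succ .size) (.loop 13 (.succ .size) (.loop 14 .size bidStep))

/-- The initial best price `n + 1` is a sentinel: columns at that price are never bid for, which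
keeps the prices bounded. -/
theorem searchLoop_post {n : ℕ} {m : Mem} (hn : m 0 0 0 = n) (h10 : m 10 0 0 = n + 1) :
    (Prog.loop 15 .size searchStep).Post (fun m' =>
      (∀ a, a ≠ 9 → a ≠ 10 → a ≠ 15 → m' a = m a) ∧ m' 10 0 0 ≤ n + 1 ∧
      (∀ w < n, m 5 (m 14 0 0) w ≠ 0 → m' 10 0 0 ≤ m 6 w 0) ∧
      (m' 10 0 0 < n + 1 → m' 9 0 0 < n ∧ m 5 (m 14 0 0) (m' 9 0 0) ≠ 0 ∧
        m 6 (m' 9 0 0) 0 = m' 10 0 0)) m := by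
  refine Prog.Post.loop (fun k m' =>
      (∀ a, a ≠ 9 → a ≠ 10 → a ≠ 15 → m' a = m a) ∧ m' 10 0 0 ≤ n + 1 ∧
      (∀ w < k, m 5 (m 14 0 0) w ≠ 0 → m' 10 0 0 ≤ m 6 w 0) ∧
      (m' 10 0 0 < n + 1 → m' 9 0 0 < n ∧ m 5 (m 14 0 0) (m' 9 0 0) ≠ 0 ∧
        m 6 (m' 9 0 0) 0 = m' 10 0 0)) ?_ ?_ ?_
  · exact ⟨fun _ _ _ _ => rfl, h10.le, fun w hw => absurd hw (by omega), fun h => by omega⟩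
  · simp only [Expr.val, hn]
    rintro k hk m' ⟨f1, f2, f3, f4⟩
    have g5 := f1 5 (by decide) (by decide) (by decide)
    have g6 := f1 6 (by decide) (by decide) (by decide)
    have g14 := f1 14 (by decide) (by decide) (by decide)
    have fr : ∀ a, a ≠ 9 → a ≠ 10 → a ≠ 15 → wr m' 15 0 0 k a = m a := fun a h1 h2 h3 =>
      (wr_ne _ h3 _ _ _).trans (f1 a h1 h2 h3)
    simp only [searchStep, Prog.Post, Expr.val, wr_apply]
    simp only [Nat.reduceEqDiff, false_and, if_false, and_self, if_true,
      g5, g6, g14, ne_eq]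
    refine ⟨fun h1 => ⟨fun h2 => ?_, fun h2 => ?_⟩, fun h1 => ?_⟩
    · refine ⟨fun a a1 a2 a3 => ?_, ?_, ?_, ?_⟩
      · rw [wr_ne _ a1, wr_ne _ a2, fr a a1 a2 a3]
      · omega
      · intro w hw hw'
        rcases Nat.lt_succ_iff_lt_or_eq.1 hw with h | h
        · have := f3 w h hw'; omega
        · subst h; exact le_refl _
      · exact fun _ => ⟨hk, h1, trivial⟩
    · refine ⟨fr, f2, ?_, f4⟩
      intro w hw hw'
      rcases Nat.lt_succ_iff_lt_or_eq.1 hw with h | h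
      · exact f3 w h hw'
      · subst h; omega
    · refine ⟨fr, f2, ?_, f4⟩
      intro w hw hw'
      rcases Nat.lt_succ_iff_lt_or_eq.1 hw with h | h
      · exact f3 w h hw'
      · subst h; exact absurd h1 hw'
  · simp only [Expr.val, hn]
    exact fun _ h => h

/-- The entries of the arrays of the auction outside their ranges vanish. -/
def AuctionClean (n : ℕ) (m : Mem) : Prop :=
  ∀ i j, (n < i ∨ j ≠ 0) → m 6 i j = 0 ∧ m 7 i j = 0 ∧ m 8 i j = 0

/-- The state of an auction for the relation `h`. -/
structure AuctionMem (n : ℕ) (h : ℕ → ℕ → ℕ) (m : Mem) : Prop where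
  size : m 0 0 0 = n
  input : m 5 = h
  inv : AuctionInv n h (fun w => m 6 w 0) (fun w => m 7 w 0) (fun x => m 8 x 0)
  clean : AuctionClean n m

theorem AuctionMem.congr {n : ℕ} {h : ℕ → ℕ → ℕ} {m m' : Mem} (H : AuctionMem n h m)
    (h0 : m' 0 = m 0) (h5 : m' 5 = m 5) (h6 : m' 6 = m 6) (h7 : m' 7 = m 7) (h8 : m' 8 = m 8) :
    AuctionMem n h m' := by
  obtain ⟨a, b, c, d⟩ := H
  refine ⟨by rw [h0, a], by rw [h5, b], by rw [h6, h7, h8]; exact c, ?_⟩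
  unfold AuctionClean at d ⊢
  rw [h6, h7, h8]; exact d

/-- The row `u` does not want to bid in the given memory. -/
abbrev DoneMem (n : ℕ) (h : ℕ → ℕ → ℕ) (m : Mem) (u : ℕ) : Prop :=
  AuctionDone n h (fun w => m 6 w 0) (fun x => m 8 x 0) u

/-- The sum of the prices. -/
def priceSum (n : ℕ) (m : Mem) : ℕ := ∑ w ∈ Finset.range n, m 6 w 0

/-- The sum of the prices is the potential: a row that wants to bid raises it, and otherwise prices
and partners stay as they are. -/
theorem bidStep_post {n : ℕ} {h : ℕ → ℕ → ℕ} {m : Mem} (H : AuctionMem n h m)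
    (hu : m 14 0 0 < n) :
    bidStep.Post (fun m' => AuctionMem n h m' ∧
      ((DoneMem n h m (m 14 0 0) ∧ m' 6 = m 6 ∧ m' 8 = m 8) ∨
        (¬ DoneMem n h m (m 14 0 0) ∧ priceSum n m + 1 ≤ priceSum n m'))) m := by
  unfold bidStep
  refine ⟨fun h1 => ?_, fun h1 => ?_⟩
  · exact ⟨H, Or.inl ⟨Or.inl h1, rfl, rfl⟩⟩
  · set m₁ := wr m 10 0 0 (n + 1) with hm₁
    have e1 : ∀ a, a ≠ 10 → m₁ a = m a := fun a ha => wr_ne _ ha _ _ _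
    have hn₁ : m₁ 0 0 0 = n := by rw [e1 0 (by decide)]; exact H.size
    have hs := searchLoop_post (m := m₁) hn₁ (by simp [hm₁, wr_apply])
    have hstart : (Prog.seq (.loop 15 .size searchStep)
        (.ite (.sub (.succ .size) (.var 10)) awardStep .skip)).Post (fun m' => AuctionMem n h m' ∧
      ((DoneMem n h m (m 14 0 0) ∧ m' 6 = m 6 ∧ m' 8 = m 8) ∨
        (¬ DoneMem n h m (m 14 0 0) ∧ priceSum n m + 1 ≤ priceSum n m'))) m₁ := by
      refine hs.mono ?_
      rintro m₂ ⟨f1, f2, f3, f4⟩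
      have fr : ∀ a, a ≠ 9 → a ≠ 10 → a ≠ 15 → m₂ a = m a := fun a a1 a2 a3 =>
        (f1 a a1 a2 a3).trans (e1 a a2)
      have g0 := fr 0 (by decide) (by decide) (by decide)
      have g5 := fr 5 (by decide) (by decide) (by decide)
      have g6 := fr 6 (by decide) (by decide) (by decide)
      have g7 := fr 7 (by decide) (by decide) (by decide)
      have g8 := fr 8 (by decide) (by decide) (by decide)
      have g14 := fr 14 (by decide) (by decide) (by decide)
      rw [e1 5 (by decide), e1 6 (by decide), e1 14 (by decide), H.input] at f3 f4
      have hn₂ : m₂ 0 0 0 = n := by rw [g0]; exact H.size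
      have hn : m 0 0 0 = n := H.size
      have hmt : m 8 (m 14 0 0 + 1) 0 = 0 := h1
      refine ⟨fun h2 => ?_, fun h2 => ?_⟩
      · simp only [Expr.val, hn₂] at h2
        obtain ⟨b1, b2, b3⟩ := f4 (by omega)
        set b := m₂ 9 0 0 with hb
        set u := m 14 0 0 with hu'
        have hown : m 7 b 0 ≤ n := H.inv.own_le b b1
        have hown' : m 7 b 0 ≠ u + 1 := fun hc => by
          have := (H.inv.mt_own u hu b b1).2 hc
          omega
        simp only [awardStep, Prog.Post, Expr.val, wr_apply]
        simp only [Nat.reduceEqDiff, false_and, if_false, and_self,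
          and_true, g6, g7, g14, ← hb, ← hu']
        have hnd : ¬ DoneMem n h m u := by
          rintro (hd | hd)
          · exact hd hmt
          · have : n + 1 ≤ m 6 b 0 := hd b b1 b2
            omega
        refine ⟨⟨?_, ?_, ?_, ?_⟩, Or.inr ⟨hnd, ?_⟩⟩
        · simp [wr_apply, hn₂]
        · rw [wr_ne _ (by decide), wr_ne _ (by decide), wr_ne _ (by decide), wr_ne _ (by decide),
            g5, H.input]
        · refine H.inv.award (u := u) (b := b) hu hmt b1 b2 (by omega) ?_ ?_ ?_ ?_
          · intro w hw hw'
            have := f3 w hw hw'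
            omega
          · intro w; simp [wr_apply, g6]
          · intro w; simp [wr_apply, g7]
          · intro x; simp [wr_apply, g8]
        · intro i j hij
          have hc := H.clean i j hij
          simp only [wr_apply, Nat.reduceEqDiff, false_and, if_false,
            true_and, g6, g7, g8]
          refine ⟨?_, ?_, ?_⟩
          · rw [if_neg (by omega)]; exact hc.1
          · rw [if_neg (by omega)]; exact hc.2.1
          · rw [if_neg (by omega), if_neg (by omega)]; exact hc.2.2
        · unfold priceSum
          have hbm : b ∈ Finset.range n := Finset.mem_range.2 b1
          rw [← Finset.add_sum_erase _ _ hbm, ← Finset.add_sum_erase _ _ hbm]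
          have : ∀ w ∈ (Finset.range n).erase b, m 6 w 0 ≤
              wr (wr (wr (wr m₂ 8 (m 7 b 0) 0 0) 7 b 0 (u + 1)) 8 (u + 1) 0 (b + 1)) 6 b 0
                (m 6 b 0 + 1) 6 w 0 := by
            intro w hw
            simp [wr_apply, Finset.ne_of_mem_erase hw, g6]
          have := Finset.sum_le_sum this
          have e : wr (wr (wr (wr m₂ 8 (m 7 b 0) 0 0) 7 b 0 (u + 1)) 8 (u + 1) 0 (b + 1)) 6 b 0
                (m 6 b 0 + 1) 6 b 0 = m 6 b 0 + 1 := by simp [wr_apply]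
          rw [e]
          omega
      · simp only [Expr.val, hn₂] at h2
        refine ⟨H.congr g0 g5 g6 g7 g8, Or.inl ⟨Or.inr fun w hw hw' => ?_, g6, g8⟩⟩
        have := f3 w hw hw'
        change n + 1 ≤ m 6 w 0
        omega
    have hval : (Expr.succ .size).val m = n + 1 := by simp [Expr.val, H.size]
    change (Prog.seq (.loop 15 .size searchStep)
        (.ite (.sub (.succ .size) (.var 10)) awardStep .skip)).Post _
        (wr m 10 0 0 ((Expr.succ .size).val m))
    rw [hval]
    exact hstart

theorem priceSum_congr {n : ℕ} {m m' : Mem} (h : m' 6 = m 6) : priceSum n m' = priceSum n m := by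
  unfold priceSum; rw [h]

theorem doneMem_congr {n : ℕ} {h : ℕ → ℕ → ℕ} {m m' : Mem} (h6 : m' 6 = m 6) (h8 : m' 8 = m 8)
    {u : ℕ} (hd : DoneMem n h m u) : DoneMem n h m' u := by
  unfold DoneMem; rw [h6, h8]; exact hd

theorem auctionRound_post {n : ℕ} {h : ℕ → ℕ → ℕ} {m : Mem} (H : AuctionMem n h m) :
    (Prog.loop 14 .size bidStep).Post (fun m' => AuctionMem n h m' ∧
      ((∀ u < n, DoneMem n h m' u) ∨ priceSum n m + 1 ≤ priceSum n m')) m := by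
  refine Prog.Post.loop (fun k m' => AuctionMem n h m' ∧
      ((m' 6 = m 6 ∧ m' 8 = m 8 ∧ ∀ u < k, DoneMem n h m' u) ∨
        priceSum n m + 1 ≤ priceSum n m')) ⟨H, Or.inl ⟨rfl, rfl, by simp⟩⟩ ?_ ?_
  · simp only [Expr.val, H.size]
    rintro k hk m' ⟨H', hor⟩
    have Hw : AuctionMem n h (wr m' 14 0 0 k) := H'.congr (wr_ne _ (by decide) _ _ _)
      (wr_ne _ (by decide) _ _ _) (wr_ne _ (by decide) _ _ _) (wr_ne _ (by decide) _ _ _)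
      (wr_ne _ (by decide) _ _ _)
    have h14 : wr m' 14 0 0 k 14 0 0 = k := by simp [wr_apply]
    have e6 : wr m' 14 0 0 k 6 = m' 6 := wr_ne _ (by decide) _ _ _
    have e8 : wr m' 14 0 0 k 8 = m' 8 := wr_ne _ (by decide) _ _ _
    refine (bidStep_post Hw (by rw [h14]; exact hk)).mono ?_
    rintro m'' ⟨H'', hor''⟩
    refine ⟨H'', ?_⟩
    rw [h14, priceSum_congr e6, e6, e8] at hor''
    rcases hor'' with ⟨d, q6, q8⟩ | ⟨-, hq⟩
    · have d' : DoneMem n h m'' k := doneMem_congr (q6.trans e6.symm) (q8.trans e8.symm) d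
      rcases hor with ⟨r6, r8, hd⟩ | hr
      · left
        refine ⟨q6.trans r6, q8.trans r8, fun u hu => ?_⟩
        rcases Nat.lt_succ_iff_lt_or_eq.1 hu with h1 | h1
        · exact doneMem_congr q6 q8 (hd u h1)
        · subst h1; exact d'
      · right; rw [priceSum_congr q6]; exact hr
    · right
      rcases hor with ⟨r6, _, _⟩ | hr
      · rw [priceSum_congr r6] at hq; exact hq
      · omega
  · simp only [Expr.val, H.size]
    rintro m' ⟨H', hor⟩
    exact ⟨H', hor.imp (fun h => h.2.2) id⟩

/-- Once no row wants to bid, the state is frozen; until then every round raises the price sum. The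
number of rounds is fixed, so both cases have to be carried along. -/
theorem auctionRound_progress {n : ℕ} {h : ℕ → ℕ → ℕ} {m : Mem} {k : ℕ} (H : AuctionMem n h m)
    (hk : (∀ u < n, DoneMem n h m u) ∨ k ≤ priceSum n m) :
    (Prog.loop 14 .size bidStep).Post (fun m' => AuctionMem n h m' ∧
      ((∀ u < n, DoneMem n h m' u) ∨ k + 1 ≤ priceSum n m')) m := by
  rcases hk with hk | hk
  · refine Prog.Post.loop (fun _ m' => AuctionMem n h m' ∧ m' 6 = m 6 ∧ m' 8 = m 8)
      ⟨H, rfl, rfl⟩ ?_ ?_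
    · simp only [Expr.val, H.size]
      rintro j hj m' ⟨H', r6, r8⟩
      have Hw : AuctionMem n h (wr m' 14 0 0 j) := H'.congr (wr_ne _ (by decide) _ _ _)
        (wr_ne _ (by decide) _ _ _) (wr_ne _ (by decide) _ _ _) (wr_ne _ (by decide) _ _ _)
        (wr_ne _ (by decide) _ _ _)
      have h14 : wr m' 14 0 0 j 14 0 0 = j := by simp [wr_apply]
      have e6 : wr m' 14 0 0 j 6 = m 6 := (wr_ne _ (by decide) _ _ _).trans r6
      have e8 : wr m' 14 0 0 j 8 = m 8 := (wr_ne _ (by decide) _ _ _).trans r8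
      refine (bidStep_post Hw (by rw [h14]; exact hj)).mono ?_
      rintro m'' ⟨H'', ⟨-, q6, q8⟩ | ⟨hq, -⟩⟩
      · exact ⟨H'', q6.trans e6, q8.trans e8⟩
      · rw [h14] at hq
        exact absurd (doneMem_congr e6 e8 (hk j hj)) hq
    · rintro m' ⟨H', r6, r8⟩
      exact ⟨H', Or.inl fun u hu => doneMem_congr r6 r8 (hk u hu)⟩
  · refine (auctionRound_post H).mono ?_
    rintro m' ⟨H', hor⟩
    exact ⟨H', hor.imp id fun h => by omega⟩

theorem AuctionMem.priceSum_le {n : ℕ} {h : ℕ → ℕ → ℕ} {m : Mem} (H : AuctionMem n h m) :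
    priceSum n m ≤ n * (n + 1) := by
  unfold priceSum
  refine (Finset.sum_le_card_nsmul _ _ (n + 1) fun w hw => ?_).trans (by simp)
  exact H.inv.pr_le w (Finset.mem_range.1 hw)

/-- There are `(n + 1)²` rounds, while the price sum never exceeds `n (n + 1)`. -/
theorem auctionRounds_post {n : ℕ} {h : ℕ → ℕ → ℕ} {m : Mem} (H : AuctionMem n h m) :
    auctionRounds.Post (fun m' => AuctionMem n h m' ∧ ∀ u < n, DoneMem n h m' u) m := by
  have wr_mem : ∀ {m : Mem} (a : ℕ), 8 < a → ∀ k, AuctionMem n h m → AuctionMem n h (wr m a 0 0 k) :=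
    fun a ha k H => H.congr (wr_ne _ (by omega) _ _ _) (wr_ne _ (by omega) _ _ _)
      (wr_ne _ (by omega) _ _ _) (wr_ne _ (by omega) _ _ _) (wr_ne _ (by omega) _ _ _)
  have wr_or : ∀ {m : Mem} (a : ℕ), 8 < a → ∀ k q, ((∀ u < n, DoneMem n h m u) ∨
      q ≤ priceSum n m) → ((∀ u < n, DoneMem n h (wr m a 0 0 k) u) ∨
      q ≤ priceSum n (wr m a 0 0 k)) := by
    intro m a ha k q hq
    have e6 : wr m a 0 0 k 6 = m 6 := wr_ne _ (by omega) _ _ _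
    have e8 : wr m a 0 0 k 8 = m 8 := wr_ne _ (by omega) _ _ _
    exact hq.imp (fun hq u hu => doneMem_congr e6 e8 (hq u hu)) fun hq => by
      rw [priceSum_congr e6]; exact hq
  refine Prog.Post.loop (fun k m' => AuctionMem n h m' ∧
    ((∀ u < n, DoneMem n h m' u) ∨ k * (n + 1) ≤ priceSum n m')) ⟨H, Or.inr (by simp)⟩ ?_ ?_
  · rintro k - m' ⟨H', hor⟩
    have H1 := wr_mem 12 (by omega) k H'
    refine Prog.Post.loop (fun j m' => AuctionMem n h m' ∧
      ((∀ u < n, DoneMem n h m' u) ∨ k * (n + 1) + j ≤ priceSum n m'))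
      ⟨H1, wr_or 12 (by omega) _ _ hor⟩ ?_ ?_
    · rintro j - m'' ⟨H'', hor''⟩
      exact auctionRound_progress (wr_mem 13 (by omega) j H'') (wr_or 13 (by omega) _ _ hor'')
    · simp only [Expr.val, H1.size]
      rintro m'' ⟨H'', hor''⟩
      exact ⟨H'', hor''.imp id fun h => by rw [add_mul, one_mul]; exact h⟩
  · simp only [Expr.val, H.size]
    rintro m' ⟨H', hor⟩
    refine ⟨H', hor.resolve_right fun hc => ?_⟩
    have := H'.priceSum_le
    nlinarith

/-! ### The matching found by the auction -/

theorem Prog.NoFlip.post_run {c : Prog} (h : c.NoFlip) (m : Mem) :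
    c.Post (fun m' => m' = c.run m) m := by
  induction c generalizing m with
  | skip => exact rfl
  | assign a i j e =>
    simp only [Prog.Post, Prog.run, Prog.exec, Expr.eval_eq, State.write_eq]
  | flip => exact h.elim
  | seq c d hc hd =>
    refine (hc h.1 m).mono ?_
    rintro _ rfl
    refine (hd h.2 _).mono ?_
    rintro _ rfl
    simp only [Prog.run, Prog.exec]
    rw [h.1.exec_eq m]
  | ite e c d hc hd =>
    refine ⟨fun he => (hc h.1 m).mono ?_, fun he => (hd h.2 m).mono ?_⟩
    · rintro _ rfl
      simp only [Prog.run, Prog.exec, Expr.eval_eq]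
      simp [he]
    · rintro _ rfl
      simp only [Prog.run, Prog.exec, Expr.eval_eq]
      simp [he]
  | loop a e c hc =>
    refine Prog.Post.loop (fun k m' => ⟨m', fun _ => false⟩ =
      (iterate (fun k s' => c.exec (s'.write a 0 0 k)) (⟨m, fun _ => false⟩, e.cost + 1) k).1)
      rfl ?_ ?_
    · intro k _ m' hm'
      refine (hc h _).mono ?_
      rintro _ rfl
      rw [iterate_succ_fst, ← hm', State.write_eq, NoFlip.exec_eq (c := c) h]
    · intro m' hm'
      simp only [Prog.run, Prog.exec, Expr.eval_eq]
      rw [← hm']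

open Classical in
/-- The matrix of a relation, extended by zero. -/
noncomputable def relMat {n : ℕ} (h : Fin n → Fin n → Prop) (i j : ℕ) : ℕ :=
  if ∃ (hi : i < n) (hj : j < n), h ⟨i, hi⟩ ⟨j, hj⟩ then 1 else 0

theorem relMat_ne_zero {n : ℕ} (h : Fin n → Fin n → Prop) (u w : Fin n) :
    relMat h u w ≠ 0 ↔ h u w := by
  simp [relMat]

/-- The contents of the array `0`. -/
def sizeArr (n : ℕ) : ℕ → ℕ → ℕ := fun i j => if i = 0 ∧ j = 0 then n else 0

/-- The memory at the start of an auction for `h`. -/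
noncomputable def auctionStart {n : ℕ} (h : Fin n → Fin n → Prop) : Mem :=
  fun a => if a = 0 then sizeArr n else if a = 5 then relMat h else fun _ _ => 0

/-- The memory at the end of an auction for `h`. -/
noncomputable def auctionEnd {n : ℕ} (h : Fin n → Fin n → Prop) : Mem :=
  auctionRounds.run (auctionStart h)

/-- The row `u` gets the column `w` in the auction for `h`. -/
def auctionRule {n : ℕ} (h : Fin n → Fin n → Prop) (u w : Fin n) : Prop :=
  auctionEnd h 8 (u + 1) 0 = w + 1

/-- The arrays that the auction uses. -/
def AuctionArr (a : ℕ) : Prop := a = 0 ∨ 5 ≤ a ∧ a ≤ 15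

/-- The arrays of the auction vanish outside their ranges. -/
def Tidy (n : ℕ) (m : Mem) : Prop :=
  AuctionClean n m ∧ ∀ a, 9 ≤ a → a ≤ 15 → ∀ i j, (i ≠ 0 ∨ j ≠ 0) → m a i j = 0

theorem Tidy.congr {n : ℕ} {m m' : Mem} (h : Tidy n m) (hm : ∀ a, 6 ≤ a → a ≤ 15 → m' a = m a) :
    Tidy n m' := by
  refine ⟨fun i j hij => ?_, fun a h1 h2 i j hij => ?_⟩
  · rw [hm 6 (by omega) (by omega), hm 7 (by omega) (by omega), hm 8 (by omega) (by omega)]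
    exact h.1 i j hij
  · rw [hm a (by omega) h2]
    exact h.2 a h1 h2 i j hij

theorem auctionMem_start {n : ℕ} (h : Fin n → Fin n → Prop) :
    AuctionMem n (relMat h) (auctionStart h) := by
  refine ⟨by simp [auctionStart, sizeArr], by simp [auctionStart], ⟨?_, ?_, ?_, ?_, ?_, ?_⟩, ?_⟩
  all_goals simp [auctionStart, AuctionClean]

theorem auctionEnd_spec {n : ℕ} (h : Fin n → Fin n → Prop) :
    AuctionMem n (relMat h) (auctionEnd h) ∧ ∀ u < n, DoneMem n (relMat h) (auctionEnd h) u :=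
  (auctionRounds_post (auctionMem_start h)).run

theorem tidy_auctionEnd {n : ℕ} (h : Fin n → Fin n → Prop) : Tidy n (auctionEnd h) := by
  refine ⟨(auctionEnd_spec h).1.clean, fun a h1 h2 i j hij => ?_⟩
  have hs : auctionRounds.Scalar a := by
    simp only [auctionRounds, bidStep, searchStep, awardStep, Prog.Scalar]
    refine ⟨trivial, ?_, ⟨⟨⟨?_, ?_⟩, trivial⟩, trivial⟩, ⟨?_, ?_, ?_, ?_⟩, trivial⟩ <;>
      first | exact fun _ => ⟨rfl, rfl⟩ | (intro hc; omega) | simp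
  have := (hs.post (auctionStart h)).run i j hij
  rw [auctionEnd, this, auctionStart, if_neg (by omega), if_neg (by omega)]

theorem auctionRule_unique {n : ℕ} {h : Fin n → Fin n → Prop} {u : Fin n} :
    auctionEnd h 8 (u + 1) 0 ≠ 0 ↔ ∃ w, auctionRule h u w := by
  constructor
  · intro h0
    have : auctionEnd h 8 (u + 1) 0 ≤ n := (auctionEnd_spec h).1.inv.mt_le u u.2
    exact ⟨⟨auctionEnd h 8 (u + 1) 0 - 1, by omega⟩, by
      simp only [auctionRule]; omega⟩
  · rintro ⟨w, hw⟩
    rw [auctionRule] at hw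
    omega

theorem isRelMatching_auctionRule {n : ℕ} (h : Fin n → Fin n → Prop) :
    IsRelMatching (auctionRule h) := by
  have H := (auctionEnd_spec h).1.inv
  refine ⟨fun u w w' h1 h2 => ?_, fun u u' w h1 h2 => ?_⟩
  · rw [auctionRule] at h1 h2
    exact Fin.ext (by omega)
  · have a1 := (H.mt_own u u.2 w w.2).1 h1
    have a2 := (H.mt_own u' u'.2 w w.2).1 h2
    exact Fin.ext (by omega)

theorem auctionRule_sub {n : ℕ} (h : Fin n → Fin n → Prop) (u w : Fin n)
    (hs : auctionRule h u w) : h u w :=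
  (relMat_ne_zero h u w).1 ((auctionEnd_spec h).1.inv.edge u u.2 w w.2 hs).1

theorem relCard_auctionRule {n : ℕ} (h : Fin n → Fin n → Prop) : relCard (auctionRule h) =
    (Finset.univ.filter fun u : Fin n => auctionEnd h 8 (u + 1) 0 ≠ 0).card := by
  classical
  rw [Finset.card_filter, relCard, Nat.cast_sum]
  refine Finset.sum_congr rfl fun u _ => ?_
  by_cases h0 : auctionEnd h 8 (u + 1) 0 ≠ 0
  · rw [if_pos h0]
    obtain ⟨w, hw⟩ := auctionRule_unique.1 h0
    rw [Finset.sum_eq_single w]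
    · simp [hw]
    · intro w' _ hw'
      rw [if_neg]
      exact fun hc => hw' ((isRelMatching_auctionRule h).row u w' w hc hw)
    · simp
  · rw [if_neg h0]
    have : ∀ w, ¬ auctionRule h u w := fun w hw => h0 (auctionRule_unique.2 ⟨w, hw⟩)
    simp [this]

/-- König's theorem for the auction: weak duality in one direction, the cover read off from the
final prices in the other. -/
theorem card_auctionEnd {n : ℕ} (h : Fin n → Fin n → Prop) :
    (Finset.univ.filter fun u : Fin n => auctionEnd h 8 (u + 1) 0 ≠ 0).card = coverNum h := by
  refine le_antisymm ?_ ?_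
  · have := (isRelMatching_auctionRule h).relCard_le (auctionRule_sub h)
    rw [relCard_auctionRule] at this
    exact_mod_cast this
  · obtain ⟨L, R, hLR, hc⟩ := (auctionEnd_spec h).1.inv.exists_cover (auctionEnd_spec h).2
    exact (coverNum_le fun u w huw => hLR u w ((relMat_ne_zero h u w).2 huw)).trans hc

theorem isMatchingRule_auctionRule {n : ℕ} :
    IsMatchingRule (auctionRule : (Fin n → Fin n → Prop) → Fin n → Fin n → Prop) where
  matching := isRelMatching_auctionRule
  sub := auctionRule_sub
  opt h := by rw [relCard_auctionRule, card_auctionEnd]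

/-- Clear the arrays of the auction. -/
def auctionClear : Prog :=
  .seq (.loop 11 (.succ .size) (.seq (.assign 6 (.var 11) (.const 0) (.const 0))
    (.seq (.assign 7 (.var 11) (.const 0) (.const 0))
      (.assign 8 (.var 11) (.const 0) (.const 0)))))
    (.seq (.set 9 (.const 0)) (.seq (.set 10 (.const 0)) (.seq (.set 11 (.const 0))
      (.seq (.set 12 (.const 0)) (.seq (.set 13 (.const 0)) (.seq (.set 14 (.const 0))
        (.set 15 (.const 0))))))))

/-- The auction for the relation in the array `5`. -/
def auction : Prog := .seq auctionClear auctionRounds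

/-- Restoring the canonical start makes the matching depend on the relation only, so that repeated
calls realize one fixed rule. By `Tidy` it suffices to clear finitely many entries. -/
theorem auctionClear_post {n : ℕ} {h : Fin n → Fin n → Prop} {m : Mem} (h0 : m 0 = sizeArr n)
    (h5 : m 5 = relMat h) (ht : Tidy n m) :
    auctionClear.Post (fun m' => ∀ a, AuctionArr a → m' a = auctionStart h a) m := by
  refine Prog.Post.loop (fun k m' => m' 0 = m 0 ∧ m' 5 = m 5 ∧ Tidy n m' ∧
    ∀ i < k, m' 6 i 0 = 0 ∧ m' 7 i 0 = 0 ∧ m' 8 i 0 = 0) ⟨rfl, rfl, ht, by simp⟩ ?_ ?_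
  · rintro k - m' ⟨r0, r5, rt, rz⟩
    simp only [Prog.Post, Expr.val]
    refine ⟨?_, ?_, ⟨?_, ?_⟩, ?_⟩
    · simp only [wr_apply, Nat.reduceEqDiff, false_and, if_false]
      rw [wr_ne _ (by decide), wr_ne _ (by decide), wr_ne _ (by decide), wr_ne _ (by decide), r0]
    · rw [wr_ne _ (by decide), wr_ne _ (by decide), wr_ne _ (by decide), wr_ne _ (by decide), r5]
    · intro i j hij
      have := rt.1 i j hij
      simp only [wr_apply, Nat.reduceEqDiff, false_and, if_false]
      refine ⟨?_, ?_, ?_⟩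
      all_goals split_ifs <;> simp [this]
    · intro a h1 h2 i j hij
      rw [wr_ne _ (by omega), wr_ne _ (by omega), wr_ne _ (by omega)]
      rw [wr_apply, if_neg (by omega)]
      exact rt.2 a h1 h2 i j hij
    · intro i hi
      simp only [wr_apply, Nat.reduceEqDiff, false_and, if_false, and_true, true_and]
      by_cases hik : i = k
      · simp [hik]
      · simpa [hik] using rz i (by omega)
  · rintro m' ⟨r0, r5, rt, rz⟩
    simp only [Expr.val, h0, sizeArr] at rz
    simp only [Prog.Post, Expr.val]
    rintro a (rfl | ⟨ha, ha'⟩)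
    · rw [wr_ne _ (by decide), wr_ne _ (by decide), wr_ne _ (by decide), wr_ne _ (by decide),
        wr_ne _ (by decide), wr_ne _ (by decide), wr_ne _ (by decide), r0, h0]
      rfl
    · funext i j
      have h678 : m' 6 i j = 0 ∧ m' 7 i j = 0 ∧ m' 8 i j = 0 := by
        by_cases hc : n < i ∨ j ≠ 0
        · exact rt.1 i j hc
        · have hj : j = 0 := by omega
          subst hj
          exact rz i (by simp; omega)
      have hs := rt.2
      by_cases hij : i = 0 ∧ j = 0
      · obtain ⟨rfl, rfl⟩ := hij
        interval_cases a <;> simp_all [auctionStart, wr_apply]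
      · have hij' : i ≠ 0 ∨ j ≠ 0 := by omega
        have hs' := fun a h1 h2 => hs a h1 h2 i j hij'
        simp only [wr_apply, if_neg (fun hc => hij (And.right hc)), auctionStart]
        interval_cases a <;> simp_all

theorem auctionRounds_noFlip : auctionRounds.NoFlip := by
  simp [auctionRounds, bidStep, searchStep, awardStep, Prog.NoFlip]

theorem auctionRounds_within : auctionRounds.Within AuctionArr := by
  simp [auctionRounds, bidStep, searchStep, awardStep, Prog.Within, Expr.Within, AuctionArr]

theorem auction_noFlip : auction.NoFlip :=
  ⟨by simp [auctionClear, Prog.NoFlip], auctionRounds_noFlip⟩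

theorem auction_noWrite {a : ℕ} (h : a < 6 ∨ 15 < a) : auction.NoWrite a := by
  simp only [auction, auctionClear, auctionRounds, bidStep, searchStep, awardStep, Prog.NoWrite,
    true_and, and_true]
  omega

theorem auction_bounded : auction.Bounded := by
  simp [auction, auctionClear, auctionRounds, bidStep, searchStep, awardStep, Prog.Bounded,
    Expr.IsSize]

theorem auction_depth : auction.depth = 4 := by
  simp [auction, auctionClear, auctionRounds, bidStep, searchStep, awardStep, Prog.depth]

/-- The result of the auction only depends on the relation. -/
theorem auction_post {n : ℕ} {h : Fin n → Fin n → Prop} {m : Mem} (h0 : m 0 = sizeArr n)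
    (h5 : m 5 = relMat h) (ht : Tidy n m) :
    auction.Post (fun m' => m' 8 = auctionEnd h 8 ∧ Tidy n m' ∧
      ∀ a, (a < 6 ∨ 15 < a) → m' a = m a) m := by
  refine Prog.Post.framed ?_
  refine (auctionClear_post h0 h5 ht).mono fun m₁ hm₁ => ?_
  refine (auctionRounds_noFlip.post_run m₁).mono ?_
  rintro _ rfl hf
  have key : ∀ a, AuctionArr a → auctionRounds.run m₁ a = auctionEnd h a :=
    auctionRounds_within.run_agree hm₁
  refine ⟨key 8 (by simp [AuctionArr]), ?_, fun a ha => hf a (auction_noWrite ha)⟩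
  exact (tidy_auctionEnd h).congr fun a h1 h2 => key a (by simp only [AuctionArr]; omega)

theorem Prog.Post.seq {c d : Prog} {P P' : Mem → Prop} {m : Mem} (h : c.Post P' m)
    (h' : ∀ m', P' m' → d.Post P m') : (Prog.seq c d).Post P m := h.mono h'

theorem Prog.Post.assign {a : ℕ} {i j e : Expr} {P : Mem → Prop} {m : Mem}
    (h : P (wr m a (i.val m) (j.val m) (e.val m))) : (Prog.assign a i j e).Post P m := h

theorem Prog.Post.ite {e : Expr} {c d : Prog} {P : Mem → Prop} {m : Mem}
    (h : e.val m ≠ 0 → c.Post P m) (h' : e.val m = 0 → d.Post P m) : (Prog.ite e c d).Post P m :=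
  ⟨h, h'⟩

theorem Prog.Post.exec_state {c : Prog} {P : Mem → Prop} {s : State} (h : c.Post P s.mem) :
    P (c.exec s).1.mem := h.exec s.coins

/-! ### Deleting vertices -/

section Delete

variable {n : ℕ} {χ : Fin n → Bool} {H : SimpleGraph (Fin n)}

/-- Adjacency in `H` without the vertices in `D`. -/
def del (H : SimpleGraph (Fin n)) (D : Finset (Fin n)) (u w : Fin n) : Prop :=
  H.Adj u w ∧ u ∉ D ∧ w ∉ D

/-- The adjacency relation contains each edge in both orientations, and in the bipartite case these
form two disjoint copies of the graph. The auction, which knows no colouring, therefore computes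
twice the cover number. -/
theorem coverNum_del (hχ : ∀ u w, H.Adj u w → χ u ≠ χ w) (D : Finset (Fin n)) :
    coverNum (del H D) = 2 * coverNum (side χ (del H D)) := by
  classical
  have hsymm : ∀ u w, del H D u w → del H D w u := fun u w h => ⟨h.1.symm, h.2.2, h.2.1⟩
  have hother : ∀ u w, H.Adj u w → χ u = false → χ w = true := fun u w h hu => by
    have := hχ u w h
    rw [hu] at this
    simpa using this.symm
  apply le_antisymm
  · obtain ⟨L, R, hLR, hc⟩ := exists_cover (side χ (del H D))
    have h1 : ∀ u w, del H D u w → u ∈ L ∪ R ∨ w ∈ L ∪ R := by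
      intro u w huw
      cases hu : χ u with
      | true => rcases hLR u w ⟨hu, huw⟩ with h | h <;> simp [h]
      | false => rcases hLR w u ⟨hother u w huw.1 hu, hsymm u w huw⟩ with h | h <;> simp [h]
    have h2 := coverNum_le h1
    have h3 := Finset.card_union_le L R
    omega
  · obtain ⟨L, R, hLR, hc⟩ := exists_cover (del H D)
    have h1 : coverNum (side χ (del H D)) ≤
        (L.filter fun u => χ u = true).card + (R.filter fun u => ¬ χ u = true).card := by
      refine coverNum_le fun u w huw => ?_
      have h2 := hχ u w huw.2.1
      rw [huw.1] at h2
      rcases hLR u w huw.2 with h | h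
      · left; simp [h, huw.1]
      · right; simp [h, h2.symm]
    have h2 : coverNum (side χ (del H D)) ≤
        (R.filter fun u => χ u = true).card + (L.filter fun u => ¬ χ u = true).card := by
      refine coverNum_le fun u w huw => ?_
      have h2 := hχ u w huw.2.1
      rw [huw.1] at h2
      rcases hLR w u (hsymm u w huw.2) with h | h
      · right; simp [h, h2.symm]
      · left; simp [h, huw.1]
    have h3 := Finset.card_filter_add_card_filter_not (s := L) fun u => χ u = true
    have h4 := Finset.card_filter_add_card_filter_not (s := R) fun u => χ u = true
    omega

theorem coverNum_del_insert_le (D : Finset (Fin n)) (v : Fin n) :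
    coverNum (side χ (del H (insert v D))) ≤ coverNum (side χ (del H D)) :=
  coverNum_mono fun _ _ h => ⟨h.1, h.2.1, fun hc => h.2.2.1 (Finset.mem_insert_of_mem hc),
    fun hc => h.2.2.2 (Finset.mem_insert_of_mem hc)⟩

theorem coverNum_le_del_insert (hχ : ∀ u w, H.Adj u w → χ u ≠ χ w) (D : Finset (Fin n))
    (v : Fin n) :
    coverNum (side χ (del H D)) ≤ coverNum (side χ (del H (insert v D))) + 1 := by
  classical
  obtain ⟨L, R, hLR, hc⟩ := exists_cover (side χ (del H (insert v D)))
  rw [← hc]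
  cases hv : χ v with
  | true =>
    have h1 : ∀ u w, side χ (del H D) u w → u ∈ insert v L ∨ w ∈ R := by
      intro u w huw
      by_cases huv : u = v
      · left; simp [huv]
      · have hwv : w ≠ v := by
          rintro rfl
          exact hχ u w huw.2.1 (huw.1.trans hv.symm)
        rcases hLR u w ⟨huw.1, huw.2.1, by simp [huv, huw.2.2.1], by simp [hwv, huw.2.2.2]⟩ with h | h
        · left; simp [h]
        · exact Or.inr h
    have h2 := coverNum_le h1
    have h3 := Finset.card_insert_le v L
    omega
  | false =>
    have h1 : ∀ u w, side χ (del H D) u w → u ∈ L ∨ w ∈ insert v R := by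
      intro u w huw
      by_cases hwv : w = v
      · right; simp [hwv]
      · have huv : u ≠ v := by
          rintro rfl
          have := huw.1
          simp [hv] at this
        rcases hLR u w ⟨huw.1, huw.2.1, by simp [huv, huw.2.2.1], by simp [hwv, huw.2.2.2]⟩ with h | h
        · exact Or.inl h
        · right; simp [h]
    have h2 := coverNum_le h1
    have h3 := Finset.card_insert_le v R
    omega

/-- If the cover number were positive, deleting any vertex of an optimal cover would lower it. -/
theorem coverNum_del_eq_zero {D : Finset (Fin n)}
    (h : ∀ v, coverNum (side χ (del H (insert v D))) = coverNum (side χ (del H D))) :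
    coverNum (side χ (del H D)) = 0 := by
  classical
  obtain ⟨L, R, hLR, hc⟩ := exists_cover (side χ (del H D))
  rcases L.eq_empty_or_nonempty with rfl | ⟨u₀, hu₀⟩
  · rcases R.eq_empty_or_nonempty with rfl | ⟨w₀, hw₀⟩
    · rw [← hc]; rfl
    · exfalso
      have h1 : ∀ u w, side χ (del H (insert w₀ D)) u w → u ∈ (∅ : Finset (Fin n)) ∨
          w ∈ R.erase w₀ := by
        intro u w huw
        have h2 := huw.2.2
        simp only [Finset.mem_insert, not_or] at h2
        rcases hLR u w ⟨huw.1, huw.2.1, h2.1.2, h2.2.2⟩ with h | h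
        · exact Or.inl h
        · right; simp [h, h2.2.1]
      have h2 := coverNum_le h1
      rw [h w₀, ← hc, Finset.card_erase_of_mem hw₀] at h2
      have := Finset.card_pos.2 ⟨w₀, hw₀⟩
      omega
  · exfalso
    have h1 : ∀ u w, side χ (del H (insert u₀ D)) u w → u ∈ L.erase u₀ ∨ w ∈ R := by
      intro u w huw
      have h2 := huw.2.2
      simp only [Finset.mem_insert, not_or] at h2
      rcases hLR u w ⟨huw.1, huw.2.1, h2.1.2, h2.2.2⟩ with h | h
      · left; simp [h, h2.1.1]
      · exact Or.inr h
    have h2 := coverNum_le h1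
    rw [h u₀, ← hc, Finset.card_erase_of_mem hu₀] at h2
    have := Finset.card_pos.2 ⟨u₀, hu₀⟩
    omega

theorem isMinVertexCover_of_coverNum (hχ : ∀ u w, H.Adj u w → χ u ≠ χ w) {D : Finset (Fin n)}
    (h0 : coverNum (side χ (del H D)) = 0) (hD : D.card = coverNum (side χ (del H ∅))) :
    IsMinVertexCover H D := by
  have hside : side χ (del H ∅) = side χ H.Adj := by
    funext u w; simp [side, del]
  refine ⟨?_, fun E hE => ?_⟩
  · obtain ⟨L, R, hLR, hc⟩ := exists_cover (side χ (del H D))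
    have hL : L = ∅ := Finset.card_eq_zero.1 (by omega)
    have hR : R = ∅ := Finset.card_eq_zero.1 (by omega)
    subst hL hR
    have key : ∀ u w, H.Adj u w → χ u = true → u ∈ D ∨ w ∈ D := by
      intro u w huw hu
      by_contra hc
      push Not at hc
      have := hLR u w ⟨hu, huw, hc.1, hc.2⟩
      simp at this
    intro u w huw
    cases hu : χ u with
    | true => exact key u w huw hu
    | false =>
      have := hχ u w huw
      rw [hu] at this
      exact (key w u huw.symm (by simpa using this.symm)).symm
  · obtain ⟨C, hC⟩ := exists_isMinVertexCover H
    rw [hD, hside, ← hC.card_eq hχ]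
    exact hC.2 E hE

end Delete

/-! ### Filling a matrix -/

/-- Fill the array `b` with the values of an expression in the row `16` and the column `17`. -/
def fillArr (b : ℕ) (e : Expr) : Prog :=
  .loop 16 .size (.loop 17 .size (.assign b (.var 16) (.var 17) e))

/-- The expression may use the old value of the entry that is being overwritten, so the lemma also
covers updates in place. -/
theorem fillArr_post {n b : ℕ} {m : Mem} {e : Expr} {F : ℕ → ℕ → ℕ} (h0 : m 0 0 0 = n)
    (hb0 : b ≠ 0) (hb16 : b ≠ 16) (hb17 : b ≠ 17)
    (he : ∀ m' : Mem, (∀ a, a ≠ b → a ≠ 16 → a ≠ 17 → m' a = m a) → ∀ i < n, ∀ j < n,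
      m' 16 0 0 = i → m' 17 0 0 = j → m' b i j = m b i j → e.val m' = F i j) :
    (fillArr b e).Post (fun m' => (∀ i j, m' b i j = if i < n ∧ j < n then F i j else m b i j) ∧
      ∀ a, a ≠ b → a ≠ 16 → a ≠ 17 → m' a = m a) m := by
  refine Prog.Post.loop (fun k m' => (∀ a, a ≠ b → a ≠ 16 → a ≠ 17 → m' a = m a) ∧
    ∀ i j, m' b i j = if i < k ∧ j < n then F i j else m b i j)
    ⟨fun _ _ _ _ => rfl, by simp⟩ ?_ ?_
  · intro k hk m' ⟨hf, hd⟩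
    simp only [Expr.val, h0] at hk
    have hf1 : ∀ a, a ≠ b → a ≠ 16 → a ≠ 17 → wr m' 16 0 0 k a = m a := fun a h1 h2 h3 =>
      (wr_ne _ h2 _ _ _).trans (hf a h1 h2 h3)
    have e5 : wr m' 16 0 0 k b = m' b := wr_ne _ hb16 _ _ _
    refine Prog.Post.loop (fun l m'' => (∀ a, a ≠ b → a ≠ 16 → a ≠ 17 → m'' a = m a) ∧
      m'' 16 0 0 = k ∧ ∀ i j, m'' b i j = if i < k ∧ j < n ∨ i = k ∧ j < l then F i j else m b i j)
      ⟨hf1, by simp [wr_apply], ?_⟩ ?_ ?_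
    · intro i j
      rw [e5, hd]
      simp
    · intro l hl m'' ⟨gf, g16, gd⟩
      have hl' : l < n := by
        simp only [Expr.val] at hl
        rw [hf1 0 (Ne.symm hb0) (by decide) (by decide), h0] at hl
        exact hl
      have gf1 : ∀ a, a ≠ b → a ≠ 16 → a ≠ 17 → wr m'' 17 0 0 l a = m a := fun a h1 h2 h3 =>
        (wr_ne _ h3 _ _ _).trans (gf a h1 h2 h3)
      have g16' : wr m'' 17 0 0 l 16 0 0 = k := by simp [wr_apply, g16]
      have g17' : wr m'' 17 0 0 l 17 0 0 = l := by simp [wr_apply]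
      have e5' : wr m'' 17 0 0 l b = m'' b := wr_ne _ hb17 _ _ _
      have ev := he _ gf1 k hk l hl' g16' g17' (by rw [e5', gd, if_neg (by omega)])
      simp only [Prog.Post, Expr.val, g16', g17', ev]
      refine ⟨fun a h1 h2 h3 => (wr_ne _ h1 _ _ _).trans (gf1 a h1 h2 h3), ?_, ?_⟩
      · rw [wr_ne _ (Ne.symm hb16), g16']
      · intro i j
        rw [wr_apply, e5', gd]
        by_cases hij : i = k ∧ j = l
        · rw [if_pos ⟨rfl, hij.1, hij.2⟩, if_pos (by omega), hij.1, hij.2]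
        · rw [if_neg (fun h => hij h.2)]
          by_cases h1 : i < k ∧ j < n ∨ i = k ∧ j < l
          · rw [if_pos h1, if_pos (by omega)]
          · rw [if_neg h1, if_neg (by omega)]
    · intro m'' ⟨gf, g16, gd⟩
      have hsz : Expr.size.val (wr m' 16 0 0 k) = n := by
        simp only [Expr.val]
        rw [hf1 0 (Ne.symm hb0) (by decide) (by decide), h0]
      rw [hsz] at gd
      refine ⟨gf, fun i j => ?_⟩
      rw [gd]
      by_cases h1 : i < k + 1 ∧ j < n
      · rw [if_pos h1, if_pos (by omega)]
      · rw [if_neg h1, if_neg (by omega)]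
  · intro m' ⟨hf, hd⟩
    simp only [Expr.val, h0] at hd
    exact ⟨hd, hf⟩

theorem fillArr_bounded {b : ℕ} (hb : b ≠ 0) (e : Expr) : (fillArr b e).Bounded := by
  simp [fillArr, Prog.Bounded, Expr.IsSize, hb]

theorem fillArr_noFlip (b : ℕ) (e : Expr) : (fillArr b e).NoFlip := by
  simp [fillArr, Prog.NoFlip]

/-- The array `5` vanishes outside its range. -/
def MatClean (n : ℕ) (m : Mem) : Prop := ∀ i j, (n ≤ i ∨ n ≤ j) → m 5 i j = 0

theorem fillArr_post_rel {n : ℕ} {m : Mem} {e : Expr} {h : Fin n → Fin n → Prop}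
    (h0 : m 0 0 0 = n) (hc : MatClean n m)
    (he : ∀ m' : Mem, (∀ a, a ≠ 5 → a ≠ 16 → a ≠ 17 → m' a = m a) → ∀ u w : Fin n,
      m' 16 0 0 = u → m' 17 0 0 = w → e.val m' = relMat h u w) :
    (fillArr 5 e).Post (fun m' => m' 5 = relMat h ∧
      ∀ a, a ≠ 5 → a ≠ 16 → a ≠ 17 → m' a = m a) m := by
  refine (fillArr_post (F := relMat h) h0 (by decide) (by decide) (by decide)
    fun m' hf i hi j hj h16 h17 _ => he m' hf ⟨i, hi⟩ ⟨j, hj⟩ h16 h17).mono ?_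
  rintro m' ⟨h5, hf⟩
  refine ⟨?_, hf⟩
  funext i j
  rw [h5]
  split_ifs with hij
  · rfl
  · rw [hc i j (by omega), relMat, if_neg]
    rintro ⟨h1, h2, -⟩
    omega

theorem matClean_relMat {n : ℕ} {m : Mem} {h : Fin n → Fin n → Prop} (hm : m 5 = relMat h) :
    MatClean n m := by
  intro i j hij
  rw [hm, relMat, if_neg]
  rintro ⟨h1, h2, -⟩
  omega

/-! ### Minimum vertex covers -/

/-- Count the rows that own a column. -/
def countRows : Prog :=
  .seq (.set 18 (.const 0))
    (.loop 16 .size (.ite (.vec 8 (.succ (.var 16))) (.set 18 (.succ (.var 18))) .skip))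

theorem countRows_post {n : ℕ} {m : Mem} (h0 : m 0 0 0 = n) :
    countRows.Post (fun m' => m' 18 0 0 =
        (Finset.univ.filter fun u : Fin n => m 8 (u + 1) 0 ≠ 0).card ∧
      ∀ a, a ≠ 16 → a ≠ 18 → m' a = m a) m := by
  classical
  have hcard : (Finset.univ.filter fun u : Fin n => m 8 (u + 1) 0 ≠ 0).card =
      ∑ i ∈ Finset.range n, if m 8 (i + 1) 0 ≠ 0 then 1 else 0 := by
    rw [Finset.card_filter, Finset.sum_range]
  rw [hcard]
  have e0 : wr m 18 0 0 0 0 0 0 = n := by rw [wr_ne _ (by decide), h0]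
  refine Prog.Post.loop (fun k m' => m' 18 0 0 =
      (∑ i ∈ Finset.range k, if m 8 (i + 1) 0 ≠ 0 then 1 else 0) ∧
      ∀ a, a ≠ 16 → a ≠ 18 → m' a = m a) ⟨by simp [wr_apply, Expr.val], ?_⟩ ?_ ?_
  · intro a _ h2
    exact wr_ne _ h2 _ _ _
  · intro k _ m' ⟨hs, hf⟩
    have g8 := hf 8 (by decide) (by decide)
    simp only [Prog.Post, Expr.val, wr_apply, Nat.reduceEqDiff, false_and, if_false, and_self,
      if_true, g8, Finset.sum_range_succ]
    refine ⟨fun h => ⟨?_, fun a h1 h2 => ?_⟩, fun h => ⟨?_, fun a h1 h2 => ?_⟩⟩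
    · rw [if_pos h, hs]
    · rw [wr_ne _ h2, wr_ne _ h1, hf a h1 h2]
    · rw [if_neg (by simp [h]), hs, add_zero]
    · rw [wr_ne _ h1, hf a h1 h2]
  · intro m' hm'
    simpa [Expr.val, e0] using hm'

/-- Compute twice the vertex cover number of the remaining graph. -/
def measureCover : Prog :=
  .seq (fillArr 5 (.sub (.sub (.add (.read 3 (.var 16) (.var 17))
      (.sub (.read 1 (.var 16) (.var 17)) (.read 2 (.var 16) (.var 17))))
      (.vec 4 (.var 16))) (.vec 4 (.var 17))))
    (.seq auction countRows)

/-- Greedy search for a minimum vertex cover. -/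
def coverProg : Prog :=
  .seq measureCover (.seq (.set 20 (.var 18)) (.loop 19 .size
    (.seq (.assign 4 (.var 19) (.const 0) (.const 1))
      (.seq measureCover (.ite (.sub (.var 20) (.var 18)) (.set 20 (.var 18))
        (.assign 4 (.var 19) (.const 0) (.const 0)))))))

/-- The memory during the search, with the set `D` of chosen vertices. -/
structure CoverMem {n : ℕ} (G Q Qp : SimpleGraph (Fin n)) (D : Finset (Fin n)) (m : Mem) :
    Prop where
  size : m 0 = sizeArr n
  arr1 : m 1 = adjEntry G
  arr2 : m 2 = adjEntry Q
  arr3 : m 3 = adjEntry Qp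
  out : ∀ v : Fin n, m 4 v 0 = if v ∈ D then 1 else 0
  mat : MatClean n m
  tidy : Tidy n m

section Greedy

variable {n : ℕ} {χ : Fin n → Bool} {G Q Qp : SimpleGraph (Fin n)}

theorem measureCover_post {D : Finset (Fin n)} {m : Mem} (hQ : Q ≤ G) (hQp : Qp ≤ Q)
    (hm : CoverMem G Q Qp D m) :
    measureCover.Post (fun m' => CoverMem G Q Qp D m' ∧
      m' 18 0 0 = coverNum (del (Qp ⊔ (G \ Q)) D) ∧ m' 19 = m 19 ∧ m' 20 = m 20) m := by
  have hs : m 0 0 0 = n := by rw [hm.size]; simp [sizeArr]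
  unfold measureCover
  refine Prog.Post.seq (fillArr_post_rel (h := del (Qp ⊔ (G \ Q)) D) hs hm.mat ?_) ?_
  · intro m' hf u w h16 h17
    simp only [Expr.val, h16, h17]
    rw [hf 3 (by decide) (by decide) (by decide), hf 1 (by decide) (by decide) (by decide),
      hf 2 (by decide) (by decide) (by decide), hf 4 (by decide) (by decide) (by decide),
      hm.arr1, hm.arr2, hm.arr3, hm.out, hm.out]
    have a1 := @hQ u w
    have a2 := @hQp u w
    simp only [adjEntry, relMat, del, Fin.is_lt, exists_true_left, Fin.eta, SimpleGraph.sup_adj,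
      SimpleGraph.sdiff_adj]
    by_cases b1 : G.Adj u w <;> by_cases b2 : Q.Adj u w <;> by_cases b3 : Qp.Adj u w <;>
      by_cases b4 : u ∈ D <;> by_cases b5 : w ∈ D <;> simp_all
  · rintro m₁ ⟨h5, hf⟩
    have g0 := hf 0 (by decide) (by decide) (by decide)
    have g1 := hf 1 (by decide) (by decide) (by decide)
    have g2 := hf 2 (by decide) (by decide) (by decide)
    have g3 := hf 3 (by decide) (by decide) (by decide)
    have g4 := hf 4 (by decide) (by decide) (by decide)
    have g19 := hf 19 (by decide) (by decide) (by decide)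
    have g20 := hf 20 (by decide) (by decide) (by decide)
    refine Prog.Post.seq (auction_post (g0.trans hm.size) h5
      (hm.tidy.congr fun a h1 h2 => hf a (by omega) (by omega) (by omega))) ?_
    rintro m₂ ⟨h8, ht, hf₂⟩
    have hs₂ : m₂ 0 0 0 = n := by rw [hf₂ 0 (by omega), g0, hs]
    refine Prog.Post.mono (countRows_post hs₂) ?_
    rintro m₃ ⟨h18, hf₃⟩
    rw [h8, card_auctionEnd] at h18
    refine ⟨⟨?_, ?_, ?_, ?_, ?_, ?_, ?_⟩, h18, ?_, ?_⟩
    · rw [hf₃ 0 (by decide) (by decide), hf₂ 0 (by omega), g0, hm.size]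
    · rw [hf₃ 1 (by decide) (by decide), hf₂ 1 (by omega), g1, hm.arr1]
    · rw [hf₃ 2 (by decide) (by decide), hf₂ 2 (by omega), g2, hm.arr2]
    · rw [hf₃ 3 (by decide) (by decide), hf₂ 3 (by omega), g3, hm.arr3]
    · rw [hf₃ 4 (by decide) (by decide), hf₂ 4 (by omega), g4]; exact hm.out
    · refine matClean_relMat (h := del (Qp ⊔ (G \ Q)) D) ?_
      rw [hf₃ 5 (by decide) (by decide), hf₂ 5 (by omega), h5]
    · exact ht.congr fun a h1 h2 => hf₃ a (by omega) (by omega)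
    · rw [hf₃ 19 (by decide) (by decide), hf₂ 19 (by omega), g19]
    · rw [hf₃ 20 (by decide) (by decide), hf₂ 20 (by omega), g20]

theorem CoverMem.congr {D : Finset (Fin n)} {m m' : Mem} (hm : CoverMem G Q Qp D m)
    (hf : ∀ a, a ≤ 15 → m' a = m a) : CoverMem G Q Qp D m' := by
  refine ⟨?_, ?_, ?_, ?_, ?_, ?_, ?_⟩
  · rw [hf 0 (by omega), hm.size]
  · rw [hf 1 (by omega), hm.arr1]
  · rw [hf 2 (by omega), hm.arr2]
  · rw [hf 3 (by omega), hm.arr3]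
  · rw [hf 4 (by omega)]; exact hm.out
  · intro i j hij; rw [hf 5 (by omega)]; exact hm.mat i j hij
  · exact hm.tidy.congr fun a _ h => hf a h

theorem CoverMem.write {D D' : Finset (Fin n)} {m : Mem} (hm : CoverMem G Q Qp D m) {i : ℕ} {x : ℕ}
    (h : ∀ v : Fin n, (if v ∈ D' then 1 else 0) = if (v : ℕ) = i then x else if v ∈ D then 1 else 0) :
    CoverMem G Q Qp D' (wr m 4 i 0 x) := by
  refine ⟨?_, ?_, ?_, ?_, ?_, ?_, ?_⟩
  · rw [wr_ne _ (by decide), hm.size]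
  · rw [wr_ne _ (by decide), hm.arr1]
  · rw [wr_ne _ (by decide), hm.arr2]
  · rw [wr_ne _ (by decide), hm.arr3]
  · intro v; rw [wr_apply, hm.out, h]; simp
  · intro i j hij; rw [wr_ne _ (by decide)]; exact hm.mat i j hij
  · exact hm.tidy.congr fun a h1 _ => wr_ne _ (by omega) _ _ _

/-- The invariant of the greedy search. -/
structure GreedyInv (χ : Fin n → Bool) (G Q Qp : SimpleGraph (Fin n)) (k : ℕ)
    (D : Finset (Fin n)) (m : Mem) : Prop where
  mem : CoverMem G Q Qp D m
  current : m 20 0 0 = 2 * coverNum (side χ (del (Qp ⊔ (G \ Q)) D))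
  card : D.card + coverNum (side χ (del (Qp ⊔ (G \ Q)) D)) =
    coverNum (side χ (del (Qp ⊔ (G \ Q)) ∅))
  processed : ∀ v : Fin n, (v : ℕ) < k →
    coverNum (side χ (del (Qp ⊔ (G \ Q)) (insert v D))) =
      coverNum (side χ (del (Qp ⊔ (G \ Q)) D))
  fresh : ∀ v ∈ D, (v : ℕ) < k

/-- A vertex is kept exactly if its deletion lowers the cover number of the rest, so every chosen
vertex belongs to a cheapest completion. At the end no deletion helps, and nothing is left to be
covered. -/
theorem coverProg_post (hχ : ∀ u w, G.Adj u w → χ u ≠ χ w) (hQ : Q ≤ G) (hQp : Qp ≤ Q) {m : Mem}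
    (hm : CoverMem G Q Qp ∅ m) :
    coverProg.Post (fun m' => ∃ D, IsMinVertexCover (Qp ⊔ (G \ Q)) D ∧
      ∀ v : Fin n, m' 4 v 0 = if v ∈ D then 1 else 0) m := by
  classical
  set H := Qp ⊔ (G \ Q) with hH
  have hχH : ∀ u w, H.Adj u w → χ u ≠ χ w := by
    rintro u w (h | h)
    · exact hχ u w (hQ (hQp h))
    · exact hχ u w h.1
  unfold coverProg
  refine Prog.Post.seq (measureCover_post hQ hQp hm) ?_
  rintro m₁ ⟨hm₁, h18, -, -⟩
  refine Prog.Post.seq (P' := fun m' => m' = wr m₁ 20 0 0 (m₁ 18 0 0)) (Prog.Post.assign rfl) ?_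
  rintro _ rfl
  have hs₁ : wr m₁ 20 0 0 (m₁ 18 0 0) 0 0 0 = n := by
    rw [wr_ne _ (by decide), hm₁.size]; simp [sizeArr]
  refine Prog.Post.loop (fun k m' => ∃ D, GreedyInv χ G Q Qp k D m') ⟨∅, ?_⟩ ?_ ?_
  · refine ⟨hm₁.congr fun a ha => wr_ne _ (by omega) _ _ _, ?_, by simp, by simp, by simp⟩
    simp only [wr_apply, and_self, if_true]
    rw [h18, coverNum_del hχH]
  · rintro k hk m' ⟨D, hD⟩
    have hkn : k < n := by simpa [Expr.val, hs₁] using hk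
    set v : Fin n := ⟨k, hkn⟩ with hv
    have hvD : v ∉ D := fun h => by
      have := hD.fresh v h
      simp [hv] at this
    have e19 : wr m' 19 0 0 k 19 0 0 = k := by simp [wr_apply]
    have c1 : CoverMem G Q Qp D (wr m' 19 0 0 k) :=
      hD.mem.congr fun a ha => wr_ne _ (by omega) _ _ _
    have c2 : CoverMem G Q Qp (insert v D) (wr (wr m' 19 0 0 k) 4 k 0 1) := by
      refine c1.write fun x => ?_
      by_cases hx : x = v
      · simp [hx, hv]
      · have : (x : ℕ) ≠ k := fun h => hx (Fin.ext h)
        simp [hx, this]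
    refine Prog.Post.seq (P' := fun m'' => m'' = wr (wr m' 19 0 0 k) 4 k 0 1)
      (Prog.Post.assign (by simp only [Expr.val, e19])) ?_
    rintro _ rfl
    refine Prog.Post.seq (measureCover_post hQ hQp c2) ?_
    rintro m₂ ⟨hm₂, g18, g19, g20⟩
    have f19 : m₂ 19 0 0 = k := by rw [g19, wr_ne _ (by decide), e19]
    have f20 : m₂ 20 0 0 = 2 * coverNum (side χ (del H D)) := by
      rw [g20, wr_ne _ (by decide), wr_ne _ (by decide), hD.current]
    rw [← hH, coverNum_del hχH] at g18
    have l1 := coverNum_del_insert_le (χ := χ) (H := H) D v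
    have l2 := coverNum_le_del_insert hχH D v
    refine Prog.Post.ite (fun hlt => Prog.Post.assign ⟨insert v D, ?_⟩)
      (fun hle => Prog.Post.assign ⟨D, ?_⟩)
    · simp only [Expr.val, f20, g18] at hlt ⊢
      refine ⟨hm₂.congr fun a ha => wr_ne _ (by omega) _ _ _, by simp [wr_apply, ← hH], ?_, ?_, ?_⟩
      · have := hD.card
        rw [Finset.card_insert_of_notMem hvD]
        rw [← hH] at this ⊢
        omega
      · intro x hx
        rcases Nat.lt_succ_iff_lt_or_eq.1 hx with h | h
        -- A rejected vertex stays useless: deleting `v` costs at most one after deleting `x`, and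
        -- in this branch it already costs one without `x`.
        · have a1 := hD.processed x h
          have a2 := coverNum_del_insert_le (χ := χ) (H := H) (insert v D) x
          have a3 := coverNum_le_del_insert hχH (insert x D) v
          rw [Finset.insert_comm v x D] at a3
          rw [← hH] at a1 ⊢
          omega
        · have : x = v := Fin.ext h
          rw [this, Finset.insert_idem]
      · intro x hx
        rcases Finset.mem_insert.1 hx with rfl | h
        · simp [hv]
        · have := hD.fresh x h
          omega
    · simp only [Expr.val, f19, f20, g18] at hle ⊢
      refine ⟨?_, ?_, hD.card, ?_, fun x hx => ?_⟩
      · refine hm₂.write fun x => ?_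
        by_cases hx : x = v
        · simp [hx, hv]
          exact hvD
        · have : (x : ℕ) ≠ k := fun h => hx (Fin.ext h)
          simp [hx, this]
      · rw [wr_ne _ (by decide), f20]
      · intro x hx
        rcases Nat.lt_succ_iff_lt_or_eq.1 hx with h | h
        · exact hD.processed x h
        · have : x = v := Fin.ext h
          rw [this, ← hH]
          omega
      · have := hD.fresh x hx
        omega
  · rintro m' ⟨D, hD⟩
    refine ⟨D, ?_, hD.mem.out⟩
    have hz : coverNum (side χ (del H D)) = 0 := coverNum_del_eq_zero fun v =>
      hD.processed v (by simp [Expr.val, hs₁])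
    refine isMinVertexCover_of_coverNum hχH hz ?_
    have := hD.card
    rw [← hH] at this
    omega

theorem findCover_coverProg (hχ : ∀ u w, G.Adj u w → χ u ≠ χ w) (hQ : Q ≤ G) (hQp : Qp ≤ Q) :
    IsMinVertexCover (Qp ⊔ (G \ Q)) (findCover coverProg G Q Qp) := by
  have hm : CoverMem G Q Qp ∅ (queryInput G Q Qp).mem := by
    refine ⟨rfl, rfl, rfl, rfl, fun v => by simp [queryInput], fun i j _ => rfl, ?_, ?_⟩
    · intro i j _; exact ⟨rfl, rfl, rfl⟩
    · intro a h1 h2 i j _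
      interval_cases a <;> rfl
  obtain ⟨D, hD, hout⟩ := (coverProg_post hχ hQ hQp hm).exec_state
  have : findCover coverProg G Q Qp = D := by
    ext v
    have := hout v
    simp only [findCover, outputSet, Finset.mem_filter, Finset.mem_univ, true_and]
    rw [this]
    simp
  rw [this]
  exact hD

end Greedy

theorem coverProg_bounded : coverProg.Bounded := by
  simp [coverProg, measureCover, countRows, fillArr_bounded, auction_bounded, Prog.Bounded,
    Expr.IsSize]

theorem coverProg_depth : coverProg.depth = 5 := by
  simp [coverProg, measureCover, countRows, fillArr, auction_depth, Prog.depth]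

/-! ### Averages over coins -/

/-- The coin sequence `ω` after the coin `b`. -/
def consCoin (b : Bool) (ω : ℕ → Bool) : ℕ → Bool
  | 0 => b
  | k + 1 => ω k

/-- The average over the first `M` coins. -/
noncomputable def coinAvg : ℕ → ((ℕ → Bool) → ℝ) → ℝ
  | 0, f => f fun _ => false
  | M + 1, f => (coinAvg M (fun ω => f (consCoin false ω)) +
      coinAvg M (fun ω => f (consCoin true ω))) / 2

theorem tape_cons {M : ℕ} (b : Bool) (r : Fin M → Bool) :
    tape (Fin.cons b r : Fin (M + 1) → Bool) = consCoin b (tape r) := by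
  funext k
  cases k with
  | zero => simp [tape, consCoin]
  | succ k =>
    simp only [tape, consCoin, Nat.add_lt_add_iff_right]
    split_ifs with h
    · exact Fin.cons_succ (α := fun _ => Bool) b r ⟨k, h⟩
    · rfl

theorem coinExp_eq_coinAvg (M : ℕ) (f : (ℕ → Bool) → ℝ) : coinExp M f = coinAvg M f := by
  induction M generalizing f with
  | zero =>
    simp only [coinExp, coinAvg, pow_zero, div_one, Finset.univ_unique, Finset.sum_singleton]
    congr 1
  | succ M ih =>
    rw [coinAvg, ← ih, ← ih]
    unfold coinExp
    rw [← (Fin.consEquiv fun _ : Fin (M + 1) => Bool).sum_comp, Fintype.sum_prod_type,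
      Fintype.sum_bool]
    simp only [Fin.consEquiv, Equiv.coe_fn_mk, tape_cons]
    rw [pow_succ]
    field_simp
    ring

theorem coinAvg_const (M : ℕ) (x : ℝ) : coinAvg M (fun _ => x) = x := by
  induction M with
  | zero => rfl
  | succ M ih => rw [coinAvg, ih]; ring

/-- Iterated expectation transformers. -/
noncomputable def loopAvg (B : ℕ → (Mem → ℝ) → Mem → ℝ) : ℕ → (Mem → ℝ) → Mem → ℝ
  | 0, f => f
  | k + 1, f => loopAvg B k (B k f)

/-- The expectation of `f` after the execution of a program from the memory `m`. -/
noncomputable def Prog.avg : Prog → (Mem → ℝ) → Mem → ℝ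
  | .skip, f, m => f m
  | .assign a i j e, f, m => f (wr m a (i.val m) (j.val m) (e.val m))
  | .flip a i j, f, m =>
    (f (wr m a (i.val m) (j.val m) 0) + f (wr m a (i.val m) (j.val m) 1)) / 2
  | .seq c d, f, m => c.avg (d.avg f) m
  | .ite e c d, f, m => if e.val m ≠ 0 then c.avg f m else d.avg f m
  | .loop a e c, f, m => loopAvg (fun k f m => c.avg f (wr m a 0 0 k)) (e.val m) f m

theorem loopAvg_mono {A : ℕ → (Mem → Prop) → Mem → Prop} {B : ℕ → (Mem → ℝ) → Mem → ℝ}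
    (hA : ∀ k P P' m, (∀ m, P m → P' m) → A k P m → A k P' m)
    (hB : ∀ k f g m, A k (fun m => f m ≤ g m) m → B k f m ≤ B k g m) {K : ℕ} {f g : Mem → ℝ}
    {m : Mem} (h : loopPost A K (fun m => f m ≤ g m) m) : loopAvg B K f m ≤ loopAvg B K g m := by
  induction K generalizing f g with
  | zero => exact h
  | succ K ih => exact ih (loopPost_mono hA (fun m hm => hB K f g m hm) h)

theorem Prog.Post.avg_mono {c : Prog} {f g : Mem → ℝ} {m : Mem}
    (h : c.Post (fun m' => f m' ≤ g m') m) : c.avg f m ≤ c.avg g m := by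
  induction c generalizing f g m with
  | skip => exact h
  | assign => exact h
  | flip a i j =>
    simp only [Prog.avg]
    linarith [h.1, h.2]
  | seq c d hc hd => exact hc (Prog.Post.mono h fun m' hm' => hd hm')
  | ite e c d hc hd =>
    simp only [Prog.avg]
    split_ifs with he
    · exact hc (h.1 he)
    · exact hd (h.2 (not_not.1 he))
  | loop a e c hc =>
    exact loopAvg_mono (A := fun k P m => c.Post P (wr m a 0 0 k))
      (B := fun k f m => c.avg f (wr m a 0 0 k)) (fun k P P' m hPP hB => hB.mono hPP) (fun k f g m hk => hc hk) h

theorem Prog.Post.avg_congr {c : Prog} {f g : Mem → ℝ} {m : Mem}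
    (h : c.Post (fun m' => f m' = g m') m) : c.avg f m = c.avg g m :=
  le_antisymm (Prog.Post.avg_mono (h.mono fun _ h => h.le))
    (Prog.Post.avg_mono (h.mono fun _ h => h.ge))

theorem Prog.avg_const (c : Prog) (x : ℝ) (m : Mem) : c.avg (fun _ => x) m = x := by
  induction c generalizing m with
  | skip => rfl
  | assign => rfl
  | flip a i j => simp only [Prog.avg]; ring
  | seq c d hc hd =>
    simp only [Prog.avg]
    rw [show d.avg (fun _ => x) = fun _ => x from funext hd, hc]
  | ite e c d hc hd => simp only [Prog.avg, hc, hd, ite_self]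
  | loop a e c hc =>
    simp only [Prog.avg]
    generalize e.val m = K
    induction K with
    | zero => rfl
    | succ K ih =>
      rw [loopAvg]
      simp only [hc]
      exact ih

theorem Prog.Post.avg_le {c : Prog} {f : Mem → ℝ} {x : ℝ} {m : Mem}
    (h : c.Post (fun m' => f m' ≤ x) m) : c.avg f m ≤ x :=
  (Prog.Post.avg_mono (g := fun _ => x) h).trans_eq (c.avg_const x m)

theorem Prog.avg_seq_le {c d : Prog} {f g : Mem → ℝ} {m : Mem}
    (h : c.Post (fun m' => d.avg f m' ≤ g m') m) : (Prog.seq c d).avg f m ≤ c.avg g m :=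
  Prog.Post.avg_mono h

/-- Loop invariants for expectations. -/
theorem Prog.avg_loop_le {a : ℕ} {e : Expr} {c : Prog} {m : Mem} {f : Mem → ℝ}
    (I : ℕ → Mem → Prop) (Ψ : ℕ → Mem → ℝ) (h0 : I 0 m)
    (hI : ∀ k < e.val m, ∀ m', I k m' → c.Post (I (k + 1)) (wr m' a 0 0 k))
    (hstep : ∀ k < e.val m, ∀ m', I k m' → c.avg (Ψ (k + 1)) (wr m' a 0 0 k) ≤ Ψ k m')
    (hf : ∀ m', I (e.val m) m' → f m' ≤ Ψ (e.val m) m') :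
    (Prog.loop a e c).avg f m ≤ Ψ 0 m := by
  have hpost : ∀ K ≤ e.val m, loopPost (fun k P m => c.Post P (wr m a 0 0 k)) K (I K) m := by
    intro K hK
    exact Prog.Post.loop (a := a) (e := .const K) (c := c) (P := I K) I h0
      (fun k hk m' hm' => hI k (lt_of_lt_of_le hk hK) m' hm') fun _ h => h
  have hmono : ∀ {K : ℕ} {f g : Mem → ℝ}, loopPost (fun k P m => c.Post P (wr m a 0 0 k)) K
      (fun m => f m ≤ g m) m → loopAvg (fun k f m => c.avg f (wr m a 0 0 k)) K f m ≤
        loopAvg (fun k f m => c.avg f (wr m a 0 0 k)) K g m := fun h =>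
    Prog.Post.avg_mono (c := .loop a (.const _) c) h
  have lmono : ∀ {K : ℕ} {P P' : Mem → Prop}, (∀ m, P m → P' m) →
      loopPost (fun k P m => c.Post P (wr m a 0 0 k)) K P m →
      loopPost (fun k P m => c.Post P (wr m a 0 0 k)) K P' m := fun hP h =>
    Prog.Post.mono (c := .loop a (.const _) c) h hP
  have key : ∀ K ≤ e.val m,
      loopAvg (fun k f m => c.avg f (wr m a 0 0 k)) K (Ψ K) m ≤ Ψ 0 m := by
    intro K
    induction K with
    | zero => exact fun _ => le_refl _
    | succ K ih =>
      intro hK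
      refine le_trans ?_ (ih (by omega))
      exact hmono (lmono (fun m' hm' => hstep K hK m' hm') (hpost K (by omega)))
  exact (hmono (lmono hf (hpost _ le_rfl))).trans (key _ le_rfl)

/-- Coins are not flipped under conditions. -/
def Prog.Uniform : Prog → Prop
  | .skip => True
  | .assign _ _ _ _ => True
  | .flip _ _ _ => True
  | .seq c d => c.Uniform ∧ d.Uniform
  | .ite _ c d => c.NoFlip ∧ d.NoFlip
  | .loop _ _ c => c.Uniform

theorem Prog.NoFlip.uniform {c : Prog} (h : c.NoFlip) : c.Uniform := by
  induction c with
  | skip => trivial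
  | assign => trivial
  | flip => trivial
  | seq c d hc hd => exact ⟨hc h.1, hd h.2⟩
  | ite e c d => exact h
  | loop a e c hc => exact hc h

/-- The number of coin flips of such a program. -/
def Prog.flips (n : ℕ) : Prog → ℕ
  | .flip _ _ _ => 1
  | .seq c d => c.flips n + d.flips n
  | .loop _ e c => e.sizeVal n * c.flips n
  | _ => 0

theorem Prog.NoFlip.avg_eq {c : Prog} (h : c.NoFlip) (f : Mem → ℝ) (m : Mem) :
    c.avg f m = f (c.run m) := by
  have h1 : c.avg f m = c.avg (fun _ => f (c.run m)) m :=
    Prog.Post.avg_congr ((h.post_run m).mono fun m' hm' => by rw [hm'])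
  rw [h1, c.avg_const]

/-- A tape as long as the time bound is therefore long enough. -/
theorem Prog.flips_le {c : Prog} (h : c.Bounded) (s : State) :
    c.flips (s.mem 0 0 0) ≤ (c.exec s).2 := by
  induction c generalizing s with
  | skip => exact Nat.zero_le _
  | assign => exact Nat.zero_le _
  | flip a i j => simp [Prog.flips, Prog.exec]
  | seq c d hc hd =>
    have h0 : (c.exec s).1.mem 0 = s.mem 0 := (h.1.noWrite.post s.mem).exec_state
    have h1 := hc h.1 s
    have h2 := hd h.2 (c.exec s).1
    rw [h0] at h2
    simp only [Prog.flips, Prog.exec]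
    omega
  | ite e c d => exact Nat.zero_le _
  | loop a e c hc =>
    simp only [Prog.flips, Prog.exec, Expr.eval_eq, h.2.1.val_eq]
    generalize e.sizeVal (s.mem 0 0 0) = K
    suffices hk : (iterate (fun k s' => c.exec (s'.write a 0 0 k)) (s, e.cost + 1) K).1.mem 0 =
        s.mem 0 ∧ K * c.flips (s.mem 0 0 0) ≤
        (iterate (fun k s' => c.exec (s'.write a 0 0 k)) (s, e.cost + 1) K).2 from hk.2
    induction K with
    | zero => simp [iterate]
    | succ K ih =>
      set q := iterate (fun k s' => c.exec (s'.write a 0 0 k)) (s, e.cost + 1) K with hq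
      have hw : (q.1.write a 0 0 K).mem 0 = s.mem 0 := by
        rw [State.write_eq]; exact (wr_ne _ (Ne.symm h.1) _ _ _).trans ih.1
      have h1 := hc h.2.2 (q.1.write a 0 0 K)
      rw [hw] at h1
      refine ⟨(h.2.2.noWrite.post (q.1.write a 0 0 K).mem).exec_state.trans hw, ?_⟩
      simp only [iterate]
      rw [add_mul K 1]
      simp only [← hq]
      omega

/-- The expectation of a program is an average over coin sequences. -/
theorem Prog.coinAvg_exec {c : Prog} (hu : c.Uniform) (hb : c.Bounded) {n : ℕ} {m : Mem}
    (hn : m 0 0 0 = n) (F : State → ℝ) (M : ℕ) :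
    coinAvg (c.flips n + M) (fun ω => F (c.exec ⟨m, ω⟩).1) =
      c.avg (fun m' => coinAvg M (fun ω => F ⟨m', ω⟩)) m := by
  induction c generalizing m F M with
  | skip => simp only [Prog.flips, Prog.exec, Prog.avg, zero_add]
  | assign a i j e =>
    simp only [Prog.flips, Prog.exec, Prog.avg, zero_add, State.write_eq, Expr.eval_eq]
  | flip a i j =>
    simp only [Prog.flips, Prog.exec, Prog.avg, State.write_eq, Expr.eval_eq]
    rw [add_comm 1 M, coinAvg]
    simp only [consCoin, Bool.toNat_false, Bool.toNat_true]
  | seq c d hc hd =>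
    simp only [Prog.flips, Prog.exec, Prog.avg]
    rw [add_assoc, hc hu.1 hb.1 hn (fun s => F (d.exec s).1)]
    refine Prog.Post.avg_congr ((hb.1.noWrite.post m).mono fun m' hm' => ?_)
    exact hd hu.2 hb.2 (by rw [hm', hn]) F M
  | ite e c d =>
    simp only [Prog.flips, zero_add]
    -- Branches consume no coins, so the position on the tape never depends on the outcomes.
    have hnf : (Prog.ite e c d).NoFlip := hu
    rw [hnf.avg_eq]
    simp only [hnf.exec_eq]
  | loop a e c hc =>
    simp only [Prog.flips, Prog.exec, Prog.avg, Expr.eval_eq, hb.2.1.val_eq, hn]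
    generalize e.sizeVal n = K
    generalize e.cost + 1 = r
    induction K generalizing F M with
    | zero => simp only [zero_mul, zero_add, iterate, loopAvg]
    | succ K ih =>
      simp only [iterate_succ_fst]
      rw [add_mul, one_mul, add_assoc,
        ih (fun s => F (c.exec (s.write a 0 0 K)).1) (c.flips n + M), loopAvg]
      have hfr : (Prog.loop a (.const K) c).Post (fun m' => m' 0 = m 0) m :=
        Prog.NoWrite.post (c := .loop a (.const K) c) ⟨hb.1, hb.2.2.noWrite⟩ m
      refine Prog.Post.avg_congr (c := .loop a (.const K) c) (hfr.mono fun m' hm' => ?_)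
      exact hc hu hb.2.2 (m := wr m' a 0 0 K) (by rw [wr_ne _ (Ne.symm hb.1), hm', hn]) F M

theorem coinExp_exec {c : Prog} (hu : c.Uniform) (hb : c.Bounded) (m : Mem) {M : ℕ}
    (hM : (c.exec ⟨m, fun _ => false⟩).2 ≤ M) (f : Mem → ℝ) :
    coinExp M (fun ω => f (c.exec ⟨m, ω⟩).1.mem) = c.avg f m := by
  have h1 := Prog.flips_le hb ⟨m, fun _ => false⟩
  obtain ⟨k, rfl⟩ := Nat.exists_eq_add_of_le (h1.trans hM)
  rw [coinExp_eq_coinAvg, Prog.coinAvg_exec hu hb rfl (fun s => f s.mem)]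
  simp only [coinAvg_const]

/-! ### Biased coins -/

/-- The number with the given binary digits after the point. -/
noncomputable def dyadic : List Bool → ℝ
  | [] => 0
  | b :: l => ((if b then 1 else 0) + dyadic l) / 2

theorem dyadic_nonneg (l : List Bool) : 0 ≤ dyadic l := by
  induction l with
  | nil => exact le_refl _
  | cons b l ih =>
    rw [dyadic]
    split_ifs <;> linarith

theorem dyadic_le_one (l : List Bool) : dyadic l ≤ 1 := by
  induction l with
  | nil => exact zero_le_one
  | cons b l ih =>
    rw [dyadic]
    split_ifs <;> linarith

theorem exists_dyadic_near (k : ℕ) {x : ℝ} (h0 : 0 ≤ x) (h1 : x ≤ 1) :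
    ∃ l, dyadic l ≤ x ∧ x ≤ dyadic l + (1 / 2) ^ k := by
  induction k generalizing x with
  | zero => exact ⟨[], h0, by simpa [dyadic] using h1⟩
  | succ k ih =>
    by_cases hx : 2 * x ≤ 1
    · obtain ⟨l, h2, h3⟩ := ih (x := 2 * x) (by linarith) hx
      refine ⟨false :: l, ?_, ?_⟩
      · simp only [dyadic]; norm_num; linarith
      · simp only [dyadic, pow_succ]; norm_num at h3 ⊢; linarith
    · obtain ⟨l, h2, h3⟩ := ih (x := 2 * x - 1) (by linarith) (by linarith)
      refine ⟨true :: l, ?_, ?_⟩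
      · simp only [dyadic]; norm_num; linarith
      · simp only [dyadic, pow_succ]; norm_num at h3 ⊢; linarith

/-- A bounded number of fair coins produces exactly the dyadic probabilities, so the sampling
density `p₁` is chosen dyadic in an interval just below `p`. -/
theorem exists_dyadic_between {x y : ℝ} (h0 : 0 ≤ x) (hxy : x < y) (h1 : y ≤ 1) :
    ∃ l, x ≤ dyadic l ∧ dyadic l ≤ y := by
  obtain ⟨k, hk⟩ := exists_pow_lt_of_lt_one (sub_pos.2 hxy) (by norm_num : (1 / 2 : ℝ) < 1)
  obtain ⟨l, h2, h3⟩ := exists_dyadic_near k (h0.trans hxy.le) h1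
  exact ⟨l, by linarith, h2⟩

/-- Set the variable `24` to `1` with probability `dyadic l`, and to `0` otherwise. -/
def coinProg : List Bool → Prog
  | [] => .set 24 (.const 0)
  | b :: l => .seq (coinProg l) (.seq (.flip 25 (.const 0) (.const 0))
      (.ite (.var 25) (.set 24 (.const b.toNat)) .skip))

theorem coinProg_post (l : List Bool) (m : Mem) :
    (coinProg l).Post (fun m' => m' 24 0 0 ≤ 1 ∧ ∀ a, a ≠ 24 → a ≠ 25 → m' a = m a) m := by
  induction l generalizing m with
  | nil => exact ⟨by simp [wr_apply, Expr.val], fun a h1 _ => wr_ne _ h1 _ _ _⟩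
  | cons b l ih =>
    refine Prog.Post.seq (ih m) ?_
    rintro m' ⟨h24, hf⟩
    have hb : b.toNat ≤ 1 := by cases b <;> simp
    simp only [Prog.Post, Expr.val]
    refine ⟨⟨fun _ => ⟨by simp [wr_apply, hb], fun a h1 h2 => ?_⟩,
      fun _ => ⟨by simpa [wr_apply] using h24, fun a h1 h2 => ?_⟩⟩,
      ⟨fun _ => ⟨by simp [wr_apply, hb], fun a h1 h2 => ?_⟩,
      fun _ => ⟨by simpa [wr_apply] using h24, fun a h1 h2 => ?_⟩⟩⟩
    · rw [wr_ne _ h1, wr_ne _ h2, hf a h1 h2]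
    · rw [wr_ne _ h2, hf a h1 h2]
    · rw [wr_ne _ h1, wr_ne _ h2, hf a h1 h2]
    · rw [wr_ne _ h2, hf a h1 h2]

/-- The outer flip replaces the outcome for the tail by the leading digit with probability one half,
which is the recursion of `dyadic`. -/
theorem coinProg_avg_le (l : List Bool) {f : Mem → ℝ} {m : Mem} {x : Bool → ℝ}
    (h : ∀ (m' : Mem) (b : Bool), (∀ a, a ≠ 24 → a ≠ 25 → m' a = m a) → m' 24 0 0 = b.toNat →
      f m' ≤ x b) :
    (coinProg l).avg f m ≤ ∑ b, bern (dyadic l) b * x b := by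
  induction l generalizing f x with
  | nil =>
    simp only [coinProg, Prog.avg, Expr.val, dyadic, Fintype.sum_bool, bern]
    have := h (wr m 24 0 0 0) false (fun a h1 _ => wr_ne _ h1 _ _ _) (by simp [wr_apply])
    simpa using this
  | cons b l ih =>
    have h1 := ih (f := (Prog.seq (.flip 25 (.const 0) (.const 0))
      (.ite (.var 25) (.set 24 (.const b.toNat)) .skip)).avg f)
      (x := fun v => (x v + x b) / 2) ?_
    · refine le_trans h1 (le_of_eq ?_)
      simp only [Fintype.sum_bool, bern, dyadic]
      cases b <;> simp <;> ring
    · intro m' v hf h24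
      simp only [Prog.avg, Expr.val, wr_apply]
      simp only [and_self, if_true, ne_eq, not_true_eq_false, if_false, one_ne_zero,
        not_false_eq_true]
      have e1 := h (wr m' 25 0 0 0) v (fun a h1 h2 => (wr_ne _ h2 _ _ _).trans (hf a h1 h2))
        (by simpa [wr_apply] using h24)
      have e2 := h (wr (wr m' 25 0 0 1) 24 0 0 b.toNat) b (fun a h1 h2 => by
        rw [wr_ne _ h1, wr_ne _ h2, hf a h1 h2]) (by simp [wr_apply])
      linarith

theorem bernE_update {ι κ : Type*} [Fintype ι] [Fintype κ] [DecidableEq ι] [DecidableEq κ]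
    (p : ℝ) (i : ι) (j : κ) (f : (ι → κ → Bool) → ℝ) :
    ∑ b, bern p b * bernE p (fun z => f (Function.update z i (Function.update (z i) j b))) =
      bernE p f := by
  unfold bernE
  have hrow : ∑ x : κ → Bool, rowWeight p x = 1 := sum_rowWeight p
  have h1 : ∀ b, prodE (fun _ : ι => rowWeight p)
      (fun z => f (Function.update z i (Function.update (z i) j b))) =
      ∑ x : κ → Bool, rowWeight p x * prodE (fun _ : ι => rowWeight p)
        (fun z => f (Function.update z i (Function.update x j b))) := by
    intro b
    rw [← prodE_update (w := fun _ : ι => rowWeight p) i hrow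
      (fun z => f (Function.update z i (Function.update (z i) j b)))]
    simp
  simp only [h1]
  rw [← prodE_update (w := fun _ : ι => rowWeight p) i hrow f]
  exact prodE_update (w := fun _ : κ => bern p) j (sum_bern p)
    (fun x => prodE (fun _ : ι => rowWeight p) (fun z => f (Function.update z i x)))

/-- Fill the array `23` with independent coins. -/
def drawProg (l : List Bool) : Prog :=
  .loop 16 .size (.loop 17 .size
    (.seq (coinProg l) (.assign 23 (.var 16) (.var 17) (.var 24))))

/-- The arrays that are not changed by `drawProg`. -/
def DrawFrame (m₁ m₂ : Mem) : Prop :=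
  ∀ a, a ≠ 16 → a ≠ 17 → a ≠ 23 → a ≠ 24 → a ≠ 25 → m₂ a = m₁ a

/-- The entries of the array `23` before `(k, l)` are drawn. -/
def Drawn (k l i j : ℕ) : Prop := i < k ∨ i = k ∧ j < l

instance (k l i j : ℕ) : Decidable (Drawn k l i j) := inferInstanceAs (Decidable (_ ∨ _))

/-- The invariant while the array `23` is drawn. -/
structure DrawInv (n : ℕ) (m : Mem) (k l : ℕ) (m' : Mem) : Prop where
  frame : DrawFrame m m'
  drawn : ∀ i < n, ∀ j < n, Drawn k l i j → m' 23 i j ≤ 1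

section Draw

variable {n : ℕ}

/-- The outcome of a draw, as far as it is drawn, and `z` elsewhere. -/
def drawMix (k l : ℕ) (m : Mem) (z : Fin n → Fin n → Bool) (u w : Fin n) : Bool :=
  if Drawn k l u w then decide (m 23 u w ≠ 0) else z u w

theorem drawEntry_post {n : ℕ} {m m' : Mem} {k l : ℕ} (ls : List Bool) (hI : DrawInv n m k l m')
    (h16 : m' 16 0 0 = k) :
    (Prog.seq (coinProg ls) (.assign 23 (.var 16) (.var 17) (.var 24))).Post
      (fun m'' => DrawInv n m k (l + 1) m'' ∧ m'' 16 0 0 = k) (wr m' 17 0 0 l) := by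
  refine Prog.Post.seq (coinProg_post ls _) ?_
  rintro m'' ⟨h24, hf⟩
  have e16 : m'' 16 0 0 = k := by
    rw [hf 16 (by decide) (by decide), wr_ne _ (by decide), h16]
  have e17 : m'' 17 0 0 = l := by
    rw [hf 17 (by decide) (by decide)]; simp [wr_apply]
  have e23 : m'' 23 = m' 23 := by
    rw [hf 23 (by decide) (by decide), wr_ne _ (by decide)]
  refine Prog.Post.assign ⟨⟨?_, ?_⟩, ?_⟩
  · intro a h1 h2 h3 h4 h5
    rw [wr_ne _ h3, hf a h4 h5, wr_ne _ h2, hI.frame a h1 h2 h3 h4 h5]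
  · intro i hi j hj hd
    simp only [Expr.val, e16, e17, wr_apply, true_and]
    split_ifs with hij
    · exact h24
    · rw [e23]
      refine hI.drawn i hi j hj ?_
      unfold Drawn at hd ⊢
      omega
  · rw [wr_ne _ (by decide), e16]

/-- The potential is the expectation of `g` with the undrawn entries still random; drawing one entry
only reveals it, by `bernE_update`. -/
theorem drawEntry_avg_le {m' : Mem} {k l : ℕ} (ls : List Bool) (hk : k < n) (hl : l < n)
    (h16 : m' 16 0 0 = k) (g : (Fin n → Fin n → Bool) → ℝ) :
    (Prog.seq (coinProg ls) (.assign 23 (.var 16) (.var 17) (.var 24))).avg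
      (fun m'' => bernE (dyadic ls) (fun z => g (drawMix k (l + 1) m'' z))) (wr m' 17 0 0 l) ≤
      bernE (dyadic ls) (fun z => g (drawMix k l m' z)) := by
  rw [← bernE_update (dyadic ls) ⟨k, hk⟩ ⟨l, hl⟩ (fun z => g (drawMix k l m' z))]
  refine coinProg_avg_le ls fun m'' b hf h24 => le_of_eq ?_
  have e16 : m'' 16 0 0 = k := by
    rw [hf 16 (by decide) (by decide), wr_ne _ (by decide), h16]
  have e17 : m'' 17 0 0 = l := by
    rw [hf 17 (by decide) (by decide)]; simp [wr_apply]
  have e23 : m'' 23 = m' 23 := by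
    rw [hf 23 (by decide) (by decide), wr_ne _ (by decide)]
  simp only [Prog.avg, Expr.val, e16, e17, h24]
  congr 1
  funext z
  congr 1
  funext u w
  unfold drawMix
  by_cases hu : u = ⟨k, hk⟩
  · by_cases hw : w = ⟨l, hl⟩
    · subst hu hw
      have d1 : Drawn k (l + 1) k l := by unfold Drawn; omega
      have d2 : ¬ Drawn k l k l := by unfold Drawn; omega
      simp only [d1, d2, if_true, if_false, Function.update_self, wr_apply, and_self]
      cases b <;> simp
    · have hw' : (w : ℕ) ≠ l := fun h => hw (Fin.ext h)
      have d : Drawn k (l + 1) u w ↔ Drawn k l u w := by unfold Drawn; omega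
      simp only [d, wr_apply, hw', and_false, if_false, e23]
      subst hu
      simp [Function.update_of_ne hw]
  · have hu' : (u : ℕ) ≠ k := fun h => hu (Fin.ext h)
    have d : Drawn k (l + 1) u w ↔ Drawn k l u w := by unfold Drawn; omega
    simp only [d, wr_apply, hu', false_and, and_false, if_false, e23, Function.update_of_ne hu]

theorem drawRow_inv {m m' : Mem} {k : ℕ} (h : DrawInv n m k n m') : DrawInv n m (k + 1) 0 m' :=
  ⟨h.frame, fun i hi j hj hd => h.drawn i hi j hj (by unfold Drawn at hd ⊢; omega)⟩

theorem DrawInv.write {m m' : Mem} {k l : ℕ} (h : DrawInv n m k l m') {a : ℕ}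
    (ha : a = 16 ∨ a = 17) (x : ℕ) : DrawInv n m k l (wr m' a 0 0 x) := by
  refine ⟨fun b h1 h2 h3 h4 h5 => ?_, fun i hi j hj hd => ?_⟩
  · rw [wr_ne _ (by omega), h.frame b h1 h2 h3 h4 h5]
  · rw [wr_ne _ (by omega)]
    exact h.drawn i hi j hj hd

theorem DrawInv.size {m m' : Mem} {k l : ℕ} (h : DrawInv n m k l m') (hn : m 0 0 0 = n) :
    m' 0 0 0 = n := by
  rw [h.frame 0 (by decide) (by decide) (by decide) (by decide) (by decide), hn]

theorem drawRow_post {m m' : Mem} {k : ℕ} (ls : List Bool) (hn : m 0 0 0 = n)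
    (hI : DrawInv n m k 0 m') :
    (Prog.loop 17 .size (.seq (coinProg ls) (.assign 23 (.var 16) (.var 17) (.var 24)))).Post
      (DrawInv n m (k + 1) 0) (wr m' 16 0 0 k) := by
  have hI' := hI.write (Or.inl rfl) k
  refine Prog.Post.loop (fun l m'' => DrawInv n m k l m'' ∧ m'' 16 0 0 = k)
    ⟨hI', by simp [wr_apply]⟩ (fun l _ m'' hm'' => drawEntry_post ls hm''.1 hm''.2) ?_
  simp only [Expr.val, hI'.size hn]
  exact fun m'' hm'' => drawRow_inv hm''.1

theorem drawRow_avg_le {m m' : Mem} {k : ℕ} (ls : List Bool) (hn : m 0 0 0 = n) (hk : k < n)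
    (hI : DrawInv n m k 0 m') (g : (Fin n → Fin n → Bool) → ℝ) :
    (Prog.loop 17 .size (.seq (coinProg ls) (.assign 23 (.var 16) (.var 17) (.var 24)))).avg
      (fun m'' => bernE (dyadic ls) (fun z => g (drawMix (k + 1) 0 m'' z))) (wr m' 16 0 0 k) ≤
      bernE (dyadic ls) (fun z => g (drawMix k 0 m' z)) := by
  have hI' := hI.write (Or.inl rfl) k
  have hs := hI'.size hn
  have e : (fun z => g (drawMix k 0 m' z)) = fun z => g (drawMix k 0 (wr m' 16 0 0 k) z) := by
    funext z
    congr 1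
  rw [e]
  refine Prog.avg_loop_le (fun l m'' => DrawInv n m k l m'' ∧ m'' 16 0 0 = k)
    (fun l m'' => bernE (dyadic ls) (fun z => g (drawMix k l m'' z)))
    ⟨hI', by simp [wr_apply]⟩ (fun l _ m'' hm'' => drawEntry_post ls hm''.1 hm''.2) ?_ ?_
  · simp only [Expr.val, hs]
    exact fun l hl m'' hm'' => drawEntry_avg_le ls hk hl hm''.2 g
  · simp only [Expr.val, hs]
    intro m'' _
    refine le_of_eq ?_
    congr 1
    funext z
    congr 1
    funext u w
    have d : Drawn (k + 1) 0 u w ↔ Drawn k n u w := by unfold Drawn; omega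
    simp only [drawMix, d]

/-- The array `23` contains the outcome `z`. -/
def HasDraw (z : Fin n → Fin n → Bool) (m : Mem) : Prop := ∀ u w : Fin n, m 23 u w = (z u w).toNat

theorem DrawInv.hasDraw {m m' : Mem} (h : DrawInv n m n 0 m') (z : Fin n → Fin n → Bool) :
    HasDraw (drawMix n 0 m' z) m' := by
  intro u w
  have d : Drawn n 0 u w := by unfold Drawn; omega
  have := h.drawn u u.2 w w.2 d
  simp only [drawMix, d, if_true]
  interval_cases h0 : m' 23 u w <;> simp

theorem drawProg_inv {m : Mem} (ls : List Bool) (hn : m 0 0 0 = n) :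
    (drawProg ls).Post (DrawInv n m n 0) m := by
  refine Prog.Post.loop (fun k m' => DrawInv n m k 0 m')
    ⟨fun _ _ _ _ _ _ => rfl, fun i _ j _ hd => absurd hd (by unfold Drawn; omega)⟩
    (fun k _ m' hm' => drawRow_post ls hn hm') ?_
  simp only [Expr.val, hn]
  exact fun _ h => h

theorem drawProg_post {m : Mem} (ls : List Bool) (hn : m 0 0 0 = n) :
    (drawProg ls).Post (fun m' => DrawFrame m m' ∧
      ∃ z : Fin n → Fin n → Bool, HasDraw z m') m :=
  (drawProg_inv ls hn).mono fun _ h => ⟨h.frame, _, h.hasDraw fun _ _ => false⟩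

theorem drawProg_avg_le {m : Mem} (ls : List Bool) (hn : m 0 0 0 = n) {f : Mem → ℝ}
    {g : (Fin n → Fin n → Bool) → ℝ}
    (hfg : ∀ (m' : Mem) (z : Fin n → Fin n → Bool), DrawFrame m m' → HasDraw z m' → f m' ≤ g z) :
    (drawProg ls).avg f m ≤ bernE (dyadic ls) g := by
  have e : bernE (dyadic ls) g = bernE (dyadic ls) (fun z => g (drawMix 0 0 m z)) := by
    congr 1
    funext z
    congr 1
    funext u w
    have d : ¬ Drawn 0 0 u w := by unfold Drawn; omega
    simp only [drawMix, d, if_false]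
  rw [e]
  refine Prog.avg_loop_le (fun k m' => DrawInv n m k 0 m')
    (fun k m' => bernE (dyadic ls) (fun z => g (drawMix k 0 m' z)))
    ⟨fun _ _ _ _ _ _ => rfl, fun i _ j _ hd => absurd hd (by unfold Drawn; omega)⟩
    (fun k _ m' hm' => drawRow_post ls hn hm') ?_ ?_
  · simp only [Expr.val, hn]
    exact fun k hk m' hm' => drawRow_avg_le ls hn hk hm' g
  · simp only [Expr.val, hn]
    intro m' hm'
    rw [← bernE_const (ι := Fin n) (κ := Fin n) (dyadic ls) (f m')]
    exact bernE_mono (dyadic_nonneg ls) (dyadic_le_one ls) fun z =>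
      hfg m' _ hm'.frame (hm'.hasDraw z)

end Draw

/-! ### Sampling matchings -/

/-- Count the pairs of the matching found by the auction in the array `21`, with multiplicity `R`,
and the matchings in the variable `22`. -/
def tallyProg (R : ℕ) : Prog :=
  .seq (.loop 16 .size (.ite (.vec 8 (.succ (.var 16)))
      (.assign 21 (.var 16) (.sub (.vec 8 (.succ (.var 16))) (.const 1))
        (.add (.read 21 (.var 16) (.sub (.vec 8 (.succ (.var 16))) (.const 1))) (.const R))) .skip))
    (.set 22 (.succ (.var 22)))

/-- Find and count a matching for the outcome in the array `23`. -/
def scoreProg (R : ℕ) : Prog :=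
  .seq (fillArr 5 (.sub (.read 1 (.var 16) (.var 17))
      (.sub (.read 4 (.var 16) (.var 17)) (.read 23 (.var 16) (.var 17)))))
    (.seq auction (tallyProg R))

/-- Find and count a matching for a random outcome. -/
def sampleProg (l : List Bool) (R : ℕ) : Prog := .seq (drawProg l) (scoreProg R)

/-- Forget all matchings. -/
def resetProg : Prog := .seq (fillArr 21 (.const 0)) (.set 22 (.const 0))

/-- Query the edges that are frequent in the matchings. -/
def updateProg : Prog :=
  fillArr 4 (.sub (.read 1 (.var 16) (.var 17)) (.sub (.const 1)
    (.add (.add (.read 4 (.var 16) (.var 17)) (.sub (.read 21 (.var 16) (.var 17)) (.var 22)))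
      (.sub (.read 21 (.var 17) (.var 16)) (.var 22)))))

/-- Sample `c * (n + 1) ^ 2` matchings. -/
def samplesProg (l : List Bool) (R c : ℕ) : Prog :=
  .loop 26 (.const c) (.loop 27 (.succ .size) (.loop 28 (.succ .size) (sampleProg l R)))

/-- Sample matchings, and query the frequent edges. -/
def stepProg (l : List Bool) (R c : ℕ) : Prog :=
  .seq resetProg (.seq (samplesProg l R c) updateProg)

/-- Find the edges to be queried. -/
def queryProg (l : List Bool) (R c : ℕ) : Prog := .loop 29 (.const R) (stepProg l R c)

section Query

variable {n : ℕ} {G Q : SimpleGraph (Fin n)}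

open Classical in
theorem tallyProg_post {R : ℕ} {h : Fin n → Fin n → Prop} {m : Mem} (h0 : m 0 0 0 = n)
    (h8 : m 8 = auctionEnd h 8) :
    (tallyProg R).Post (fun m' =>
      (∀ u w : Fin n, m' 21 u w = m 21 u w + if auctionRule h u w then R else 0) ∧
      m' 22 0 0 = m 22 0 0 + 1 ∧ ∀ a, a ≠ 16 → a ≠ 21 → a ≠ 22 → m' a = m a) m := by
  refine Prog.Post.seq (P' := fun m' =>
      (∀ u w : Fin n, m' 21 u w = m 21 u w + if auctionRule h u w then R else 0) ∧
      ∀ a, a ≠ 16 → a ≠ 21 → m' a = m a) ?_ ?_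
  · refine Prog.Post.loop (fun k m' =>
      (∀ u w : Fin n, m' 21 u w =
        m 21 u w + if (u : ℕ) < k ∧ auctionRule h u w then R else 0) ∧
      ∀ a, a ≠ 16 → a ≠ 21 → m' a = m a) ⟨by simp, fun _ _ _ => rfl⟩ ?_ ?_
    · intro k hk m' ⟨hc, hf⟩
      simp only [Expr.val, h0] at hk
      have e8 : wr m' 16 0 0 k 8 = auctionEnd h 8 := by
        rw [wr_ne _ (by decide), hf 8 (by decide) (by decide), h8]
      have e16 : wr m' 16 0 0 k 16 0 0 = k := by simp [wr_apply]
      have e21 : wr m' 16 0 0 k 21 = m' 21 := wr_ne _ (by decide) _ _ _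
      refine Prog.Post.ite (fun hne => Prog.Post.assign ?_) (fun he => ?_)
      · simp only [Expr.val, e8, e16] at hne ⊢
        refine ⟨fun u w => ?_, fun a h1 h2 => ?_⟩
        · rw [wr_apply, e21]
          by_cases hu : (u : ℕ) = k
          · by_cases hw : (w : ℕ) = auctionEnd h 8 (k + 1) 0 - 1
            · have hr : auctionRule h u w := by
                rw [auctionRule, hu, hw]; omega
              rw [if_pos ⟨rfl, hu, hw⟩, ← hw, ← hu, hc, if_neg (by omega), if_pos ⟨by omega, hr⟩]
              rfl
            · have hr : ¬ auctionRule h u w := by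
                rw [auctionRule, hu]; omega
              rw [if_neg (fun hh => hw hh.2.2), hc, if_neg (fun hh => hr hh.2),
                if_neg (fun hh => hr hh.2)]
          · rw [if_neg (fun hh => hu hh.2.1), hc]
            have : (u : ℕ) < k + 1 ↔ (u : ℕ) < k := by omega
            simp only [this]
        · rw [wr_ne _ h2, wr_ne _ h1, hf a h1 h2]
      · simp only [Expr.val, e8, e16] at he
        refine ⟨fun u w => ?_, fun a h1 h2 => ?_⟩
        · rw [e21, hc]
          by_cases hu : (u : ℕ) = k
          · have hr : ¬ auctionRule h u w := by
              rw [auctionRule, hu]; omega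
            rw [if_neg (fun hh => hr hh.2), if_neg (fun hh => hr hh.2)]
          · have : (u : ℕ) < k + 1 ↔ (u : ℕ) < k := by omega
            simp only [this]
        · rw [wr_ne _ h1, hf a h1 h2]
    · simp only [Expr.val, h0, Fin.is_lt, true_and]
      exact fun _ h => h
  · rintro m' ⟨hc, hf⟩
    refine Prog.Post.assign ⟨fun u w => ?_, ?_, fun a h1 h2 h3 => ?_⟩
    · rw [wr_ne _ (by decide), hc]
    · simp [wr_apply, Expr.val, hf 22 (by decide) (by decide)]
    · rw [wr_ne _ h3, hf a h1 h2]

open Classical in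
/-- The memory during the search, when the edges of `Q` have been chosen. -/
structure QueryMem (G Q : SimpleGraph (Fin n)) (m : Mem) : Prop where
  size : m 0 = sizeArr n
  arr1 : m 1 = adjEntry G
  out : ∀ u w : Fin n, m 4 u w = if Q.Adj u w then 1 else 0
  mat : MatClean n m
  tidy : Tidy n m

theorem QueryMem.size_eq {m : Mem} (h : QueryMem G Q m) : m 0 0 0 = n := by
  rw [h.size]; simp [sizeArr]

theorem QueryMem.congr {m m' : Mem} (hm : QueryMem G Q m) (hf : ∀ a, a ≤ 15 → m' a = m a) :
    QueryMem G Q m' := by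
  refine ⟨?_, ?_, ?_, ?_, ?_⟩
  · rw [hf 0 (by omega), hm.size]
  · rw [hf 1 (by omega), hm.arr1]
  · rw [hf 4 (by omega)]; exact hm.out
  · intro i j hij; rw [hf 5 (by omega)]; exact hm.mat i j hij
  · exact hm.tidy.congr fun a _ h => hf a h

open Classical in
theorem scoreProg_post {R : ℕ} {m : Mem} {z : Fin n → Fin n → Bool} (hQ : Q ≤ G)
    (hm : QueryMem G Q m) (hz : HasDraw z m) :
    (scoreProg R).Post (fun m' => QueryMem G Q m' ∧
      (∀ u w : Fin n, m' 21 u w =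
        m 21 u w + if auctionRule (candidate G Q z) u w then R else 0) ∧
      m' 22 0 0 = m 22 0 0 + 1) m := by
  unfold scoreProg
  refine Prog.Post.seq (fillArr_post_rel (h := candidate G Q z) hm.size_eq hm.mat ?_) ?_
  · intro m' hf u w h16 h17
    simp only [Expr.val, h16, h17]
    rw [hf 1 (by decide) (by decide) (by decide), hf 4 (by decide) (by decide) (by decide),
      hf 23 (by decide) (by decide) (by decide), hm.arr1, hm.out, hz]
    have a1 := @hQ u w
    simp only [adjEntry, relMat, candidate, Fin.is_lt, exists_true_left, Fin.eta]
    by_cases b1 : G.Adj u w <;> by_cases b2 : Q.Adj u w <;> cases b3 : z u w <;> simp_all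
  · rintro m₁ ⟨h5, hf⟩
    refine Prog.Post.seq (auction_post
      ((hf 0 (by decide) (by decide) (by decide)).trans hm.size) h5
      (hm.tidy.congr fun a h1 h2 => hf a (by omega) (by omega) (by omega))) ?_
    rintro m₂ ⟨h8, ht, hf₂⟩
    have e0 : m₂ 0 = m 0 := by rw [hf₂ 0 (by omega), hf 0 (by decide) (by decide) (by decide)]
    refine Prog.Post.mono (tallyProg_post (R := R) (by rw [e0, hm.size_eq]) h8) ?_
    rintro m₃ ⟨h21, h22, hf₃⟩
    rw [hf₂ 22 (by omega), hf 22 (by decide) (by decide) (by decide)] at h22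
    rw [hf₂ 21 (by omega), hf 21 (by decide) (by decide) (by decide)] at h21
    refine ⟨⟨?_, ?_, ?_, ?_, ?_⟩, h21, h22⟩
    · rw [hf₃ 0 (by decide) (by decide) (by decide), e0, hm.size]
    · rw [hf₃ 1 (by decide) (by decide) (by decide), hf₂ 1 (by omega),
        hf 1 (by decide) (by decide) (by decide), hm.arr1]
    · rw [hf₃ 4 (by decide) (by decide) (by decide), hf₂ 4 (by omega),
        hf 4 (by decide) (by decide) (by decide)]
      exact hm.out
    · refine matClean_relMat (h := candidate G Q z) ?_
      rw [hf₃ 5 (by decide) (by decide) (by decide), hf₂ 5 (by omega), h5]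
    · exact ht.congr fun a h1 h2 => hf₃ a (by omega) (by omega) (by omega)

/-- The memory after `t` samples. -/
structure TallyMem (G Q : SimpleGraph (Fin n)) (R t : ℕ) (m : Mem) : Prop where
  mem : QueryMem G Q m
  total : m 22 0 0 = t
  row : ∀ u : Fin n, ∑ w : Fin n, m 21 u w ≤ R * t
  col : ∀ w : Fin n, ∑ u : Fin n, m 21 u w ≤ R * t

theorem TallyMem.congr {R t : ℕ} {m m' : Mem} (hm : TallyMem G Q R t m)
    (hf : ∀ a, a ≤ 22 → a ≠ 16 → a ≠ 17 → m' a = m a) : TallyMem G Q R t m' := by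
  refine ⟨hm.mem.congr fun a ha => hf a (by omega) (by omega) (by omega), ?_, ?_, ?_⟩
  · rw [hf 22 (by decide) (by decide) (by decide), hm.total]
  · rw [hf 21 (by decide) (by decide) (by decide)]; exact hm.row
  · rw [hf 21 (by decide) (by decide) (by decide)]; exact hm.col

theorem sampleProg_post {R t : ℕ} {m : Mem} (l : List Bool) (hQ : Q ≤ G)
    (hm : TallyMem G Q R t m) : (sampleProg l R).Post (TallyMem G Q R (t + 1)) m := by
  classical
  refine Prog.Post.seq (drawProg_post l hm.mem.size_eq) ?_
  rintro m' ⟨hf, z, hz⟩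
  have hm' : TallyMem G Q R t m' := hm.congr fun a h1 h2 h3 =>
    hf a h2 h3 (by omega) (by omega) (by omega)
  refine Prog.Post.mono (scoreProg_post hQ hm'.mem hz) ?_
  rintro m'' ⟨h1, h2, h3⟩
  have hM := isRelMatching_auctionRule (candidate G Q z)
  refine ⟨h1, by rw [h3, hm'.total], fun u => ?_, fun w => ?_⟩
  · simp only [h2, Finset.sum_add_distrib, mul_add, mul_one]
    refine add_le_add (hm'.row u) ?_
    have h4 := hM.sum_row_le u
    have h5 : (∑ w, if auctionRule (candidate G Q z) u w then R else 0) =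
        R * ∑ w, if auctionRule (candidate G Q z) u w then 1 else 0 := by
      simp only [Finset.mul_sum, mul_ite, mul_one, mul_zero]
    have h6 : (∑ w, if auctionRule (candidate G Q z) u w then 1 else 0) ≤ 1 := by exact_mod_cast h4
    rw [h5]
    exact (Nat.mul_le_mul_left R h6).trans (by omega)
  · simp only [h2, Finset.sum_add_distrib, mul_add, mul_one]
    refine add_le_add (hm'.col w) ?_
    have h4 := hM.sum_col_le w
    have h5 : (∑ u, if auctionRule (candidate G Q z) u w then R else 0) =
        R * ∑ u, if auctionRule (candidate G Q z) u w then 1 else 0 := by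
      simp only [Finset.mul_sum, mul_ite, mul_one, mul_zero]
    have h6 : (∑ u, if auctionRule (candidate G Q z) u w then 1 else 0) ≤ 1 := by exact_mod_cast h4
    rw [h5]
    exact (Nat.mul_le_mul_left R h6).trans (by omega)

/-- The deviation of the counts from their expectations. -/
noncomputable def deviation (R : ℕ) (X : Fin n → Fin n → ℝ) (m : Mem) : ℝ :=
  ∑ u : Fin n, ∑ w : Fin n, ((m 21 u w : ℝ) / R - m 22 0 0 * X u w) ^ 2

theorem deviation_congr {R : ℕ} {X : Fin n → Fin n → ℝ} {m m' : Mem} (h21 : m' 21 = m 21)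
    (h22 : m' 22 = m 22) : deviation R X m' = deviation R X m := by
  simp only [deviation, h21, h22]

-- The potential is a sum of squared deviations. A sample adds to each cell an independent centred
-- indicator of variance at most `X u w`, and the row sums of `X` are at most `1`, so the total
-- grows by at most `n`.
open Classical in
theorem sampleProg_avg_le {R t : ℕ} {m : Mem} (l : List Bool) (hQ : Q ≤ G) (hR : 0 < R)
    (hm : TallyMem G Q R t m) :
    (sampleProg l R).avg (deviation R (selectProb auctionRule (dyadic l) G Q)) m ≤
      deviation R (selectProb auctionRule (dyadic l) G Q) m + n := by
  set X := selectProb auctionRule (dyadic l) G Q with hX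
  have hR' : (R : ℝ) ≠ 0 := by exact_mod_cast hR.ne'
  have h0 := dyadic_nonneg l
  have h1 := dyadic_le_one l
  have key : (sampleProg l R).avg (deviation R X) m ≤ bernE (dyadic l) (fun z =>
      ∑ u : Fin n, ∑ w : Fin n, ((m 21 u w : ℝ) / R - t * X u w +
        ((if auctionRule (candidate G Q z) u w then 1 else 0) - X u w)) ^ 2) := by
    refine drawProg_avg_le l hm.mem.size_eq fun m' z hf hz => ?_
    have hm' : TallyMem G Q R t m' := hm.congr fun a h1 h2 h3 =>
      hf a h2 h3 (by omega) (by omega) (by omega)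
    have h21 : m' 21 = m 21 := hf 21 (by decide) (by decide) (by decide) (by decide) (by decide)
    refine Prog.Post.avg_le ((scoreProg_post hQ hm'.mem hz).mono ?_)
    rintro m'' ⟨-, g21, g22⟩
    refine le_of_eq (Finset.sum_congr rfl fun u _ => Finset.sum_congr rfl fun w _ => ?_)
    rw [g21, g22, hm'.total, h21]
    congr 1
    by_cases hr : auctionRule (candidate G Q z) u w
    · simp only [hr, if_true]
      push_cast
      field_simp
      ring
    · simp only [hr, if_false]
      push_cast
      ring
  refine key.trans ?_
  unfold bernE
  rw [prodE_sum]
  have hcell : ∀ u w : Fin n, prodE (fun _ => rowWeight (dyadic l)) (fun z =>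
      ((m 21 u w : ℝ) / R - t * X u w +
        ((if auctionRule (candidate G Q z) u w then 1 else 0) - X u w)) ^ 2) ≤
      ((m 21 u w : ℝ) / R - t * X u w) ^ 2 + X u w := by
    intro u w
    set y := (m 21 u w : ℝ) / R - t * X u w
    have e : ∀ z : Fin n → Fin n → Bool,
        (y + ((if auctionRule (candidate G Q z) u w then 1 else 0) - X u w)) ^ 2 =
        (y - X u w) ^ 2 + (2 * (y - X u w) + 1) *
          (if auctionRule (candidate G Q z) u w then 1 else 0) := by
      intro z
      split_ifs <;> ring
    simp only [e]
    rw [prodE_add, prodE_mul_left, prodE_const (fun _ => sum_rowWeight _)]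
    change (y - X u w) ^ 2 + (2 * (y - X u w) + 1) * X u w ≤ _
    nlinarith [sq_nonneg (X u w)]
  calc _ ≤ ∑ u : Fin n, ∑ w : Fin n, (((m 21 u w : ℝ) / R - t * X u w) ^ 2 + X u w) := by
        refine Finset.sum_le_sum fun u _ => ?_
        rw [prodE_sum]
        exact Finset.sum_le_sum fun w _ => hcell u w
    _ = deviation R X m + ∑ u : Fin n, ∑ w : Fin n, X u w := by
        simp only [Finset.sum_add_distrib, deviation, hm.total]
    _ ≤ deviation R X m + ∑ u : Fin n, 1 := by
        gcongr with u
        exact sum_row_selectProb_le isMatchingRule_auctionRule h0 h1 u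
    _ = _ := by simp

end Query

/-! ### Counting loops -/

theorem Prog.Post.loop_count {a b : ℕ} {e : Expr} {c : Prog} {m : Mem} {J : ℕ → Mem → Prop} {t : ℕ}
    (hw : ∀ t m k, J t m → J t (wr m a 0 0 k)) (hc : ∀ t m, J t m → c.Post (J (t + b)) m)
    (hm : J t m) : (Prog.loop a e c).Post (J (t + e.val m * b)) m := by
  refine Prog.Post.loop (fun k => J (t + k * b)) (by simpa using hm) ?_ fun _ h => h
  intro k _ m' hm'
  rw [add_mul, one_mul, ← add_assoc]
  exact hc _ _ (hw _ _ k hm')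

theorem Prog.avg_add_const (c : Prog) (f : Mem → ℝ) (x : ℝ) (m : Mem) :
    c.avg (fun m' => f m' + x) m = c.avg f m + x := by
  induction c generalizing f m with
  | skip => rfl
  | assign => rfl
  | flip a i j => simp only [Prog.avg]; ring
  | seq c d hc hd =>
    simp only [Prog.avg]
    rw [show d.avg (fun m' => f m' + x) = fun m' => d.avg f m' + x from funext (hd f), hc]
  | ite e c d hc hd =>
    simp only [Prog.avg, hc, hd]
    split_ifs <;> rfl
  | loop a e c hc =>
    simp only [Prog.avg]
    generalize e.val m = K
    induction K generalizing f with
    | zero => rfl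
    | succ K ih =>
      simp only [loopAvg, hc]
      exact ih _

theorem Prog.avg_mul_const (c : Prog) (f : Mem → ℝ) (x : ℝ) (m : Mem) :
    c.avg (fun m' => x * f m') m = x * c.avg f m := by
  induction c generalizing f m with
  | skip => rfl
  | assign => rfl
  | flip a i j => simp only [Prog.avg]; ring
  | seq c d hc hd =>
    simp only [Prog.avg]
    rw [show d.avg (fun m' => x * f m') = fun m' => x * d.avg f m' from funext (hd f), hc]
  | ite e c d hc hd =>
    simp only [Prog.avg, hc, hd]
    split_ifs <;> rfl
  | loop a e c hc =>
    simp only [Prog.avg]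
    generalize e.val m = K
    induction K generalizing f with
    | zero => rfl
    | succ K ih =>
      simp only [loopAvg, hc]
      exact ih _

theorem Prog.avg_loop_count_le {a b : ℕ} {e : Expr} {c : Prog} {m : Mem} {J : ℕ → Mem → Prop}
    {t : ℕ} {Φ : Mem → ℝ} {x : ℝ} (hw : ∀ t m k, J t m → J t (wr m a 0 0 k))
    (hc : ∀ t m, J t m → c.Post (J (t + b)) m) (hΦ : ∀ m k, Φ (wr m a 0 0 k) = Φ m)
    (hx : ∀ t m, J t m → c.avg Φ m ≤ Φ m + x) (hm : J t m) :
    (Prog.loop a e c).avg Φ m ≤ Φ m + e.val m * x := by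
  have h := Prog.avg_loop_le (a := a) (e := e) (c := c) (m := m) (f := Φ)
    (fun k => J (t + k * b)) (fun k m' => Φ m' + ((e.val m : ℝ) - k) * x) (by simpa using hm)
    ?_ ?_ ?_
  · simpa using h
  · intro k _ m' hm'
    rw [add_mul, one_mul, ← add_assoc]
    exact hc _ _ (hw _ _ k hm')
  · intro k _ m' hm'
    rw [Prog.avg_add_const]
    have h1 := hx _ _ (hw _ _ k hm')
    rw [hΦ] at h1
    push_cast
    linarith
  · intro m' _
    simp

/-! ### Sample frequencies, degrees, and the failure probability of the search. -/

section Query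

variable {n : ℕ} {G Q : SimpleGraph (Fin n)}

theorem samplesProg_spec {R c : ℕ} {m : Mem} (l : List Bool) (hQ : Q ≤ G) (hR : 0 < R)
    (hm : TallyMem G Q R 0 m) :
    (samplesProg l R c).Post (TallyMem G Q R (c * ((n + 1) * (n + 1)))) m ∧
    (samplesProg l R c).avg (deviation R (selectProb auctionRule (dyadic l) G Q)) m ≤
      deviation R (selectProb auctionRule (dyadic l) G Q) m + (c * ((n + 1) * (n + 1)) : ℕ) * n := by
  set Φ := deviation R (selectProb auctionRule (dyadic l) G Q) with hΦ
  have hw : ∀ a, 22 < a → ∀ t m k, TallyMem G Q R t m → TallyMem G Q R t (wr m a 0 0 k) :=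
    fun a ha t m k h => h.congr fun b h1 _ _ => wr_ne _ (by omega) _ _ _
  have hwΦ : ∀ a, 22 < a → ∀ m k, Φ (wr m a 0 0 k) = Φ m := fun a ha m k =>
    deviation_congr (wr_ne _ (by omega) _ _ _) (wr_ne _ (by omega) _ _ _)
  have val : ∀ t m, TallyMem G Q R t m → (Expr.succ .size).val m = n + 1 := fun t m h => by
    simp [Expr.val, h.mem.size_eq]
  have p1 : ∀ t m, TallyMem G Q R t m → (sampleProg l R).Post (TallyMem G Q R (t + 1)) m :=
    fun t m h => sampleProg_post l hQ h
  have a1 : ∀ t m, TallyMem G Q R t m → (sampleProg l R).avg Φ m ≤ Φ m + n :=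
    fun t m h => sampleProg_avg_le l hQ hR h
  have p2 : ∀ t m, TallyMem G Q R t m → (Prog.loop 28 (.succ .size) (sampleProg l R)).Post
      (TallyMem G Q R (t + (n + 1))) m := fun t m h => by
    have := Prog.Post.loop_count (e := .succ .size) (hw 28 (by decide)) p1 h
    rwa [val t m h, mul_one] at this
  have a2 : ∀ t m, TallyMem G Q R t m → (Prog.loop 28 (.succ .size) (sampleProg l R)).avg Φ m ≤
      Φ m + ((n + 1 : ℕ) : ℝ) * n := fun t m h => by
    have := Prog.avg_loop_count_le (e := .succ .size) (hw 28 (by decide)) p1 (hwΦ 28 (by decide))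
      a1 h
    rwa [val t m h] at this
  have p3 : ∀ t m, TallyMem G Q R t m → (Prog.loop 27 (.succ .size)
      (Prog.loop 28 (.succ .size) (sampleProg l R))).Post
      (TallyMem G Q R (t + (n + 1) * (n + 1))) m := fun t m h => by
    have := Prog.Post.loop_count (e := .succ .size) (hw 27 (by decide)) p2 h
    rwa [val t m h] at this
  have a3 : ∀ t m, TallyMem G Q R t m → (Prog.loop 27 (.succ .size)
      (Prog.loop 28 (.succ .size) (sampleProg l R))).avg Φ m ≤
      Φ m + ((n + 1 : ℕ) : ℝ) * (((n + 1 : ℕ) : ℝ) * n) := fun t m h => by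
    have := Prog.avg_loop_count_le (e := .succ .size) (hw 27 (by decide)) p2 (hwΦ 27 (by decide))
      a2 h
    rwa [val t m h] at this
  constructor
  · have := Prog.Post.loop_count (e := .const c) (hw 26 (by decide)) p3 hm
    rwa [zero_add] at this
  · have := Prog.avg_loop_count_le (e := .const c) (hw 26 (by decide)) p3 (hwΦ 26 (by decide))
      a3 hm
    refine this.trans (le_of_eq ?_)
    simp only [Expr.val]
    push_cast
    ring

theorem resetProg_post {R : ℕ} {m : Mem} (X : Fin n → Fin n → ℝ) (hm : QueryMem G Q m) :
    resetProg.Post (fun m' => TallyMem G Q R 0 m' ∧ deviation R X m' = 0) m := by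
  refine Prog.Post.seq (fillArr_post (F := fun _ _ => 0) hm.size_eq (by decide) (by decide)
    (by decide) fun m' _ i _ j _ _ _ _ => rfl) ?_
  rintro m' ⟨h21, hf⟩
  have hz : ∀ u w : Fin n, wr m' 22 0 0 0 21 u w = 0 := fun u w => by
    rw [wr_ne _ (by decide), h21]; simp
  refine Prog.Post.assign ⟨⟨?_, by simp [wr_apply, Expr.val], ?_, ?_⟩, ?_⟩
  · exact hm.congr fun a ha => by
      rw [wr_ne _ (by omega), hf a (by omega) (by omega) (by omega)]
  · intro u; simp only [Expr.val, hz]; simp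
  · intro u; simp only [Expr.val, hz]; simp
  · simp only [deviation, Expr.val, hz]
    simp [wr_apply]

/-- Add the edges of `G` that were counted more than `m 22 0 0` times. -/
def addFrequent (G Q : SimpleGraph (Fin n)) (m : Mem) : SimpleGraph (Fin n) where
  Adj u w := G.Adj u w ∧ (Q.Adj u w ∨ m 22 0 0 < m 21 u w ∨ m 22 0 0 < m 21 w u)
  symm := ⟨fun u w h => ⟨h.1.symm, by rw [Q.adj_comm]; tauto⟩⟩
  loopless := ⟨fun u h => G.loopless.irrefl u h.1⟩

theorem updateProg_post {m : Mem} (hQ : Q ≤ G) (hm : QueryMem G Q m) :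
    updateProg.Post (QueryMem G (addFrequent G Q m)) m := by
  classical
  refine (fillArr_post (F := relMat (addFrequent G Q m).Adj) hm.size_eq (by decide) (by decide)
    (by decide) ?_).mono ?_
  · intro m' hf i hi j hj h16 h17 h4
    -- Truncated subtraction encodes the logic: `x - y` is nonzero iff `y < x`, sums are
    -- disjunctions, and `1 - (1 - s)` truncates `s` to `0` or `1`.
    simp only [Expr.val, h16, h17, h4]
    rw [hf 1 (by decide) (by decide) (by decide), hf 21 (by decide) (by decide) (by decide),
      hf 22 (by decide) (by decide) (by decide), hm.arr1, hm.out ⟨i, hi⟩ ⟨j, hj⟩]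
    have a1 := @hQ ⟨i, hi⟩ ⟨j, hj⟩
    simp only [adjEntry, relMat, addFrequent, hi, hj, exists_true_left]
    by_cases b1 : G.Adj ⟨i, hi⟩ ⟨j, hj⟩
    · by_cases b2 : Q.Adj ⟨i, hi⟩ ⟨j, hj⟩
      · simp [b1, b2]
        omega
      · simp only [b1, b2, if_true, if_false, true_and, false_or]
        split_ifs with b3
        · omega
        · omega
    · simp [b1]
  · rintro m' ⟨h4, hf⟩
    refine ⟨?_, ?_, ?_, ?_, ?_⟩
    · rw [hf 0 (by decide) (by decide) (by decide), hm.size]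
    · rw [hf 1 (by decide) (by decide) (by decide), hm.arr1]
    · intro u w
      rw [h4, if_pos ⟨u.2, w.2⟩]
      simp [relMat]
    · intro i j hij; rw [hf 5 (by decide) (by decide) (by decide)]; exact hm.mat i j hij
    · exact hm.tidy.congr fun a h1 h2 => hf a (by omega) (by omega) (by omega)

theorem le_addFrequent (hQ : Q ≤ G) (m : Mem) : Q ≤ addFrequent G Q m := fun _ _ h =>
  ⟨hQ h, Or.inl h⟩

theorem addFrequent_le (m : Mem) : addFrequent G Q m ≤ G := fun _ _ h => h.1

/-- Counts are stored with multiplicity `R`, so `t < f w` says that the frequency exceeds `1/R`.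
Frequencies in a row add up to at most `1`, so this happens at most `R` times. -/
theorem card_frequent_le {R t : ℕ} {f : Fin n → ℕ} (h : ∑ w, f w ≤ R * t) :
    (Finset.univ.filter fun w => t < f w).card ≤ R := by
  have h1 : (Finset.univ.filter fun w => t < f w).card * (t + 1) ≤ ∑ w, f w := by
    rw [← smul_eq_mul]
    refine (Finset.card_nsmul_le_sum _ f (t + 1) fun w hw => ?_).trans
      (Finset.sum_le_sum_of_subset (Finset.filter_subset _ _))
    exact (Finset.mem_filter.1 hw).2
  by_contra hc
  have h2 := Nat.mul_le_mul_right (t + 1) (Nat.succ_le_of_lt (not_le.1 hc))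
  nlinarith

theorem ncard_addFrequent_le {R t D : ℕ} {m : Mem} (hm : TallyMem G Q R t m)
    (hD : ∀ v, (Q.neighborSet v).ncard ≤ D) (v : Fin n) :
    ((addFrequent G Q m).neighborSet v).ncard ≤ D + 2 * R := by
  classical
  have h1 : (addFrequent G Q m).neighborSet v ⊆ (Q.neighborSet v ∪
      ((Finset.univ.filter fun w : Fin n => t < m 21 v w : Finset (Fin n)) : Set (Fin n))) ∪
      ((Finset.univ.filter fun w : Fin n => t < m 21 w v : Finset (Fin n)) : Set (Fin n)) := by
    rintro w ⟨_, hw⟩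
    rw [hm.total] at hw
    simp only [Set.mem_union, SimpleGraph.mem_neighborSet, Finset.coe_filter, Finset.mem_univ,
      true_and, Set.mem_ofPred_eq]
    tauto
  refine (Set.ncard_le_ncard h1 (Set.toFinite _)).trans ?_
  refine (Set.ncard_union_le _ _).trans ?_
  have h2 := Set.ncard_union_le (Q.neighborSet v)
    ((Finset.univ.filter fun w : Fin n => t < m 21 v w : Finset (Fin n)) : Set (Fin n))
  rw [Set.ncard_coe_finset] at h2 ⊢
  have h3 := card_frequent_le (hm.row v)
  have h4 := card_frequent_le (hm.col v)
  have h5 := hD v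
  omega

/-- The threshold `1/R` is half of the bound `2/R` required of a good step. A missed edge of
probability above `2/R` has frequency at most `1/R`, so its count alone deviates by at least `t/R`.
-/
theorem goodStep_addFrequent {S : (Fin n → Fin n → Prop) → Fin n → Fin n → Prop} {R t : ℕ} {p : ℝ}
    {m : Mem} (hQ : Q ≤ G) (hR : 0 < R) (ht : 0 < t) (hm : TallyMem G Q R t m)
    (hdev : deviation R (selectProb S p G Q) m < ((t : ℝ) / R) ^ 2) :
    GoodStep S p R G Q (addFrequent G Q m) := by
  refine ⟨le_addFrequent hQ m, fun u w huw hn => ?_⟩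
  by_contra hc
  push Not at hc
  have hR' : (0 : ℝ) < R := by exact_mod_cast hR
  have ht' : (0 : ℝ) < t := by exact_mod_cast ht
  have h1 : m 21 u w ≤ t := by
    by_contra hlt
    exact hn ⟨huw, Or.inr (Or.inl (by rw [hm.total]; omega))⟩
  have h1' : (m 21 u w : ℝ) / R ≤ t / R := by
    gcongr
  have h2 : (t : ℝ) * (2 / R) ≤ t * selectProb S p G Q u w := by gcongr
  have h3 : ((t : ℝ) / R) ≤ t * selectProb S p G Q u w - (m 21 u w : ℝ) / R := by
    have : (t : ℝ) * (2 / R) = t / R + t / R := by ring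
    linarith
  have h4 : ((t : ℝ) / R) ^ 2 ≤ ((m 21 u w : ℝ) / R - m 22 0 0 * selectProb S p G Q u w) ^ 2 := by
    rw [hm.total, ← neg_sq ((m 21 u w : ℝ) / R - t * selectProb S p G Q u w), neg_sub]
    exact pow_le_pow_left₀ (by positivity) h3 2
  have h5 : ((m 21 u w : ℝ) / R - m 22 0 0 * selectProb S p G Q u w) ^ 2 ≤
      deviation R (selectProb S p G Q) m := by
    unfold deviation
    refine le_trans ?_ (Finset.single_le_sum (f := fun u : Fin n => ∑ w : Fin n,
      ((m 21 u w : ℝ) / R - m 22 0 0 * selectProb S p G Q u w) ^ 2)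
      (fun u _ => Finset.sum_nonneg fun w _ => sq_nonneg _) (Finset.mem_univ u))
    exact Finset.single_le_sum (f := fun w : Fin n =>
      ((m 21 u w : ℝ) / R - m 22 0 0 * selectProb S p G Q u w) ^ 2)
      (fun w _ => sq_nonneg _) (Finset.mem_univ w)
  linarith

/-- The graph of the chosen edges. -/
def memGraph (n : ℕ) (m : Mem) : SimpleGraph (Fin n) := outputGraph n ⟨m, fun _ => false⟩

theorem QueryMem.memGraph_eq {m : Mem} (hm : QueryMem G Q m) : memGraph n m = Q := by
  classical
  ext u w
  simp only [memGraph, outputGraph, SimpleGraph.fromRel_adj, hm.out, Q.adj_comm w u, or_self]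
  by_cases h : Q.Adj u w
  · simp [h, h.ne]
  · simp [h]

/-- The state between two steps. -/
structure StepMem (G : SimpleGraph (Fin n)) (D : ℕ) (m : Mem) : Prop where
  mem : QueryMem G (memGraph n m) m
  le : memGraph n m ≤ G
  degree : ∀ v, ((memGraph n m).neighborSet v).ncard ≤ D

theorem stepMem_addFrequent {R t D : ℕ} {m m' : Mem} (hm : TallyMem G Q R t m)
    (hD : ∀ v, (Q.neighborSet v).ncard ≤ D) (hm' : QueryMem G (addFrequent G Q m) m') :
    StepMem G (D + 2 * R) m' := by
  have e := hm'.memGraph_eq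
  refine ⟨by rw [e]; exact hm', by rw [e]; exact addFrequent_le m, ?_⟩
  rw [e]
  exact ncard_addFrequent_le hm hD

theorem stepProg_post {R c D : ℕ} {m : Mem} (l : List Bool) (hR : 0 < R) (hm : StepMem G D m) :
    (stepProg l R c).Post (StepMem G (D + 2 * R)) m := by
  refine Prog.Post.seq (resetProg_post (R := R) (fun _ _ => 0) hm.mem) ?_
  rintro m₁ ⟨hm₁, -⟩
  refine Prog.Post.seq (samplesProg_spec l hm.le hR hm₁).1 ?_
  intro m₂ hm₂
  refine Prog.Post.mono (updateProg_post hm.le hm₂.mem) ?_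
  exact fun m₃ hm₃ => stepMem_addFrequent hm₂ hm.degree hm₃

-- Markov's inequality for the deviation: its mean after `N = c (n + 1)²` samples is at most `N n`,
-- while failure requires `(N/R)²`.
open Classical in
theorem stepProg_avg_le {R c D : ℕ} {m : Mem} (l : List Bool) (hR : 0 < R) (hc : 0 < c)
    (hm : StepMem G D m) :
    (stepProg l R c).avg (fun m' => if GoodStep auctionRule (dyadic l) R G (memGraph n m)
      (memGraph n m') then 0 else 1) m ≤ (R : ℝ) ^ 2 / (c * (n + 1)) := by
  set Q := memGraph n m with hQdef
  set X := selectProb auctionRule (dyadic l) G Q with hX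
  set N := c * ((n + 1) * (n + 1)) with hN
  have hN0 : 0 < N := by positivity
  have hN' : (0 : ℝ) < N := by exact_mod_cast hN0
  have hR' : (0 : ℝ) < R := by exact_mod_cast hR
  have hc' : (0 : ℝ) < c := by exact_mod_cast hc
  have hu : ∀ m₂, TallyMem G Q R N m₂ → updateProg.avg (fun m' => if GoodStep auctionRule (dyadic l)
      R G Q (memGraph n m') then (0 : ℝ) else 1) m₂ ≤ ((R : ℝ) / N) ^ 2 * deviation R X m₂ := by
    intro m₂ hm₂
    refine Prog.Post.avg_le ((updateProg_post hm.le hm₂.mem).mono fun m₃ hm₃ => ?_)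
    rw [hm₃.memGraph_eq]
    have hdev0 : 0 ≤ deviation R X m₂ := Finset.sum_nonneg fun u _ => Finset.sum_nonneg fun w _ =>
      sq_nonneg _
    split_ifs with hg
    · positivity
    · have h1 : ((N : ℝ) / R) ^ 2 ≤ deviation R X m₂ := by
        by_contra hlt
        exact hg (goodStep_addFrequent hm.le hR hN0 hm₂ (not_le.1 hlt))
      calc (1 : ℝ) = ((R : ℝ) / N) ^ 2 * ((N : ℝ) / R) ^ 2 := by field_simp
        _ ≤ _ := by gcongr
  have hs : ∀ m₁, TallyMem G Q R 0 m₁ ∧ deviation R X m₁ = 0 →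
      (Prog.seq (samplesProg l R c) updateProg).avg (fun m' => if GoodStep auctionRule (dyadic l)
      R G Q (memGraph n m') then (0 : ℝ) else 1) m₁ ≤ (R : ℝ) ^ 2 / (c * (n + 1)) := by
    rintro m₁ ⟨hm₁, hd⟩
    obtain ⟨q1, q2⟩ := samplesProg_spec (c := c) l hm.le hR hm₁
    refine (Prog.avg_seq_le (q1.mono hu)).trans ?_
    rw [Prog.avg_mul_const]
    rw [← hX, ← hN, hd, zero_add] at q2
    calc _ ≤ ((R : ℝ) / N) ^ 2 * ((N : ℝ) * n) := by gcongr
      _ = (R : ℝ) ^ 2 * n / N := by field_simp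
      _ ≤ (R : ℝ) ^ 2 * (n + 1) / N := by gcongr; linarith
      _ = _ := by
        rw [hN]; push_cast; field_simp
  exact (Prog.avg_seq_le (g := fun _ => (R : ℝ) ^ 2 / (c * (n + 1)))
    ((resetProg_post (R := R) X hm.mem).mono hs)).trans_eq (Prog.avg_const _ _ _)

theorem queryProg_post {R c : ℕ} {m : Mem} (l : List Bool) (hR : 0 < R) (hm : StepMem G 0 m) :
    (queryProg l R c).Post (StepMem G (R * (2 * R))) m := by
  refine Prog.Post.loop (fun k => StepMem G (k * (2 * R))) (by simpa using hm) ?_ fun _ h => h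
  intro k _ m' hm'
  rw [add_mul, one_mul]
  refine stepProg_post l hR ?_
  have e4 : wr m' 29 0 0 k 4 = m' 4 := wr_ne _ (by decide) _ _ _
  have eg : memGraph n (wr m' 29 0 0 k) = memGraph n m' := by
    simp only [memGraph, outputGraph, e4]
  exact ⟨by rw [eg]; exact hm'.mem.congr fun a ha => wr_ne _ (by omega) _ _ _, by
    rw [eg]; exact hm'.le, by rw [eg]; exact hm'.degree⟩

-- A union bound over the `R` steps. The potential is the indicator that the chain has already
-- broken plus the failure budget of the remaining steps.
open Classical in
theorem queryProg_avg_le {R c : ℕ} {m : Mem} (l : List Bool) (hR : 0 < R) (hc : 0 < c)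
    (hm : StepMem G 0 m) (hbot : memGraph n m = ⊥) :
    (queryProg l R c).avg (fun m' => if GoodChain auctionRule (dyadic l) R G R (memGraph n m')
      then 0 else 1) m ≤ (R : ℝ) ^ 3 / (c * (n + 1)) := by
  set y := (R : ℝ) ^ 2 / (c * (n + 1)) with hy
  have hy0 : 0 ≤ y := by positivity
  have hwr : ∀ (D : ℕ) (m' : Mem) (k : ℕ), StepMem G D m' → StepMem G D (wr m' 29 0 0 k) ∧
      memGraph n (wr m' 29 0 0 k) = memGraph n m' := by
    intro D m' k hm'
    have e4 : wr m' 29 0 0 k 4 = m' 4 := wr_ne _ (by decide) _ _ _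
    have eg : memGraph n (wr m' 29 0 0 k) = memGraph n m' := by
      simp only [memGraph, outputGraph, e4]
    exact ⟨⟨by rw [eg]; exact hm'.mem.congr fun a ha => wr_ne _ (by omega) _ _ _, by
      rw [eg]; exact hm'.le, by rw [eg]; exact hm'.degree⟩, eg⟩
  have h := Prog.avg_loop_le (a := 29) (e := .const R) (c := stepProg l R c) (m := m)
    (f := fun m' => if GoodChain auctionRule (dyadic l) R G R (memGraph n m') then (0 : ℝ) else 1)
    (fun k m' => StepMem G (k * (2 * R)) m')
    (fun k m' => (if GoodChain auctionRule (dyadic l) R G k (memGraph n m') then (0 : ℝ) else 1) +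
      ((R : ℝ) - k) * y) (by simpa using hm) ?_ ?_ ?_
  · refine h.trans (le_of_eq ?_)
    have h0 : GoodChain (auctionRule : (Fin n → Fin n → Prop) → Fin n → Fin n → Prop)
        (dyadic l) R G 0 (memGraph n m) := hbot
    simp only [h0, if_true, hy]
    push_cast
    ring
  · intro k _ m' hm'
    rw [add_mul, one_mul]
    exact stepProg_post l hR (hwr _ _ k hm').1
  · intro k _ m' hm'
    rw [Prog.avg_add_const]
    obtain ⟨h1, h2⟩ := hwr _ _ k hm'
    suffices hs : (stepProg l R c).avg (fun m' => if GoodChain auctionRule (dyadic l) R G (k + 1)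
        (memGraph n m') then (0 : ℝ) else 1) (wr m' 29 0 0 k) ≤
        (if GoodChain auctionRule (dyadic l) R G k (memGraph n m') then (0 : ℝ) else 1) + y by
      push_cast
      linarith
    by_cases hg : GoodChain auctionRule (dyadic l) R G k (memGraph n m')
    · rw [if_pos hg, zero_add]
      refine le_trans ?_ (stepProg_avg_le l hR hc h1)
      refine Prog.Post.avg_mono ((stepProg_post (c := c) l hR h1).mono fun m'' _ => ?_)
      rw [h2]
      by_cases hs : GoodStep auctionRule (dyadic l) R G (memGraph n m') (memGraph n m'')
      · have : GoodChain auctionRule (dyadic l) R G (k + 1) (memGraph n m'') := ⟨_, hg, hs⟩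
        simp only [this, if_true]
        split_ifs <;> norm_num
      · rw [if_neg hs]
        split_ifs <;> norm_num
    · rw [if_neg hg]
      refine Prog.Post.avg_le ((stepProg_post (c := c) l hR h1).mono fun m'' _ => ?_)
      split_ifs <;> linarith
  · intro m' _
    rw [show (Expr.const R).val m = R from rfl]
    simp

theorem stepMem_graphInput (G : SimpleGraph (Fin n)) (ω : ℕ → Bool) :
    StepMem G 0 (graphInput G ω).mem ∧ memGraph n (graphInput G ω).mem = ⊥ := by
  classical
  have hm : QueryMem G ⊥ (graphInput G ω).mem := by
    refine ⟨rfl, rfl, fun u w => by simp [graphInput], fun i j _ => rfl, ?_, ?_⟩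
    · intro i j _; exact ⟨rfl, rfl, rfl⟩
    · intro a h1 h2 i j _
      interval_cases a <;> rfl
  have e := hm.memGraph_eq
  refine ⟨⟨by rw [e]; exact hm, by rw [e]; exact bot_le, ?_⟩, e⟩
  rw [e]
  intro v
  simp

end Query

/-! ### Syntactic checks for the query program: loop bounds, use of coins, depth. -/

theorem coinProg_bounded (l : List Bool) : (coinProg l).Bounded := by
  induction l with
  | nil => simp [coinProg, Prog.Bounded]
  | cons b l ih => simp [coinProg, Prog.Bounded, ih]

theorem coinProg_uniform (l : List Bool) : (coinProg l).Uniform := by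
  induction l with
  | nil => simp [coinProg, Prog.Uniform]
  | cons b l ih => simp [coinProg, Prog.Uniform, Prog.NoFlip, ih]

theorem coinProg_depth (l : List Bool) : (coinProg l).depth = 0 := by
  induction l with
  | nil => simp [coinProg, Prog.depth]
  | cons b l ih => simp [coinProg, Prog.depth, ih]

theorem queryProg_bounded (l : List Bool) (R c : ℕ) : (queryProg l R c).Bounded := by
  simp [queryProg, stepProg, resetProg, samplesProg, updateProg, sampleProg, scoreProg, tallyProg,
    drawProg, coinProg_bounded, fillArr_bounded, auction_bounded, Prog.Bounded, Expr.IsSize]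

theorem queryProg_uniform (l : List Bool) (R c : ℕ) : (queryProg l R c).Uniform := by
  simp [queryProg, stepProg, resetProg, samplesProg, updateProg, sampleProg, scoreProg, tallyProg,
    drawProg, coinProg_uniform, (fillArr_noFlip _ _).uniform, auction_noFlip.uniform, Prog.Uniform,
    Prog.NoFlip]

theorem queryProg_depth (l : List Bool) (R c : ℕ) : (queryProg l R c).depth = 8 := by
  simp [queryProg, stepProg, resetProg, samplesProg, updateProg, sampleProg, scoreProg, tallyProg,
    drawProg, coinProg_depth, fillArr, auction_depth, Prog.depth]

/-! ### Approximation -/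

section Approx

variable {n : ℕ} {χ : Fin n → Bool} {G Q : SimpleGraph (Fin n)} {p : ℝ}

theorem coverE_nonneg (hp0 : 0 ≤ p) (hp1 : p ≤ 1) : 0 ≤ coverE χ p G Q :=
  prodE_nonneg (fun _ => rowWeight_nonneg hp0 hp1) fun _ => Nat.cast_nonneg _

theorem coverE_bot : coverE χ p G ⊥ = coverNum (side χ G.Adj) := by
  have h : ∀ z, candidate G ⊥ z = G.Adj := fun z => by
    funext u w; simp [candidate]
  simp only [coverE, h, bernE_const]

theorem coverNum_le_coverE_one : (coverNum (side χ G.Adj) : ℝ) ≤ coverE χ 1 G G := by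
  classical
  have h1 := bernE_prod (ι := Fin n) (κ := Fin n) 1 (fun _ _ b => if b = true then 1 else 0)
  simp only [Fintype.sum_bool, bern] at h1
  norm_num at h1
  calc (coverNum (side χ G.Adj) : ℝ) = coverNum (side χ G.Adj) * bernE (ι := Fin n) (κ := Fin n) 1
        (fun z => ∏ i, ∏ j, if z i j = true then 1 else 0) := by rw [h1, mul_one]
    _ = bernE (ι := Fin n) (κ := Fin n) 1
        (fun z => coverNum (side χ G.Adj) * ∏ i, ∏ j, if z i j = true then 1 else 0) :=
        (prodE_mul_left _ _ _).symm
    _ ≤ coverE χ 1 G G := by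
        refine bernE_mono zero_le_one le_rfl fun z => ?_
        by_cases hz : ∀ i j, z i j = true
        · have : candidate G G z = G.Adj := by
            funext u w; simp [candidate, hz]
          simp [this, hz]
        · push Not at hz
          obtain ⟨i, j, hij⟩ := hz
          have : (∏ i, ∏ j, if z i j = true then (1 : ℝ) else 0) = 0 :=
            Finset.prod_eq_zero (Finset.mem_univ i)
              (Finset.prod_eq_zero (Finset.mem_univ j) (by simp [hij]))
          rw [this, mul_zero]
          exact Nat.cast_nonneg _

/-- Thinning from density `1` keeps a `p`-fraction of the cover number of `G`, and no candidate
graph exceeds `G`. This bounds the damage when the search fails. -/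
theorem coverE_le_div (hχ : ∀ u w, G.Adj u w → χ u ≠ χ w) (hp0 : 0 < p) (hp1 : p ≤ 1) :
    coverE χ p G Q ≤ coverE χ p G G / p := by
  have h1 : coverE χ p G Q ≤ coverE χ p G ⊥ := coverE_anti hp0.le hp1 bot_le
  have h2 := coverE_thin (Q := G) isMatchingRule_auctionRule hχ zero_le_one le_rfl hp0.le hp1
  rw [one_mul] at h2
  rw [le_div_iff₀ hp0, mul_comm]
  refine le_trans (mul_le_mul_of_nonneg_left ?_ hp0.le) h2
  exact h1.trans (coverE_bot.le.trans coverNum_le_coverE_one)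

theorem exists_side (hG : G.IsBipartite) : ∃ χ : Fin n → Bool, ∀ u w, G.Adj u w → χ u ≠ χ w := by
  obtain ⟨c⟩ := hG
  refine ⟨fun u => decide (c u = 0), fun u w huw => ?_⟩
  have h := c.valid huw
  intro hc
  rw [decide_eq_decide] at hc
  apply h
  have h1 := (c u).2
  have h2 := (c w).2
  rw [Fin.ext_iff] at hc ⊢
  rw [Fin.ext_iff] at hc
  simp at hc
  omega

theorem approximates_of_coverE {β : ℝ} {q : unitInterval} (hχ : ∀ u w, G.Adj u w → χ u ≠ χ w)
    (hQ : Q ≤ G) (h : coverE χ q G Q ≤ β * coverE χ q G G) :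
    Approximates coverProg β q G Q := by
  have hB : ∀ Qp ≤ Q, IsMinVertexCover (Qp ⊔ (G \ Q)) (findCover coverProg G Q Qp) :=
    fun Qp hQp => findCover_coverProg hχ hQ hQp
  refine ⟨fun R hR => isVertexCover_findCover hB R hR, ?_⟩
  rw [expectedCover_eq hB hχ hQ, expectedNu_eq hχ]
  exact h

end Approx

/-! ### Running times, constants, and the quality of the result. -/

theorem findCoverTime_coverProg_le : ∃ T, ∀ (n : ℕ) (G Q Qp : SimpleGraph (Fin n)),
    findCoverTime coverProg G Q Qp ≤ T * (n + 1) ^ 8 := by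
  obtain ⟨T, hT⟩ := coverProg_bounded.exists_cost_le
  refine ⟨T, fun n G Q Qp => ?_⟩
  have h := hT (queryInput G Q Qp)
  rw [coverProg_depth] at h
  have h0 : (queryInput G Q Qp).mem 0 0 0 = n := by simp [queryInput]
  rw [h0] at h
  exact h.trans (Nat.mul_le_mul_left _ (Nat.pow_le_pow_right (by omega) (by norm_num)))

theorem findQueryTime_queryProg_le (l : List Bool) (R c : ℕ) : ∃ T, ∀ (n : ℕ)
    (G : SimpleGraph (Fin n)) (ω : ℕ → Bool),
    findQueryTime (queryProg l R c) G ω ≤ T * (n + 1) ^ 8 := by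
  obtain ⟨T, hT⟩ := (queryProg_bounded l R c).exists_cost_le
  refine ⟨T, fun n G ω => ?_⟩
  have h := hT (graphInput G ω)
  rw [queryProg_depth] at h
  have h0 : (graphInput G ω).mem 0 0 0 = n := by simp [graphInput]
  rw [h0] at h
  exact h

theorem findQuery_spec {n : ℕ} {G : SimpleGraph (Fin n)} (l : List Bool) {R : ℕ} (c : ℕ)
    (hR : 0 < R) (ω : ℕ → Bool) : findQuery (queryProg l R c) G ω ≤ G ∧
      ∀ v, ((findQuery (queryProg l R c) G ω).neighborSet v).ncard ≤ R * (2 * R) := by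
  have h := (queryProg_post (c := c) l hR (stepMem_graphInput G ω).1).exec_state
  exact ⟨h.le, h.degree⟩

theorem coinExp_findQuery {n : ℕ} {G : SimpleGraph (Fin n)} (l : List Bool) (R c : ℕ) {M : ℕ}
    (hM : ∀ ω, findQueryTime (queryProg l R c) G ω ≤ M) (f : SimpleGraph (Fin n) → ℝ) :
    coinExp M (fun ω => f (findQuery (queryProg l R c) G ω)) =
      (queryProg l R c).avg (fun m => f (memGraph n m)) (graphInput G fun _ => false).mem := by
  rw [← coinExp_exec (queryProg_uniform l R c) (queryProg_bounded l R c)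
    (graphInput G fun _ => false).mem (hM fun _ => false) (fun m => f (memGraph n m))]
  rfl

/-- The constants of the algorithm. -/
theorem exists_accuracy {β : ℝ} (hβ : (Real.exp 1 + 1) / Real.exp 1 < β) : ∃ β' ε : ℝ,
    β' < β ∧ 0 < ε ∧ ε ≤ 1 / 8 ∧ 1 ≤ β' ∧
      1 + Real.exp (-1) ≤ β' * ((1 - 4 * ε) * (1 - 2 * ε)) := by
  have he : (Real.exp 1 + 1) / Real.exp 1 = 1 + Real.exp (-1) := by
    rw [Real.exp_neg]; field_simp
  rw [he] at hβ
  have hpos := Real.exp_pos (-1)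
  set b := 1 + Real.exp (-1) with hb
  set β' := (b + β) / 2 with hβ'
  have h1 : b < β' := by rw [hβ']; linarith
  have h2 : 1 < β' := by linarith
  refine ⟨β', min (1 / 8) ((β' - b) / (6 * β')), by rw [hβ']; linarith, ?_, min_le_left _ _,
    h2.le, ?_⟩
  · exact lt_min (by norm_num) (div_pos (by linarith) (by linarith))
  · set ε := min (1 / 8) ((β' - b) / (6 * β')) with hε
    -- Sufficient because `(1 - 4ε)(1 - 2ε) ≥ 1 - 6ε`.
    have h3 : ε * (6 * β') ≤ β' - b := by
      rw [← le_div_iff₀ (by linarith)]; exact min_le_right _ _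
    have h4 : β' * (8 * ε ^ 2) ≥ 0 := by positivity
    nlinarith

/-- `R` is `3/(2 ε^5 p)` rounded up. The degree bound `2R²` is then at most `18/(ε^10 p²)`, which is
stronger than the exponent `6`. -/
theorem exists_rounds {ε p : ℝ} (hε : 0 < ε) (hε1 : ε ≤ 1 / 8) (hp0 : 0 < p) (hp1 : p ≤ 1) :
    ∃ R : ℕ, 0 < R ∧ 3 / (R : ℝ) ≤ 2 * ε ^ 5 * p ∧
      ((R * (2 * R) : ℕ) : ℝ) ≤ 18 / ε ^ 10 / p ^ 6 := by
  set x := 3 / (2 * ε ^ 5 * p) with hx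
  have hε5 : ε ^ 5 ≤ 1 := pow_le_one₀ hε.le (by linarith)
  have hd : 0 < 2 * ε ^ 5 * p := by positivity
  have hx1 : 1 ≤ x := by
    rw [hx, le_div_iff₀ hd]
    nlinarith [mul_le_one₀ hε5 hp0.le hp1]
  have hR0 : 0 < ⌈x⌉₊ := Nat.ceil_pos.2 (by linarith)
  have hR1 : x ≤ ⌈x⌉₊ := Nat.le_ceil x
  have hR2 : (⌈x⌉₊ : ℝ) ≤ 2 * x := by
    have := Nat.ceil_lt_add_one (a := x) (by linarith)
    linarith
  refine ⟨⌈x⌉₊, hR0, ?_, ?_⟩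
  · have hR' : (0 : ℝ) < ⌈x⌉₊ := by exact_mod_cast hR0
    rw [div_le_iff₀ hR']
    rw [hx, div_le_iff₀ hd] at hR1
    linarith
  · push_cast
    calc (⌈x⌉₊ : ℝ) * (2 * ⌈x⌉₊) ≤ 2 * x * (2 * (2 * x)) := by gcongr
      _ = 18 / ε ^ 10 / p ^ 2 := by
        rw [hx]; field_simp; norm_num
      _ ≤ 18 / ε ^ 10 / p ^ 6 := by
        apply div_le_div_of_nonneg_left (by positivity) (by positivity)
        exact pow_le_pow_of_le_one hp0.le hp1 (by norm_num)

open Classical in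
/-- The quality of the graph that `queryProg` finds. -/
theorem queryProg_quality {n R c : ℕ} {χ : Fin n → Bool} {G : SimpleGraph (Fin n)} {l : List Bool}
    {β β' ε η : ℝ} {p : unitInterval} (hχ : ∀ u w, G.Adj u w → χ u ≠ χ w) (hp0 : 0 < (p : ℝ))
    (hββ : β' ≤ β) (hε : 0 < ε) (hε1 : ε ≤ 1 / 8)
    (hβε : 1 + Real.exp (-1) ≤ β' * ((1 - 4 * ε) * (1 - 2 * ε)))
    (hl : (1 - 2 * ε) * p ≤ dyadic l) (hu : dyadic l ≤ (1 - ε) * p) (hR : 0 < R)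
    (hRp : 3 / (R : ℝ) ≤ 2 * ε ^ 5 * p) (hc : 0 < c) (hη : (R : ℝ) ^ 3 / c ≤ η)
    (hη1 : η ≤ 1 / 2) (hη2 : η ≤ (β - β') * p) :
    (∃ Q ≤ G, (∀ v, (Q.neighborSet v).ncard ≤ R * (2 * R)) ∧ Approximates coverProg β p G Q) ∧
    1 - 1 / ((n : ℝ) + 1) ≤ (queryProg l R c).avg
      (fun m => if Approximates coverProg β p G (memGraph n m) then 1 else 0)
      (graphInput G fun _ => false).mem ∧
    (queryProg l R c).avg (fun m => expectedCover coverProg p G (memGraph n m))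
      (graphInput G fun _ => false).mem ≤ β * expectedNu p G := by
  have hp1 : (p : ℝ) ≤ 1 := p.2.2
  obtain ⟨hin, hbot⟩ := stepMem_graphInput G fun _ => false
  set m₀ := (graphInput G fun _ => false).mem with hm₀
  set bad : Mem → ℝ := fun m => if GoodChain auctionRule (dyadic l) R G R (memGraph n m)
    then 0 else 1 with hbad
  set opt := coverE χ p G G with hopt
  have hopt0 : 0 ≤ opt := coverE_nonneg hp0.le hp1
  have hn1 : (0 : ℝ) < (n : ℝ) + 1 := by positivity
  have hc' : (0 : ℝ) < c := by exact_mod_cast hc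
  have hbadE : (queryProg l R c).avg bad m₀ ≤ η / ((n : ℝ) + 1) := by
    refine (queryProg_avg_le l hR hc hin hbot).trans ?_
    rw [← div_div]
    gcongr
  have hbadη : (queryProg l R c).avg bad m₀ ≤ η := by
    have hη0 : 0 ≤ η := le_trans (by positivity) hη
    exact hbadE.trans (div_le_self hη0 (by linarith))
  have hpost := queryProg_post (c := c) l hR hin
  have hgood : ∀ Q, GoodChain auctionRule (dyadic l) R G R Q → coverE χ p G Q ≤ β' * opt := by
    intro Q hQ
    have h := coverE_le_of_goodChain isMatchingRule_auctionRule hχ hp0 hp1 hε hε1 hl hu hR hRp hQ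
    have hpos : 0 < (1 - 4 * ε) * (1 - 2 * ε) := mul_pos (by linarith) (by linarith)
    have h2 : (1 + Real.exp (-1)) * opt ≤ β' * ((1 - 4 * ε) * (1 - 2 * ε)) * opt := by gcongr
    have h3 : (1 - 4 * ε) * (1 - 2 * ε) * coverE χ p G Q ≤
        (1 - 4 * ε) * (1 - 2 * ε) * (β' * opt) := by linarith
    exact le_of_mul_le_mul_left h3 hpos
  have happ : ∀ Q ≤ G, GoodChain auctionRule (dyadic l) R G R Q →
      Approximates coverProg β p G Q := fun Q hQG hQ =>
    approximates_of_coverE hχ hQG ((hgood Q hQ).trans (by gcongr))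
  refine ⟨?_, ?_, ?_⟩
  -- Existence from positive probability: the search fails with probability at most `η ≤ 1/2`.
  · by_contra hno
    have h1 : ∀ m, StepMem G (R * (2 * R)) m → (1 : ℝ) ≤ bad m := by
      intro m hm
      rw [hbad]
      simp only
      split_ifs with hg
      · exact absurd ⟨_, hm.le, hm.degree, happ _ hm.le hg⟩ hno
      · exact le_refl _
    have h2 := Prog.Post.avg_mono (f := fun _ => (1 : ℝ)) (hpost.mono h1)
    rw [Prog.avg_const] at h2
    linarith
  · have h1 : (queryProg l R c).avg (fun m => -1 * bad m + 1) m₀ ≤ (queryProg l R c).avg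
        (fun m => if Approximates coverProg β p G (memGraph n m) then 1 else 0) m₀ := by
      refine Prog.Post.avg_mono (hpost.mono fun m hm => ?_)
      rw [hbad]
      simp only
      by_cases hg : GoodChain auctionRule (dyadic l) R G R (memGraph n m)
      · simp [hg, happ _ hm.le hg]
      · simp only [hg, if_false]
        split_ifs <;> norm_num
    rw [Prog.avg_add_const, Prog.avg_mul_const] at h1
    have h2 : η / ((n : ℝ) + 1) ≤ 1 / ((n : ℝ) + 1) := by
      gcongr
      linarith
    linarith
  · have h1 : (queryProg l R c).avg (fun m => expectedCover coverProg p G (memGraph n m)) m₀ ≤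
        -- A good chain costs at most `β' * opt`. A failure costs at most `opt / p`, and its
        -- probability is at most `(β - β') p`, so the slack between `β'` and `β` pays for it.
        (queryProg l R c).avg (fun m => opt / p * bad m + β' * opt) m₀ := by
      refine Prog.Post.avg_mono (hpost.mono fun m hm => ?_)
      rw [expectedCover_eq (fun Qp hQp => findCover_coverProg hχ hm.le hQp) hχ hm.le, hbad]
      simp only
      split_ifs with hg
      · rw [mul_zero, zero_add]
        exact hgood _ hg
      · rw [mul_one]
        have h2 := coverE_le_div (Q := memGraph n m) hχ hp0 hp1
        have h3 : 0 ≤ β' := by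
          by_contra hneg
          have hpos : 0 < (1 - 4 * ε) * (1 - 2 * ε) := mul_pos (by linarith) (by linarith)
          have := Real.exp_pos (-1)
          nlinarith [not_le.1 hneg]
        have h4 := mul_nonneg h3 hopt0
        linarith
    rw [Prog.avg_add_const, Prog.avg_mul_const] at h1
    rw [expectedNu_eq hχ, ← hopt]
    have h2 : opt / p * (queryProg l R c).avg bad m₀ ≤ opt / p * ((β - β') * p) := by
      gcongr
      exact hbadη.trans hη2
    have h3 : opt / p * ((β - β') * p) = (β - β') * opt := by field_simp
    linarith

theorem coinExp_const (M : ℕ) (x : ℝ) : coinExp M (fun _ => x) = x := by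
  rw [coinExp_eq_coinAvg, coinAvg_const]

theorem approximates_of_isEmpty {β : ℝ} (hβ : 1 ≤ β) {p : unitInterval} (hp0 : 0 < (p : ℝ))
    {G Q : SimpleGraph (Fin 0)} : Approximates coverProg β p G Q := by
  have hχ : ∀ u w, G.Adj u w → (fun _ : Fin 0 => true) u ≠ (fun _ : Fin 0 => true) w :=
    fun u => u.elim0
  have hQG : Q = G := by
    ext u
    exact u.elim0
  subst hQG
  refine approximates_of_coverE hχ le_rfl ?_
  exact le_mul_of_one_le_left (coverE_nonneg hp0.le p.2.2) hβ

end StochVC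


theorem theorem6p1 :
    ∃ (d : ℕ) (B : StochVC.Prog) (T₀ : ℕ),
      -- `B` computes a minimum vertex cover of `Q_p ∪ (E ∖ Q)` in polynomial time
      (∀ (n : ℕ) (G : SimpleGraph (Fin n)), G.IsBipartite → ∀ Q ≤ G, ∀ Qp ≤ Q,
        StochVC.findCoverTime B G Q Qp ≤ T₀ * (n + 1) ^ d ∧
        StochVC.IsMinVertexCover (Qp ⊔ (G \ Q)) (StochVC.findCover B G Q Qp)) ∧
      ∀ β : ℝ, (Real.exp 1 + 1) / Real.exp 1 < β →
        ∃ K : ℝ, ∀ p : unitInterval, 0 < p →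
          ∃ (A : StochVC.Prog) (T : ℕ), ∀ (n : ℕ) (G : SimpleGraph (Fin n)), G.IsBipartite →
            -- a good subgraph `Q` exists
            (∃ Q ≤ G, StochVC.DegreesLE Q (K / (p : ℝ) ^ 6) ∧ StochVC.Approximates B β p G Q) ∧
            -- `A` runs in polynomial time and always finds a subgraph of bounded degree
            (∀ ω : ℕ → Bool,
              StochVC.findQueryTime A G ω ≤ T * (n + 1) ^ d ∧
              StochVC.findQuery A G ω ≤ G ∧
              StochVC.DegreesLE (StochVC.findQuery A G ω) (K / (p : ℝ) ^ 6)) ∧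
            -- this subgraph is good with high probability
            1 - 1 / (n : ℝ) ≤ StochVC.coinProb (T * (n + 1) ^ d)
              (fun ω => StochVC.Approximates B β p G (StochVC.findQuery A G ω)) ∧
            -- the expected size over the coins of `A` and the realization of `G`
            StochVC.coinExp (T * (n + 1) ^ d)
              (fun ω => StochVC.expectedCover B p G (StochVC.findQuery A G ω)) ≤
                β * StochVC.expectedNu p G := by
  classical
  obtain ⟨T₀, hT₀⟩ := StochVC.findCoverTime_coverProg_le
  refine ⟨8, StochVC.coverProg, T₀, ?_, ?_⟩
  · intro n G hG Q hQ Qp hQp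
    obtain ⟨χ, hχ⟩ := StochVC.exists_side hG
    exact ⟨hT₀ n G Q Qp, StochVC.findCover_coverProg hχ hQ hQp⟩
  · intro β hβ
    obtain ⟨β', ε, hββ, hε, hε1, hβ1, hβε⟩ := StochVC.exists_accuracy hβ
    refine ⟨18 / ε ^ 10, fun p hp => ?_⟩
    have hp0 : (0 : ℝ) < p := hp
    have hp1 : (p : ℝ) ≤ 1 := p.2.2
    obtain ⟨R, hR, hRp, hRK⟩ := StochVC.exists_rounds hε hε1 hp0 hp1
    obtain ⟨l, hl, hu⟩ := StochVC.exists_dyadic_between (x := (1 - 2 * ε) * p) (y := (1 - ε) * p)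
      (mul_nonneg (by linarith) hp0.le) (by nlinarith) (by nlinarith)
    set η := min (1 / 2) ((β - β') * p) with hη
    have hη0 : 0 < η := lt_min (by norm_num) (mul_pos (by linarith) hp0)
    have hR' : (0 : ℝ) < R := by exact_mod_cast hR
    -- With this many samples, in units of `(n + 1)²` per step, the failure probability `R³/(c (n +
    -- 1))` is at most `η/(n + 1)`.
    set c := ⌈(R : ℝ) ^ 3 / η⌉₊ with hc
    have hc0 : 0 < c := Nat.ceil_pos.2 (by positivity)
    have hcη : (R : ℝ) ^ 3 / c ≤ η := by
      have hc' : (0 : ℝ) < c := by exact_mod_cast hc0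
      have h1 : (R : ℝ) ^ 3 / η ≤ c := Nat.le_ceil _
      rw [div_le_iff₀ hη0] at h1
      rw [div_le_iff₀ hc']
      linarith
    obtain ⟨T, hT⟩ := StochVC.findQueryTime_queryProg_le l R c
    refine ⟨StochVC.queryProg l R c, T, fun n G hG => ?_⟩
    obtain ⟨χ, hχ⟩ := StochVC.exists_side hG
    obtain ⟨⟨Q, hQG, hQd, hQa⟩, hprob, hexp⟩ := StochVC.queryProg_quality hχ hp0 hββ.le hε hε1 hβε
      hl hu hR hRp hc0 hcη (min_le_left _ _) (min_le_right _ _)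
    have hdeg : ∀ Q : SimpleGraph (Fin n), (∀ v, (Q.neighborSet v).ncard ≤ R * (2 * R)) →
        StochVC.DegreesLE Q (18 / ε ^ 10 / (p : ℝ) ^ 6) := fun Q h v =>
      le_trans (by exact_mod_cast h v) hRK
    refine ⟨⟨Q, hQG, hdeg Q hQd, hQa⟩, fun ω => ?_, ?_, ?_⟩
    · have h := StochVC.findQuery_spec (G := G) l c hR ω
      exact ⟨hT n G ω, h.1, hdeg _ h.2⟩
    -- For `n = 0` the division `1 / 0 = 0` makes the claim demand probability one; it holds because
    -- there is only one graph on no vertices.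
    · rcases Nat.eq_zero_or_pos n with rfl | hn
      · have h1 : StochVC.coinProb (T * (0 + 1) ^ 8) (fun ω => StochVC.Approximates
            StochVC.coverProg β p G (StochVC.findQuery (StochVC.queryProg l R c) G ω)) = 1 := by
          unfold StochVC.coinProb
          simp only [StochVC.approximates_of_isEmpty (hβ1.trans hββ.le) hp0, if_true]
          exact StochVC.coinExp_const _ 1
        rw [h1]
        simp
      · have h1 := StochVC.coinExp_findQuery l R c (hT n G)
          (fun Q => if StochVC.Approximates StochVC.coverProg β p G Q then (1 : ℝ) else 0)
        unfold StochVC.coinProb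
        have hn' : (0 : ℝ) < n := by exact_mod_cast hn
        have h2 : 1 / ((n : ℝ) + 1) ≤ 1 / n := one_div_le_one_div_of_le hn' (by linarith)
        refine le_trans ?_ (le_of_eq_of_le rfl (hprob.trans (le_of_eq ?_)))
        · linarith
        · rw [← h1]
    · rw [StochVC.coinExp_findQuery l R c (hT n G)
        (fun Q => StochVC.expectedCover StochVC.coverProg p G Q)]
      exact hexp
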